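/- Let $\mathbb{Z}[i]$ be the ring of Gaussian integers. Call $z\in\mathbb{Z}[i]$ primary if $z\equiv 1 \pmod{2(1+i)}$; writing $z=r+is$, this means that $r$ is odd and $s\equiv r-1\pmod 4$. For $z=r+is$ with $r$ odd and $s$ even let $$[z]=i^{\frac{r-1}{2}}\left(\frac{s}{|r|}\right)$$ be the Jacobi–Kubota symbol, where $\left(\frac{s}{|r|}\right)$ is the Jacobi symbol. Let $d\ge 1$ be an integer, let $\chi$ be a multiplicative character on the residue classes modulo $4d$ in $\mathbb{Z}[i]$ (a character of $(\mathbb{Z}[i]/4d\,\mathbb{Z}[i])^{*}$, extended by $0$ to the non-invertible classes), let $k\in\mathbb{Z}$, and put $\psi(z)=\chi(z)\,(z/|z|)^{k}$ for $z \neq 0$. For every integer $n\ge 1$ define the quadratic eigenvalue $$\lambda(n)=\sum_{\substack{z\ \text{primary}\\ z\bar z=n}}\psi(z)[z].$$ There is an absolute constant $C>0$ such that, for all $d$, $\chi$, $k$ as above, every integer $c\ge 1$ and every real $x\ge 0$ $$\Bigl|\sum_{1 \le n\le x}\Lambda(n)\,\lambda(cn)\Bigr|\le C\,c\,d\,(|k|+1)\,x^{\frac{76}{77}},$$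 where $\Lambda$ is the von Mangoldt function. -/

import Mathlib

noncomputable section

namespace QuadraticEigenvalue

/-- A Gaussian integer `z` is primary if `z ≡ 1 (mod 2(1+i))`. -/
def IsPrimary (z : GaussianInt) : Prop :=
  (2 * ⟨1, 1⟩ : GaussianInt) ∣ z - 1

/-- The Jacobi–Kubota symbol `[z] = i^((r-1)/2) (s / |r|)` of `z = r + is` with `r` odd and `s` even
(so that the integer division is exact), `(s / |r|)` being the Jacobi symbol. -/
def jacobiKubota (z : GaussianInt) : ℂ :=
  Complex.I ^ ((z.re - 1) / 2) * (jacobiSym z.im z.re.natAbs : ℂ)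

/-- Multiplicative characters on the residue classes modulo `4d` in `ℤ[i]`: characters of
`(ℤ[i] / 4d ℤ[i])ˣ`, extended by `0` to the classes that are not invertible. -/
abbrev ResidueChar (d : ℕ) : Type :=
  MulChar (GaussianInt ⧸ Ideal.span {(4 * d : GaussianInt)}) ℂ

/-- The Grössencharacter `ψ(z) = χ(z) (z/|z|)^k`. -/
def grossenchar {d : ℕ} (χ : ResidueChar d) (k : ℤ) (z : GaussianInt) : ℂ :=
  χ (Ideal.Quotient.mk _ z) *
    (GaussianInt.toComplex z / (‖GaussianInt.toComplex z‖ : ℂ)) ^ k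

theorem finite_primary_norm_eq (n : ℕ) :
    {z : GaussianInt | IsPrimary z ∧ z * star z = n}.Finite := by
  have hf : ((Set.Icc (-(n : ℤ)) n) ×ˢ (Set.Icc (-(n : ℤ)) n)).Finite :=
    (Set.finite_Icc _ _).prod (Set.finite_Icc _ _)
  refine (hf.preimage (f := fun z : GaussianInt => (z.re, z.im)) ?_).subset ?_
  · intro a _ b _ h
    simp only [Prod.mk.injEq] at h
    exact Zsqrtd.ext h.1 h.2
  · rintro z ⟨-, hz⟩
    have h := congrArg Zsqrtd.re hz
    simp only [Zsqrtd.re_mul, Zsqrtd.re_star, Zsqrtd.im_star, Zsqrtd.re_natCast] at h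
    simp only [Set.mem_preimage, Set.mem_prod, Set.mem_Icc]
    refine ⟨⟨?_, ?_⟩, ?_, ?_⟩ <;>
      nlinarith [mul_self_nonneg z.re, mul_self_nonneg z.im, Int.le_self_sq z.re,
        Int.le_self_sq z.im, Int.le_self_sq (-z.re), Int.le_self_sq (-z.im)]

/-- The quadratic eigenvalue `λ(n) = ∑ ψ(z) [z]`, summed over the primary `z` with `z z̄ = n`. -/
def eigenvalue {d : ℕ} (χ : ResidueChar d) (k : ℤ) (n : ℕ) : ℂ :=
  ∑ z ∈ (finite_primary_norm_eq n).toFinset, grossenchar χ k z * jacobiKubota z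

end QuadraticEigenvalue

end

/-! The symbol [z] is multiplicative only up to a twist. For primary w, z with w primitive, [wz] =
[w][z](z/w)ε, where (z/w) is a quadratic residue symbol in ℤ[i] and ε is a product of real Hilbert
symbols depending only on signs of coordinates (`jacobiKubota_mul`, `kubotaSign`). The factor
i^((r-1)/2) in [z] is what absorbs the 2-adic Hilbert symbols produced by reciprocity. This twist
destroys the multiplicativity of λ, but it oscillates, and that makes bilinear sums small. No
L-function enters: the sum over primes is treated by Vaughan's identity
(`norm_sum_vonMangoldt_mul_le`) from two kinds of estimates.

The passage from integers to Gaussian integers rests on unique factorization: a primitive primary Z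
has exactly one primary divisor of each norm a dividing its norm (`existsUnique_primary_dvd`), and
[Z] = 0 for imprimitive Z. Hence λ(ab) is a double sum over primary w, z of norms a, b for all a and
b, coprime or not, and c only contributes one more fixed factor.

Type II (`exists_bilinear_hyperbola_le`). Bilinear forms in (z/w) with arbitrary bounded
coefficients are O(M^(1+η) N^(11/12)) for N ≤ M: Hölder with exponent 6 in w, multiplicativity in z
to merge six variables into one, Cauchy, and a second moment in which only pairs with N(w)N(w') a
square fail to cancel. The sign ε depends on a comparison u/v < s/r and on the sign of r, so it is
separated by finite Fourier analysis at the cost of a logarithm (`norm_bilinear_ite_lt_le`), as is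
the hyperbola condition.

Type I (`exists_sum_grossenchar_jacobiKubota_le`). For fixed W the sum over z = r + is is taken row
by row. On a row [Wz] is (s/|r|) times a weight periodic in s, a sign with one change and a monotone
phase, so Pólya–Vinogradov saves unless |r| is a divisor of 4d·N(W) times a square; such rows are
few. The result is X^(3/4+η).

With Vaughan's parameter X^(2/11) the type II terms are about X^(1-1/66) and the type I terms about
X^(43/44). Both are below X^(76/77) with room for the η-losses. For c > x the factor c in the bound
makes the trivial estimate enough. -/

noncomputable section

namespace QuadraticEigenvalue

/-! ### The Jacobi symbol with a signed modulus -/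

/-- The Jacobi symbol `(a / |b|)` for a signed modulus `b`. -/
def signedJacobi (a b : ℤ) : ℤ := jacobiSym a b.natAbs

/-- The Hilbert symbol at the real place. -/
def realHilbert (a b : ℤ) : ℤ := if a < 0 ∧ b < 0 then -1 else 1

/-- The sign in quadratic reciprocity for odd integers. -/
def oddHilbert (a b : ℤ) : ℤ := if a % 4 = 3 ∧ b % 4 = 3 then -1 else 1

theorem signedJacobi_mul_left (a b c : ℤ) :
    signedJacobi (a * b) c = signedJacobi a c * signedJacobi b c :=
  jacobiSym.mul_left a b _

theorem signedJacobi_mul_right (a : ℤ) {b c : ℤ} (hb : b ≠ 0) (hc : c ≠ 0) :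
    signedJacobi a (b * c) = signedJacobi a b * signedJacobi a c := by
  unfold signedJacobi
  rw [Int.natAbs_mul, jacobiSym.mul_right' a (by simpa using hb) (by simpa using hc)]

theorem signedJacobi_congr {a a' b : ℤ} (h : b ∣ a - a') :
    signedJacobi a b = signedJacobi a' b := by
  unfold signedJacobi
  refine jacobiSym.mod_left' ?_
  exact ((Int.modEq_iff_dvd).2 (Int.natAbs_dvd.2 h)).symm

theorem signedJacobi_mul_self {a b : ℤ} (h : IsCoprime a b) :
    signedJacobi a b * signedJacobi a b = 1 := by
  unfold signedJacobi
  have : a.gcd b.natAbs = 1 := by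
    simpa only [Int.gcd, Int.natAbs_natCast] using Int.isCoprime_iff_gcd_eq_one.1 h
  have := jacobiSym.sq_one this
  rwa [sq] at this

theorem signedJacobi_neg_one {b : ℤ} (hb : b % 2 = 1) :
    signedJacobi (-1) b = b.sign * (if b % 4 = 1 then 1 else -1) := by
  unfold signedJacobi
  rw [jacobiSym.at_neg_one (by rw [Nat.odd_iff]; omega), ZMod.χ₄_nat_eq_if_mod_four]
  rcases lt_or_gt_of_ne (show b ≠ 0 by rintro rfl; simp at hb) with h | h
  · rw [Int.sign_eq_neg_one_of_neg h]
    split_ifs <;> omega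
  · rw [Int.sign_eq_one_of_pos h]
    split_ifs <;> omega

theorem signedJacobi_two {b : ℤ} (hb : b % 2 = 1) :
    signedJacobi 2 b = if b % 8 = 1 ∨ b % 8 = 7 then 1 else -1 := by
  unfold signedJacobi
  rw [jacobiSym.at_two (by rw [Nat.odd_iff]; omega), ZMod.χ₈_nat_eq_if_mod_eight]
  split_ifs <;> omega

/-- Signs are peeled off through (-1/·), which leaves the classical law for absolute values.
Coprimality is not needed, since otherwise both symbols vanish. -/
theorem signedJacobi_reciprocity {a b : ℤ} (ha : a % 2 = 1) (hb : b % 2 = 1) :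
    signedJacobi a b = oddHilbert a b * realHilbert a b * signedJacobi b a := by
  have key : ∀ c : ℤ, c % 2 = 1 → ∀ e : ℤ, signedJacobi e c =
      (if e < 0 then c.sign * (if c % 4 = 1 then 1 else -1) else 1) *
        jacobiSym e.natAbs c.natAbs := by
    intro c hc e
    rcases lt_or_ge e 0 with he | he
    · rw [if_pos he, ← signedJacobi_neg_one hc]
      have : e = -1 * (e.natAbs : ℤ) := by omega
      conv_lhs => rw [this, signedJacobi_mul_left]
      rfl
    · have : e = (e.natAbs : ℤ) := by omega
      conv_lhs => rw [this]
      rw [if_neg (by omega), one_mul]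
      rfl
  rw [key b hb a, key a ha b]
  have hq := jacobiSym.quadratic_reciprocity_if (a := a.natAbs) (b := b.natAbs) (by omega) (by omega)
  rw [← hq]
  unfold oddHilbert realHilbert
  have ha4 : a % 4 = 1 ∨ a % 4 = 3 := by omega
  have hb4 : b % 4 = 1 ∨ b % 4 = 3 := by omega
  rcases lt_or_gt_of_ne (show a ≠ 0 by rintro rfl; simp at ha) with h | h <;>
  rcases lt_or_gt_of_ne (show b ≠ 0 by rintro rfl; simp at hb) with h' | h' <;>
  rcases ha4 with ha4 | ha4 <;> rcases hb4 with hb4 | hb4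
  all_goals
    first
      | rw [Int.sign_eq_neg_one_of_neg h]
      | rw [Int.sign_eq_one_of_pos h]
    first
      | rw [Int.sign_eq_neg_one_of_neg h']
      | rw [Int.sign_eq_one_of_pos h']
    split_ifs <;> omega

theorem I_zpow_half {r : ℤ} (hr : r % 2 = 1) :
    Complex.I ^ ((r - 1) / 2) =
      if r % 8 = 1 then 1 else if r % 8 = 3 then Complex.I else
        if r % 8 = 5 then -1 else -Complex.I := by
  have h : Complex.I ^ ((r - 1) / 2) = Complex.I ^ (((r - 1) / 2) % 4) := by
    conv_lhs => rw [← Int.mul_ediv_add_emod ((r - 1) / 2) 4]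
    rw [zpow_add₀ Complex.I_ne_zero, zpow_mul]
    have : (Complex.I ^ (4 : ℤ)) = 1 := by exact_mod_cast Complex.I_pow_four
    rw [this, one_zpow, one_mul]
  rw [h]
  have : r % 8 = 1 ∨ r % 8 = 3 ∨ r % 8 = 5 ∨ r % 8 = 7 := by omega
  rcases this with h | h | h | h
  · rw [show ((r - 1) / 2) % 4 = 0 by omega]; simp [h]
  · rw [show ((r - 1) / 2) % 4 = 1 by omega]; simp [h]
  · rw [show ((r - 1) / 2) % 4 = 2 by omega]
    rw [show ((2 : ℤ)) = ((2 : ℕ) : ℤ) by norm_num, zpow_natCast]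
    simp [h]
  · rw [show ((r - 1) / 2) % 4 = 3 by omega]
    rw [show ((3 : ℤ)) = ((3 : ℕ) : ℤ) by norm_num, zpow_natCast, Complex.I_pow_three]
    simp [h]

/-- Bookkeeping at the prime 2 for `signedJacobi_twist_of_factor`: the reciprocity flips made there
leave these symbols, and everything depends on residues modulo 4 only. -/
theorem oddHilbert_product {u r g v : ℤ} (hu : u % 2 = 1) (hr : r % 2 = 1) (hg : g % 2 = 1)
    (hv : v % 2 = 1) {R : ℤ} (hR : R % 4 = (u * r) % 4) :
    oddHilbert v R * oddHilbert r R * oddHilbert v r * oddHilbert u (g * v) *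
      (if r % 4 = 1 then 1 else -1) = oddHilbert (g * r) u := by
  unfold oddHilbert
  have h1 := Int.mul_emod u r 4
  have h2 := Int.mul_emod g v 4
  have h3 := Int.mul_emod g r 4
  have hu : u % 4 = 1 ∨ u % 4 = 3 := by omega
  have hr : r % 4 = 1 ∨ r % 4 = 3 := by omega
  have hg : g % 4 = 1 ∨ g % 4 = 3 := by omega
  have hv : v % 4 = 1 ∨ v % 4 = 3 := by omega
  rcases hu with hu | hu <;> rcases hr with hr | hr <;> rcases hg with hg | hg <;>
    rcases hv with hv | hv <;> rw [hu, hr] at h1 <;> rw [hg, hv] at h2 <;> rw [hg, hr] at h3 <;>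
    norm_num at h1 h2 h3 <;> rw [h1] at hR <;> simp [hR, h2, h3, hu, hr, hv]

/-- Since (ur-1)/2 = (u-1)/2 + (r-1)/2 + 2·((u-1)/2)·((r-1)/2), the function i^((r-1)/2) is
multiplicative up to the sign `oddHilbert r u`. Replacing ur by ur + 4 flips both i^((R-1)/2) and
(2/R), and these flips cancel when (2/·) occurs to the first power. -/
theorem I_zpow_half_mul {u r R : ℤ} (hu : u % 2 = 1) (hr : r % 2 = 1) (a : ℕ)
    (h : R % 8 = (u * r) % 8 ∨ (a = 1 ∧ R % 8 = (u * r + 4) % 8)) :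
    (((signedJacobi 2 R * signedJacobi 2 r * signedJacobi 2 u) ^ a * oddHilbert r u : ℤ) : ℂ) *
      Complex.I ^ ((R - 1) / 2) = Complex.I ^ ((u - 1) / 2) * Complex.I ^ ((r - 1) / 2) := by
  have h1 := Int.mul_emod u r 8
  have hR : R % 2 = 1 := by
    have : (u * r) % 2 = 1 := by rw [Int.mul_emod, hu, hr]; rfl
    omega
  rw [I_zpow_half hu, I_zpow_half hr, I_zpow_half hR, signedJacobi_two hu, signedJacobi_two hr,
    signedJacobi_two hR]
  unfold oddHilbert
  have hu : u % 8 = 1 ∨ u % 8 = 3 ∨ u % 8 = 5 ∨ u % 8 = 7 := by omega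
  have hr : r % 8 = 1 ∨ r % 8 = 3 ∨ r % 8 = 5 ∨ r % 8 = 7 := by omega
  have hI : Complex.I * Complex.I = -1 := Complex.I_mul_I
  have e4 : ∀ x : ℤ, x % 4 = (x % 8) % 4 := by intro x; omega
  rw [e4 r, e4 u]
  rcases hu with hu | hu | hu | hu <;> rcases hr with hr | hr | hr | hr <;> rw [hu, hr] at h1 <;>
    norm_num at h1 <;> rcases h with h | ⟨rfl, h⟩ <;>
    first
      | rw [h1] at h; simp [h, hu, hr]
      | (replace h : R % 8 = ((u * r) % 8 + 4) % 8 := by rw [h]; omega)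
        rw [h1] at h; norm_num at h; simp [h, hu, hr]

theorem realHilbert_congr {a a' b b' : ℤ} (ha : a < 0 ↔ a' < 0) (hb : b < 0 ↔ b' < 0) :
    realHilbert a b = realHilbert a' b' := by
  unfold realHilbert; simp only [ha, hb]

theorem signedJacobi_two_pow_mul (a : ℕ) (v b : ℤ) :
    signedJacobi (2 ^ a * v) b = signedJacobi 2 b ^ a * signedJacobi v b := by
  rw [signedJacobi_mul_left]
  unfold signedJacobi
  rw [jacobiSym.pow_left]

/-- The real factor in the multiplication rule for the Jacobi–Kubota symbol. -/
def kubotaSign (u v r R : ℤ) : ℤ :=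
  r.sign * realHilbert r R * realHilbert v R * realHilbert v r * realHilbert u v

/-- This is the twisted multiplication rule in coordinates, with w = u + iv and z = r + is, so that
R = ur - vs and us + vr are the real and imaginary parts of wz. With g = gcd(r, v) one has R = gR'.
Modulo g the numerator is us. Modulo R' it is, up to the factor v', equal to r'(u² + v²), so N(w)
appears, and reciprocity turns the rest into (v/u)(s/r) times symbols at 2 and at infinity. -/
theorem signedJacobi_twist_of_factor {u v r s g r' v' v'' : ℤ} {a : ℕ} (hu : u % 2 = 1)
    (hs : s % 2 = 0) (ha : 1 ≤ a) (hg : 0 < g) (hr : r = g * r') (hv : v = g * v') (hv' : v' = 2 ^ a * v'')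
    (hg2 : g % 2 = 1) (hr2 : r' % 2 = 1) (hv2 : v'' % 2 = 1) (hrv : IsCoprime r' v')
    (huv : IsCoprime u v) :
    Complex.I ^ ((u * r - v * s - 1) / 2) * (signedJacobi (u * s + v * r) (u * r - v * s) : ℂ) =
      Complex.I ^ ((u - 1) / 2) * (signedJacobi v u : ℂ) *
      (Complex.I ^ ((r - 1) / 2) * (signedJacobi s r : ℂ)) *
      (signedJacobi (u * r - v * s) (u ^ 2 + v ^ 2) : ℂ) *
      (kubotaSign u v r (u * r - v * s) : ℂ) := by
  obtain ⟨R', hR'⟩ : ∃ R', R' = u * r' - v' * s := ⟨_, rfl⟩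
  have hRR : u * r - v * s = g * R' := by rw [hR', hr, hv]; ring
  have hr0 : r' ≠ 0 := by rintro rfl; simp at hr2
  have hg0 : g ≠ 0 := hg.ne'
  have hv0 : v'' ≠ 0 := by rintro rfl; simp at hv2
  have hu0 : u ≠ 0 := by rintro rfl; simp at hu
  have odd_mul : ∀ {x y : ℤ}, x % 2 = 1 → y % 2 = 1 → (x * y) % 2 = 1 := by
    intro x y hx hy; rw [Int.mul_emod, hx, hy]; rfl
  obtain ⟨s', rfl⟩ : ∃ s', s = 2 * s' := ⟨s / 2, by omega⟩
  obtain ⟨b, rfl⟩ : ∃ b, a = b + 1 := ⟨a - 1, by omega⟩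
  have hv's : v' * (2 * s') = 4 * (2 ^ b * v'' * s') := by rw [hv']; ring
  have hR4 : R' % 4 = (u * r') % 4 := by rw [hR', hv's]; omega
  have hR2 : R' % 2 = 1 := by have := odd_mul hu hr2; omega
  have hR0 : R' ≠ 0 := by rintro h; simp [h] at hR2
  have hug : IsCoprime u g := huv.of_isCoprime_of_dvd_right ⟨v', hv⟩
  have huv' : IsCoprime u v' := huv.of_isCoprime_of_dvd_right ⟨g, by rw [hv]; ring⟩
  have hvv : v'' ∣ v' := ⟨2 ^ (b + 1), by rw [hv']; ring⟩
  have hvR : IsCoprime v' R' := by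
    have : IsCoprime v' (u * r' + v' * (-(2 * s'))) :=
      (huv'.symm.mul_right hrv.symm).add_mul_left_right _
    convert this using 1; rw [hR']; ring
  obtain ⟨q, hq⟩ : ∃ q, q = u ^ 2 + v ^ 2 := ⟨_, rfl⟩
  have hu4 : u ^ 2 % 4 = 1 := by
    have : u % 4 = 1 ∨ u % 4 = 3 := by omega
    rcases this with h | h <;> rw [pow_two, Int.mul_emod, h] <;> rfl
  have hq4 : q % 4 = 1 := by
    have : v ^ 2 = 4 * (g * 2 ^ b * v'') ^ 2 := by rw [hv, hv']; ring
    rw [hq, this]; omega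
  have hq0 : 0 < q := by rw [hq]; positivity
  -- the symbol modulo the two factors of the modulus
  have e1 : signedJacobi (u * (2 * s') + v * r) (g * R') =
      signedJacobi u g * signedJacobi (2 * s') g * signedJacobi (u * (2 * s') + v * r) R' := by
    rw [signedJacobi_mul_right _ hg0 hR0, ← signedJacobi_mul_left,
      signedJacobi_congr (a := u * (2 * s') + v * r) (a' := u * (2 * s')) (b := g)
        ⟨v' * r, by rw [hv]; ring⟩]
  -- The central congruence: v'(us + vr) - q r' = -u R', because vr = g²v'r' makes the remaining
  -- terms cancel.
  have e2 : signedJacobi v' R' * signedJacobi (u * (2 * s') + v * r) R' =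
      signedJacobi q R' * signedJacobi r' R' := by
    rw [← signedJacobi_mul_left, ← signedJacobi_mul_left]
    refine signedJacobi_congr ⟨-u, ?_⟩
    rw [hR', hq, hr, hv]; ring
  have e2' : signedJacobi (u * (2 * s') + v * r) R' =
      signedJacobi v' R' * (signedJacobi q R' * signedJacobi r' R') := by
    linear_combination (-signedJacobi (u * (2 * s') + v * r) R') * signedJacobi_mul_self hvR +
      signedJacobi v' R' * e2
  have hrec1 : ∀ {x : ℤ}, x % 2 = 1 → signedJacobi q x = signedJacobi x q := by
    intro x hx
    rw [signedJacobi_reciprocity (by omega) hx]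
    have h1 : oddHilbert q x = 1 := by unfold oddHilbert; rw [if_neg (by omega)]
    have h2 : realHilbert q x = 1 := by unfold realHilbert; rw [if_neg (by omega)]
    rw [h1, h2, one_mul, one_mul]
  have e3 : signedJacobi q R' = signedJacobi (g * R') q := by
    rw [hrec1 hR2, signedJacobi_mul_left, ← hrec1 hg2,
      signedJacobi_congr (a := q) (a' := u * u) (b := g) ⟨v' * v, by rw [hq, hv]; ring⟩,
      signedJacobi_mul_left, signedJacobi_mul_self hug, one_mul]
  have e4 : signedJacobi R' r' =
      signedJacobi (-1) r' * signedJacobi v' r' * signedJacobi (2 * s') r' := by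
    rw [← signedJacobi_mul_left, ← signedJacobi_mul_left]
    exact signedJacobi_congr ⟨u, by rw [hR']; ring⟩
  have e5 : signedJacobi R' v'' = signedJacobi u v'' * signedJacobi r' v'' := by
    rw [← signedJacobi_mul_left]
    refine signedJacobi_congr (dvd_trans hvv ⟨-(2 * s'), by rw [hR']; ring⟩)
  have e6 : signedJacobi r' v'' * signedJacobi r' v'' = 1 :=
    signedJacobi_mul_self (hrv.of_isCoprime_of_dvd_right hvv)
  have e7 : signedJacobi u g * signedJacobi u v'' =
      oddHilbert u (g * v'') * realHilbert u (g * v'') * signedJacobi (g * v'') u := by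
    rw [← signedJacobi_mul_right u hg0 hv0, signedJacobi_reciprocity hu (odd_mul hg2 hv2)]
  have e8 : signedJacobi (2 * s') r = signedJacobi (2 * s') g * signedJacobi (2 * s') r' := by
    rw [hr, signedJacobi_mul_right _ hg0 hr0]
  have e9 : signedJacobi v u = signedJacobi 2 u ^ (b + 1) * signedJacobi (g * v'') u := by
    rw [← signedJacobi_two_pow_mul, hv, hv']; congr 1; ring
  have hsq : ∀ {x : ℤ}, x % 2 = 1 → signedJacobi 2 x * signedJacobi 2 x = 1 := by
    intro x hx; rw [signedJacobi_two hx]; split_ifs <;> rfl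
  have e10 : signedJacobi 2 R' * signedJacobi 2 r' =
      signedJacobi 2 (g * R') * signedJacobi 2 r := by
    rw [hr, signedJacobi_mul_right _ hg0 hR0, signedJacobi_mul_right _ hg0 hr0]
    linear_combination (-(signedJacobi 2 R' * signedJacobi 2 r')) * hsq hg2
  have hpm : (signedJacobi 2 u ^ (b + 1)) * (signedJacobi 2 u ^ (b + 1)) = 1 := by
    rw [← mul_pow, hsq hu, one_pow]
  have hA := oddHilbert_product hu hr2 hg2 hv2 hR4
  rw [← hr] at hA
  have hB := I_zpow_half_mul (u := u) (r := r) (R := g * R') hu (by rw [hr]; exact odd_mul hg2 hr2)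
    (b + 1) (by
      have hd : g * R' = u * r - 4 * (2 ^ b * (g * v'' * s')) := by rw [← hRR, hv, hv']; ring
      -- Here vs = 4·2^b·(…), so R can differ from ur modulo 8 only when b = 0, that is a = 1, as
      -- `I_zpow_half_mul` permits.
      rcases Nat.eq_zero_or_pos b with rfl | hb
      · rw [hd]; simp only [pow_zero, one_mul]
        rcases Int.emod_two_eq_zero_or_one (g * v'' * s') with h | h
        · left; omega
        · exact Or.inr ⟨trivial, by omega⟩
      · obtain ⟨c, rfl⟩ : ∃ c, b = c + 1 := ⟨b - 1, by omega⟩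
        left; rw [hd, pow_succ, show 4 * (2 ^ c * 2 * (g * v'' * s')) = 8 * (2 ^ c * (g * v'' * s')) by ring]
        omega)
  have hsr : r.sign = r'.sign := by rw [hr, Int.sign_mul, Int.sign_eq_one_of_pos hg, one_mul]
  have hvneg : v < 0 ↔ v'' < 0 := by
    rw [hv, hv', ← mul_assoc]
    exact ⟨fun h => by by_contra h'; have : 0 ≤ g * 2 ^ (b + 1) * v'' := by push Not at h'; positivity
                       omega,
      fun h => mul_neg_of_pos_of_neg (by positivity) h⟩
  have hneg : ∀ x : ℤ, g * x < 0 ↔ x < 0 := fun x =>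
    ⟨fun h => by by_contra h'; have : 0 ≤ g * x := by push Not at h'; positivity
                 omega, fun h => mul_neg_of_pos_of_neg hg h⟩
  have hE : kubotaSign u v r (g * R') =
      r'.sign * realHilbert r' R' * realHilbert v'' R' * realHilbert v'' r' *
        realHilbert u (g * v'') := by
    unfold kubotaSign
    rw [hsr, hr, realHilbert_congr (hneg r') (hneg R'), realHilbert_congr hvneg (hneg R'),
      realHilbert_congr hvneg (hneg r'), realHilbert_congr Iff.rfl (hvneg.trans (hneg v'').symm)]
  have main : signedJacobi (u * (2 * s') + v * r) (g * R') =
      signedJacobi v u * signedJacobi (2 * s') r * signedJacobi (g * R') q *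
      kubotaSign u v r (g * R') *
      ((signedJacobi 2 (g * R') * signedJacobi 2 r * signedJacobi 2 u) ^ (b + 1) *
        oddHilbert r u) := by
    rw [hE, ← hA, e1, e2', e3, signedJacobi_reciprocity hr2 hR2, e4, signedJacobi_neg_one hr2, e8, e9]
    conv_lhs => rw [hv', signedJacobi_two_pow_mul, signedJacobi_two_pow_mul,
      signedJacobi_reciprocity hv2 hR2, e5, signedJacobi_reciprocity hv2 hr2]
    rw [← e10, mul_pow, mul_pow]
    generalize signedJacobi 2 R' ^ (b + 1) = x1 at *
    generalize signedJacobi 2 r' ^ (b + 1) = x2 at *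
    generalize signedJacobi 2 u ^ (b + 1) = x3 at *
    generalize signedJacobi (2 * s') g = x4 at *
    generalize signedJacobi (2 * s') r' = x5 at *
    generalize signedJacobi (g * R') q = x6 at *
    generalize (if r' % 4 = 1 then (1 : ℤ) else -1) = x7 at *
    generalize signedJacobi u g = y1 at *
    generalize signedJacobi u v'' = y2 at *
    generalize signedJacobi (g * v'') u = y3 at *
    generalize signedJacobi r' v'' = y4 at *
    generalize oddHilbert u (g * v'') = y5 at *
    generalize realHilbert u (g * v'') = y6 at *
    generalize oddHilbert v'' R' = y7 at *
    generalize oddHilbert r' R' = y8 at *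
    generalize oddHilbert v'' r' = y9 at *
    generalize realHilbert v'' R' = z7 at *
    generalize realHilbert r' R' = z8 at *
    generalize realHilbert v'' r' = z9 at *
    generalize r'.sign = z0 at *
    linear_combination
      (x1 * x2 * x4 * x5 * x6 * x7 * y7 * y8 * y9 * z7 * z8 * z9 * z0 * y4 * y4) * e7 +
      (x1 * x2 * x4 * x5 * x6 * x7 * y7 * y8 * y9 * z7 * z8 * z9 * z0 * y5 * y6 * y3) * e6 -
      (x1 * x2 * x4 * x5 * x6 * x7 * y7 * y8 * y9 * z7 * z8 * z9 * z0 * y5 * y6 * y3) * hpm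
  rw [hRR, ← hq, main]
  push_cast at hB ⊢
  linear_combination ((signedJacobi v u : ℂ) * (signedJacobi (2 * s') r : ℂ) *
    (signedJacobi (g * R') q : ℂ) * (kubotaSign u v r (g * R') : ℂ)) * hB

/-! ### Gaussian integers -/

/-- The norm of a Gaussian integer as a natural number. -/
def gnorm (z : GaussianInt) : ℕ := z.norm.natAbs

theorem gnorm_cast (z : GaussianInt) : (gnorm z : ℤ) = z.re ^ 2 + z.im ^ 2 := by
  unfold gnorm
  rw [GaussianInt.abs_natCast_norm, Zsqrtd.norm_def]; ring

theorem gnorm_mul (z w : GaussianInt) : gnorm (z * w) = gnorm z * gnorm w := by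
  unfold gnorm; rw [Zsqrtd.norm_mul, Int.natAbs_mul]

@[simp] theorem gnorm_one : gnorm 1 = 1 := by simp [gnorm]

theorem gnorm_pos {z : GaussianInt} (hz : z ≠ 0) : 0 < gnorm z :=
  Int.natAbs_pos.2 (GaussianInt.norm_pos.2 hz).ne'

theorem mul_star_eq_gnorm (z : GaussianInt) : z * star z = (gnorm z : GaussianInt) := by
  rw [← Zsqrtd.norm_eq_mul_conj, gnorm, GaussianInt.natCast_natAbs_norm]

theorem isPrimary_iff (z : GaussianInt) :
    IsPrimary z ↔ z.re % 2 = 1 ∧ (z.im - z.re + 1) % 4 = 0 := by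
  constructor
  · rintro ⟨w, hw⟩
    have h1 := congrArg Zsqrtd.re hw
    have h2 := congrArg Zsqrtd.im hw
    simp at h1 h2
    omega
  · rintro ⟨h1, h2⟩
    refine ⟨⟨(z.re - 1 + z.im) / 4, (z.im - z.re + 1) / 4⟩, ?_⟩
    ext
    · simp; omega
    · simp; omega

theorem IsPrimary.re_odd {z : GaussianInt} (h : IsPrimary z) : z.re % 2 = 1 :=
  ((isPrimary_iff z).1 h).1

theorem IsPrimary.im_even {z : GaussianInt} (h : IsPrimary z) : z.im % 2 = 0 := by
  have := (isPrimary_iff z).1 h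
  omega

theorem IsPrimary.mul {z w : GaussianInt} (hz : IsPrimary z) (hw : IsPrimary w) :
    IsPrimary (z * w) := by
  have h : z * w - 1 = z * (w - 1) + (z - 1) := by ring
  unfold IsPrimary at *
  rw [h]
  exact dvd_add (hw.mul_left z) hz

theorem IsPrimary.ne_zero {z : GaussianInt} (hz : IsPrimary z) : z ≠ 0 := by
  rintro rfl
  have := hz.re_odd
  simp at this

theorem IsPrimary.gnorm_mod_four {z : GaussianInt} (hz : IsPrimary z) : gnorm z % 4 = 1 := by
  have h := gnorm_cast z
  have h1 := hz.re_odd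
  have h2 := hz.im_even
  obtain ⟨a, ha⟩ : ∃ a, z.re = 2 * a + 1 := ⟨z.re / 2, by omega⟩
  obtain ⟨b, hb⟩ : ∃ b, z.im = 2 * b := ⟨z.im / 2, by omega⟩
  rw [ha, hb, show (2 * a + 1) ^ 2 + (2 * b) ^ 2 = 4 * (a ^ 2 + a + b ^ 2) + 1 by ring] at h
  omega

theorem exists_isPrimary_of_gnorm_odd {z : GaussianInt} (hz : gnorm z % 2 = 1) :
    ∃ u : GaussianInt, IsUnit u ∧ IsPrimary (u * z) := by
  have h := gnorm_cast z
  have hpar : (z.re % 2 = 1 ∧ z.im % 2 = 0) ∨ (z.re % 2 = 0 ∧ z.im % 2 = 1) := by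
    have h' : (z.re * z.re + z.im * z.im) % 2 = 1 := by
      rw [show z.re * z.re + z.im * z.im = z.re ^ 2 + z.im ^ 2 by ring, ← h]; omega
    rw [Int.add_emod, Int.mul_emod, Int.mul_emod z.im] at h'
    rcases Int.emod_two_eq_zero_or_one z.re with h1 | h1 <;>
      rcases Int.emod_two_eq_zero_or_one z.im with h2 | h2 <;> simp [h1, h2] at h' ⊢
  have unit : ∀ a b : ℤ, a ^ 2 + b ^ 2 = 1 → IsUnit (⟨a, b⟩ : GaussianInt) := by
    intro a b hab
    rw [← Zsqrtd.norm_eq_one_iff' (by norm_num), Zsqrtd.norm_def]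
    simp only; linarith
  have key : ∀ a b : ℤ, a ^ 2 + b ^ 2 = 1 → (a * z.re - b * z.im) % 2 = 1 →
      ((a * z.im + b * z.re) - (a * z.re - b * z.im) + 1) % 4 = 0 →
      ∃ u : GaussianInt, IsUnit u ∧ IsPrimary (u * z) := by
    intro a b hab h1 h2
    refine ⟨⟨a, b⟩, unit a b hab, (isPrimary_iff _).2 ?_⟩
    simp only [Zsqrtd.re_mul, Zsqrtd.im_mul]
    rw [show a * z.re + -1 * b * z.im = a * z.re - b * z.im by ring]
    exact ⟨h1, h2⟩
  rcases hpar with ⟨h1, h2⟩ | ⟨h1, h2⟩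
  · by_cases h4 : (z.im - z.re + 1) % 4 = 0
    · exact key 1 0 (by norm_num) (by omega) (by omega)
    · exact key (-1) 0 (by norm_num) (by omega) (by omega)
  · by_cases h4 : (z.re + z.im + 1) % 4 = 0
    · exact key 0 1 (by norm_num) (by omega) (by omega)
    · exact key 0 (-1) (by norm_num) (by omega) (by omega)

theorem IsPrimary.eq_of_associated {z w : GaussianInt} (hz : IsPrimary z) (hw : IsPrimary w)
    (h : Associated z w) : z = w := by
  obtain ⟨u, rfl⟩ := h
  have hu : (u : GaussianInt).norm = 1 := (Zsqrtd.norm_eq_one_iff' (by norm_num) _).2 u.isUnit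
  rw [Zsqrtd.norm_def] at hu
  obtain ⟨a, ha⟩ : ∃ a, a = (u : GaussianInt).re := ⟨_, rfl⟩
  obtain ⟨b, hb⟩ : ∃ b, b = (u : GaussianInt).im := ⟨_, rfl⟩
  have h1 := (isPrimary_iff _).1 hz
  have h2 := (isPrimary_iff _).1 hw
  simp only [Zsqrtd.re_mul, Zsqrtd.im_mul] at h2
  rw [← ha, ← hb] at hu h2
  have ha' : a = -1 ∨ a = 0 ∨ a = 1 := by
    have : -1 ≤ a := by nlinarith [mul_self_nonneg b]
    have : a ≤ 1 := by nlinarith [mul_self_nonneg b]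
    omega
  have hb' : b = -1 ∨ b = 0 ∨ b = 1 := by
    have : -1 ≤ b := by nlinarith [mul_self_nonneg a]
    have : b ≤ 1 := by nlinarith [mul_self_nonneg a]
    omega
  have hu1 : (u : GaussianInt) = 1 := by
    rcases ha' with rfl | rfl | rfl <;> rcases hb' with rfl | rfl | rfl <;> norm_num at hu <;>
      first
        | (exfalso; omega)
        | (ext <;> simp [← ha, ← hb])
  rw [hu1, mul_one]

/-- A Gaussian integer is primitive when it has no rational integer divisor besides `±1`. -/
def IsPrimitive (z : GaussianInt) : Prop := IsCoprime z.re z.im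

theorem IsPrimitive.of_dvd {z w : GaussianInt} (hz : IsPrimitive z) (h : w ∣ z) : IsPrimitive w :=
  Zsqrtd.isCoprime_of_dvd_isCoprime hz h

theorem jacobiKubota_eq (z : GaussianInt) :
    jacobiKubota z = Complex.I ^ ((z.re - 1) / 2) * (signedJacobi z.im z.re : ℂ) := rfl

theorem norm_jacobiKubota_le (z : GaussianInt) : ‖jacobiKubota z‖ ≤ 1 := by
  unfold jacobiKubota
  rw [norm_mul, norm_zpow, Complex.norm_I, one_zpow, one_mul]
  rcases jacobiSym.trichotomy z.im z.re.natAbs with h | h | h <;> simp [h]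

theorem jacobiKubota_eq_zero {z : GaussianInt} (hz : z.re ≠ 0) (h : ¬ IsPrimitive z) :
    jacobiKubota z = 0 := by
  unfold jacobiKubota
  have : jacobiSym z.im z.re.natAbs = 0 := by
    rw [jacobiSym.eq_zero_iff]
    refine ⟨by simpa using hz, fun h' => h ?_⟩
    have : IsCoprime z.im z.re := by
      rw [Int.isCoprime_iff_gcd_eq_one]
      simpa only [Int.gcd, Int.natAbs_natCast] using h'
    exact this.symm
  rw [this]; simp

theorem IsPrimary.re_ne_zero {z : GaussianInt} (hz : IsPrimary z) : z.re ≠ 0 := by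
  have := hz.re_odd
  rintro h; simp [h] at this

/-! ### The quadratic residue symbol in the Gaussian integers -/

/-- The quadratic residue symbol `(z / w)` for primitive odd `w`. -/
def dirichletSym (z w : GaussianInt) : ℤ := jacobiSym (w * z).re (gnorm w)

theorem dirichletSym_trichotomy (z w : GaussianInt) :
    dirichletSym z w = 0 ∨ dirichletSym z w = 1 ∨ dirichletSym z w = -1 :=
  jacobiSym.trichotomy _ _

theorem norm_dirichletSym_le (z w : GaussianInt) : ‖(dirichletSym z w : ℂ)‖ ≤ 1 := by
  rcases dirichletSym_trichotomy z w with h | h | h <;> simp [h]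

/-- Only w must be primitive. If wz is not primitive, both sides vanish. The common factor of Re z
and Im w is odd because Re z is, and the cofactor of Im w is even because Im w is; this provides the
data for `signedJacobi_twist_of_factor`. -/
theorem jacobiKubota_mul {w z : GaussianInt} (hw : IsPrimary w) (hz : IsPrimary z)
    (hp : IsPrimitive w) (him : w.im ≠ 0) :
    jacobiKubota (w * z) = jacobiKubota w * jacobiKubota z * (dirichletSym z w : ℂ) *
      (kubotaSign w.re w.im z.re (w * z).re : ℂ) := by
  have hr := hz.re_odd
  have hv := hw.im_even
  obtain ⟨g, r', v', hg, hr', hv', hcop⟩ : ∃ g r' v' : ℤ, 0 < g ∧ z.re = g * r' ∧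
      w.im = g * v' ∧ IsCoprime r' v' := by
    have hpos : 0 < Int.gcd z.re w.im := Int.gcd_pos_of_ne_zero_right _ him
    obtain ⟨r', v', h1, h2, h3⟩ := Int.exists_gcd_one hpos
    exact ⟨Int.gcd z.re w.im, r', v', by exact_mod_cast hpos, by rw [mul_comm]; exact h2,
      by rw [mul_comm]; exact h3, Int.isCoprime_iff_gcd_eq_one.2 h1⟩
  have hv0 : v' ≠ 0 := by rintro rfl; simp at hv'; exact him hv'
  obtain ⟨a, m, hm, hvm⟩ := Nat.exists_eq_two_pow_mul_odd (Int.natAbs_ne_zero.2 hv0)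
  have hodd : ∀ {x y : ℤ}, (x * y) % 2 = 1 → x % 2 = 1 ∧ y % 2 = 1 := by
    intro x y h
    rw [Int.mul_emod] at h
    rcases Int.emod_two_eq_zero_or_one x with h1 | h1 <;>
      rcases Int.emod_two_eq_zero_or_one y with h2 | h2 <;> simp [h1, h2] at h ⊢
  obtain ⟨hg2, hr2⟩ := hodd (hr' ▸ hr)
  have hm2 : (m : ℤ) % 2 = 1 := by rw [Nat.odd_iff] at hm; omega
  have hvm' : v' = 2 ^ a * (v'.sign * m) := by
    conv_lhs => rw [← Int.sign_mul_natAbs v', hvm]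
    push_cast; ring
  have hs2 : (v'.sign * m) % 2 = 1 := by
    rcases lt_or_gt_of_ne hv0 with h | h
    · rw [Int.sign_eq_neg_one_of_neg h]; omega
    · rw [Int.sign_eq_one_of_pos h]; omega
  have ha : 1 ≤ a := by
    by_contra h
    have : a = 0 := by omega
    subst this
    rw [pow_zero, one_mul] at hvm'
    rw [hv', hvm', Int.mul_emod, hg2, hs2] at hv
    norm_num at hv
  have := signedJacobi_twist_of_factor hw.re_odd hz.im_even ha hg hr' hv' hvm' hg2 hr2 hs2 hcop hp
  have e1 : (w * z).re = w.re * z.re - w.im * z.im := by rw [Zsqrtd.re_mul]; ring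
  have e2 : (w * z).im = w.re * z.im + w.im * z.re := Zsqrtd.im_mul _ _
  rw [jacobiKubota_eq, jacobiKubota_eq, jacobiKubota_eq, dirichletSym, e1, e2, this]
  have e3 : gnorm w = (w.re ^ 2 + w.im ^ 2).natAbs := by rw [← gnorm_cast]; simp
  rw [e3]; rfl

theorem IsPrimary.eq_one_of_im_eq_zero {w : GaussianInt} (hw : IsPrimary w) (hp : IsPrimitive w)
    (him : w.im = 0) : w = 1 := by
  unfold IsPrimitive at hp
  rw [him, isCoprime_zero_right, Int.isUnit_iff] at hp
  have := (isPrimary_iff w).1 hw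
  rcases hp with h | h
  · ext <;> simp [h, him]
  · rw [h, him] at this; norm_num at this

/-- N(w) is positive and 1 modulo 4, so reciprocity costs no sign, and N(w) ≡ (Im w)² modulo Re w.
-/
theorem jacobiSym_re_gnorm {w : GaussianInt} (hw : IsPrimary w) (hp : IsPrimitive w) :
    jacobiSym w.re (gnorm w) = 1 := by
  have h1 : jacobiSym w.re (gnorm w) = signedJacobi w.re (gnorm w) := rfl
  have h4 : (gnorm w : ℤ) % 4 = 1 := by have := hw.gnorm_mod_four; omega
  rw [h1, signedJacobi_reciprocity hw.re_odd (by omega)]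
  have h2 : oddHilbert w.re (gnorm w) = 1 := by unfold oddHilbert; rw [if_neg (by omega)]
  have h3 : realHilbert w.re (gnorm w) = 1 := by unfold realHilbert; rw [if_neg (by omega)]
  rw [h2, h3, signedJacobi_congr (a' := w.im * w.im) ⟨w.re, by rw [gnorm_cast]; ring⟩,
    signedJacobi_mul_left, signedJacobi_mul_self hp.symm]
  rfl

/-- The identity Re(wz)Re(wt) - Re(w)Re(wzt) = N(w)·Im z·Im t gives the rule, since (Re w / N(w)) =
1. -/
theorem dirichletSym_mul_left {w : GaussianInt} (hw : IsPrimary w) (hp : IsPrimitive w)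
    (z t : GaussianInt) : dirichletSym (z * t) w = dirichletSym z w * dirichletSym t w := by
  unfold dirichletSym
  have h : jacobiSym (w * (z * t)).re (gnorm w) = jacobiSym (w.re * (w * (z * t)).re) (gnorm w) := by
    rw [jacobiSym.mul_left, jacobiSym_re_gnorm hw hp, one_mul]
  rw [h, ← jacobiSym.mul_left]
  refine jacobiSym.mod_left' ((Int.modEq_iff_dvd).2 ?_)
  refine ⟨z.im * t.im, ?_⟩
  rw [gnorm_cast]
  simp only [Zsqrtd.re_mul, Zsqrtd.im_mul]
  ring

/-- The two symbols have the same numerator Re(wz) and multiply to (Re(wz)/N(wz)), which is 1 when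
wz is primitive. When it is not, a rational prime dividing wz must divide both norms, and both
symbols vanish. -/
theorem dirichletSym_symm {w z : GaussianInt} (hw : IsPrimary w) (hpw : IsPrimitive w)
    (hz : IsPrimary z) (hpz : IsPrimitive z) : dirichletSym z w = dirichletSym w z := by
  unfold dirichletSym
  rw [mul_comm z w]
  have hw0 : gnorm w ≠ 0 := (gnorm_pos hw.ne_zero).ne'
  have hz0 : gnorm z ≠ 0 := (gnorm_pos hz.ne_zero).ne'
  have hwz := hw.mul hz
  by_cases hp : IsPrimitive (w * z)
  · have h := jacobiSym_re_gnorm hwz hp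
    rw [gnorm_mul, jacobiSym.mul_right' _ hw0 hz0] at h
    rcases jacobiSym.trichotomy (w * z).re (gnorm w) with h1 | h1 | h1 <;>
      rcases jacobiSym.trichotomy (w * z).re (gnorm z) with h2 | h2 | h2 <;>
      rw [h1, h2] at h <;> simp_all
  · have key : ∀ {a b : GaussianInt}, IsPrimary a → IsPrimary b → IsPrimitive b →
        ¬ IsPrimitive (a * b) → jacobiSym (a * b).re (gnorm a) = 0 := by
      intro a b ha hb hpb hab
      rw [jacobiSym.eq_zero_iff]
      refine ⟨(gnorm_pos ha.ne_zero).ne', fun hg => hab ?_⟩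
      have hc : IsCoprime (a * b).re (gnorm a : ℤ) := Int.isCoprime_iff_gcd_eq_one.2 hg
      unfold IsPrimitive
      rw [Int.isCoprime_iff_gcd_eq_one, Nat.eq_one_iff_not_exists_prime_dvd]
      intro p hp hd
      have hp1 : (p : ℤ) ∣ (a * b).re := (Int.natCast_dvd_natCast.2 hd).trans (Int.gcd_dvd_left ..)
      have hp2 : (p : ℤ) ∣ (a * b).im := (Int.natCast_dvd_natCast.2 hd).trans (Int.gcd_dvd_right ..)
      have hpa : ¬ (p : ℤ) ∣ gnorm a := fun h => by
        have := hc.isUnit_of_dvd' hp1 h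
        exact hp.one_lt.ne' (by simpa [Int.isUnit_iff_natAbs_eq] using this)
      have e1 : (gnorm a : ℤ) * b.re = a.re * (a * b).re + a.im * (a * b).im := by
        rw [gnorm_cast]; simp only [Zsqrtd.re_mul, Zsqrtd.im_mul]; ring
      have e2 : (gnorm a : ℤ) * b.im = a.re * (a * b).im - a.im * (a * b).re := by
        rw [gnorm_cast]; simp only [Zsqrtd.re_mul, Zsqrtd.im_mul]; ring
      have hp' : Prime (p : ℤ) := Nat.prime_iff_prime_int.1 hp
      have f1 : (p : ℤ) ∣ b.re := (hp'.dvd_or_dvd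
        (e1 ▸ dvd_add (hp1.mul_left _) (hp2.mul_left _))).resolve_left hpa
      have f2 : (p : ℤ) ∣ b.im := (hp'.dvd_or_dvd
        (e2 ▸ dvd_sub (hp2.mul_left _) (hp1.mul_left _))).resolve_left hpa
      have := hpb.isUnit_of_dvd' f1 f2
      exact hp.one_lt.ne' (by simpa [Int.isUnit_iff_natAbs_eq] using this)
    rw [key hw hz hpz hp, mul_comm w z, key hz hw hpw (by rwa [mul_comm])]

theorem dirichletSym_mul_right {w w' z : GaussianInt} (hw : IsPrimary w) (hw' : IsPrimary w')
    (hp : IsPrimitive (w * w')) (hz : IsPrimary z) (hpz : IsPrimitive z) :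
    dirichletSym z (w * w') = dirichletSym z w * dirichletSym z w' := by
  rw [dirichletSym_symm (hw.mul hw') hp hz hpz, dirichletSym_mul_left hz hpz,
    dirichletSym_symm hw (hp.of_dvd ⟨w', rfl⟩) hz hpz,
    dirichletSym_symm hw' (hp.of_dvd ⟨w, mul_comm _ _⟩) hz hpz]

/-! ### Divisors of primitive Gaussian integers -/

/-- Bézout for the coordinates expresses 2 as a combination of z and its conjugate, and their
product N(z) is odd. -/
theorem isCoprime_star {z : GaussianInt} (hz : IsPrimary z) (hp : IsPrimitive z) :
    IsCoprime z (star z) := by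
  obtain ⟨a, b, hab⟩ := hp
  have h4 := hz.gnorm_mod_four
  obtain ⟨m, hm⟩ : ∃ m : ℤ, (gnorm z : ℤ) = 2 * m + 1 := ⟨(gnorm z : ℤ) / 2, by omega⟩
  have h2 : (2 : GaussianInt) = ((a : GaussianInt) + b * ⟨0, -1⟩) * z + (a + b * ⟨0, 1⟩) * star z := by
    ext
    · simp; linarith
    · simp; ring
  have h1 : (1 : GaussianInt) = z * star z - m * 2 := by
    rw [mul_star_eq_gnorm]
    ext <;> simp [hm]; ring
  refine ⟨-m * ((a : GaussianInt) + b * ⟨0, -1⟩), z - m * (a + b * ⟨0, 1⟩), ?_⟩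
  linear_combination (-1 : GaussianInt) * h1 + m * h2

/-- The divisor is gcd(z, a). Its norm is a: Bézout shows a ∣ N(g), and coprimality of z and z̄
shows N(g) ∣ a. Conversely a divisor w of z of norm a divides a = w w̄, hence divides the gcd, and
equal norms make the two associated. Being primary singles out one associate. -/
theorem existsUnique_primary_dvd {z : GaussianInt} (hz : IsPrimary z) (hp : IsPrimitive z) {a : ℕ}
    (ha : a ∣ gnorm z) : ∃! w : GaussianInt, (IsPrimary w ∧ w ∣ z) ∧ gnorm w = a := by
  have ha0 : a ≠ 0 := by
    rintro rfl
    exact (gnorm_pos hz.ne_zero).ne' (zero_dvd_iff.1 ha)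
  obtain ⟨b, hb⟩ := ha
  obtain ⟨g, hg⟩ : ∃ g, g = EuclideanDomain.gcd z (a : GaussianInt) := ⟨_, rfl⟩
  have hgz : g ∣ z := hg ▸ EuclideanDomain.gcd_dvd_left _ _
  have hga : g ∣ (a : GaussianInt) := hg ▸ EuclideanDomain.gcd_dvd_right _ _
  have hbez : ∃ x y, g = z * x + a * y := ⟨_, _, hg ▸ EuclideanDomain.gcd_eq_gcd_ab z (a : GaussianInt)⟩
  have star_dvd : ∀ {x y : GaussianInt}, x ∣ y → star x ∣ star y := by
    rintro x _ ⟨t, rfl⟩; exact ⟨star t, by rw [star_mul']⟩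
  have hsa : star (a : GaussianInt) = a := by ext <;> simp
  have hzz : z * star z = a * b := by rw [mul_star_eq_gnorm, hb]; push_cast; rfl
  have hgn : gnorm g = a := by
    have d1 : (a : GaussianInt) ∣ (gnorm g : GaussianInt) := by
      obtain ⟨x, y, hxy⟩ := hbez
      rw [← mul_star_eq_gnorm, hxy, star_add, star_mul', star_mul', hsa]
      refine ⟨b * x * star x + z * x * star y + y * star z * star x + a * y * star y, ?_⟩
      linear_combination x * star x * hzz
    have d2 : (gnorm g : GaussianInt) ∣ (a : GaussianInt) := by
      rw [← mul_star_eq_gnorm]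
      obtain ⟨u, v, huv⟩ := isCoprime_star hz hp
      have h1 : g * star g ∣ z * a := mul_dvd_mul hgz (hsa ▸ star_dvd hga)
      have h2 : g * star g ∣ a * star z := mul_dvd_mul hga (star_dvd hgz)
      have : (a : GaussianInt) = u * (z * a) + v * (a * star z) := by
        linear_combination (-(a : GaussianInt)) * huv
      rw [this]
      exact dvd_add (h1.mul_left _) (h2.mul_left _)
    have c1 : a ∣ gnorm g := by
      have := (Zsqrtd.intCast_dvd_intCast (d := -1) a (gnorm g)).1 (by simpa using d1)
      exact Int.natCast_dvd_natCast.1 this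
    have c2 : gnorm g ∣ a := by
      have := (Zsqrtd.intCast_dvd_intCast (d := -1) (gnorm g) a).1 (by simpa using d2)
      exact Int.natCast_dvd_natCast.1 this
    exact Nat.dvd_antisymm c2 c1
  have hodd : gnorm g % 2 = 1 := by
    have h1 : gnorm g ∣ gnorm z := by rw [hgn]; exact ⟨b, hb⟩
    have h4 := hz.gnorm_mod_four
    obtain ⟨t, ht⟩ := h1
    by_contra h
    obtain ⟨e, he⟩ : ∃ e, gnorm g = 2 * e := ⟨gnorm g / 2, by omega⟩
    rw [he, mul_assoc] at ht
    omega
  obtain ⟨u, hu, hup⟩ := exists_isPrimary_of_gnorm_odd hodd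
  have hass : Associated g (u * g) := by
    rw [mul_comm]; exact associated_mul_unit_right g u hu
  have hgu : gnorm (u * g) = a := by
    rw [gnorm_mul, hgn, gnorm, Zsqrtd.norm_eq_one_iff.2 hu, one_mul]
  refine ⟨u * g, ⟨⟨hup, (hass.dvd_iff_dvd_left).1 hgz⟩, hgu⟩, ?_⟩
  rintro w ⟨⟨hw, hwz⟩, hwa⟩
  refine hw.eq_of_associated hup ?_
  have hwg : w ∣ u * g := by
    refine Dvd.dvd.mul_left ?_ u
    rw [hg]
    refine EuclideanDomain.dvd_gcd hwz ⟨star w, ?_⟩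
    rw [mul_star_eq_gnorm, hwa]
  obtain ⟨t, ht⟩ := hwg
  have htn : gnorm t = 1 := by
    have := congrArg gnorm ht
    rw [hgu, gnorm_mul, hwa] at this
    exact Nat.eq_of_mul_eq_mul_left (Nat.pos_of_ne_zero ha0) (by rw [← this, mul_one])
  rw [ht]
  exact associated_mul_unit_right w t (Zsqrtd.norm_eq_one_iff.1 htn)

/-! ### Fourier analysis on intervals modulo `q` -/

open Finset

theorem harmonic_sum_le (n : ℕ) : ∑ j ∈ Ico 1 (n + 1), (1 / (j : ℝ)) ≤ 1 + Real.log n := by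
  have h := harmonic_le_one_add_log n
  rw [harmonic_eq_sum_Icc] at h
  push_cast at h
  refine le_trans (le_of_eq ?_) h
  refine Finset.sum_congr rfl fun j _ => by rw [one_div]

/-- A geometric sum of ratio z with |z - 1| = 2 sin(πk/q), bounded below by concavity of the sine.
Using both reciprocals avoids the distance to the nearest multiple of q. -/
theorem norm_sum_stdAddChar_le {q : ℕ} [NeZero q] {k : ZMod q} (hk : k ≠ 0) (n : ℕ) :
    ‖∑ t ∈ range n, ZMod.stdAddChar (k * (t : ZMod q))‖ ≤
      (q / 2 : ℝ) * (1 / (k.val : ℝ) + 1 / ((q : ℝ) - k.val)) := by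
  have hq : (0 : ℝ) < q := by exact_mod_cast NeZero.pos q
  have hkv : 0 < k.val := by
    rw [Nat.pos_iff_ne_zero]; exact fun h => hk ((ZMod.val_eq_zero k).1 h)
  have hk0 : (0 : ℝ) < k.val := by exact_mod_cast hkv
  have hkq : (k.val : ℝ) < q := by exact_mod_cast ZMod.val_lt k
  obtain ⟨z, hz⟩ : ∃ z, z = ZMod.stdAddChar k := ⟨_, rfl⟩
  have hzexp : z = Complex.exp (Complex.I * ((2 * Real.pi * k.val / q : ℝ) : ℂ)) := by
    have h := ZMod.stdAddChar_coe (N := q) (k.val : ℤ)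
    rw [Int.cast_natCast, ZMod.natCast_zmod_val] at h
    rw [hz, h]; congr 1; push_cast; ring
  have hzn : ‖z‖ = 1 := by rw [hz]; exact AddChar.norm_apply _ _
  have hpow : ∀ t : ℕ, ZMod.stdAddChar (k * (t : ZMod q)) = z ^ t := by
    intro t
    rw [hz, ← AddChar.map_nsmul_eq_pow, nsmul_eq_mul, mul_comm]
  have hsin : ‖z - 1‖ = 2 * Real.sin (Real.pi * k.val / q) := by
    have hpos : 0 ≤ Real.sin (Real.pi * k.val / q) := by
      refine Real.sin_nonneg_of_nonneg_of_le_pi (by positivity) ?_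
      rw [div_le_iff₀ hq]
      exact mul_le_mul_of_nonneg_left hkq.le Real.pi_pos.le
    rw [hzexp, Complex.norm_exp_I_mul_ofReal_sub_one]
    rw [show 2 * Real.pi * (k.val : ℝ) / q / 2 = Real.pi * k.val / q by ring, norm_mul,
      Real.norm_of_nonneg hpos]
    norm_num
  have key : ∀ a b : ℝ, 0 < a → a + b = q → a ≤ b →
      2 * a / q ≤ Real.sin (Real.pi * a / q) := by
    intro a b ha hab hle
    have := Real.mul_le_sin (x := Real.pi * a / q) (by positivity) (by
      rw [div_le_div_iff₀ hq (by norm_num)]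
      nlinarith [Real.pi_pos])
    refine le_trans (le_of_eq ?_) this
    field_simp
  have hlow : ∃ m : ℝ, 0 < m ∧ (1 / m ≤ 1 / (k.val : ℝ) + 1 / ((q : ℝ) - k.val)) ∧
      2 * m / q ≤ Real.sin (Real.pi * k.val / q) := by
    have hsub : (0 : ℝ) < (q : ℝ) - k.val := by linarith
    rcases le_total (k.val : ℝ) ((q : ℝ) - k.val) with h | h
    · exact ⟨k.val, hk0, le_add_of_nonneg_right (by positivity), key _ _ hk0 (by ring) h⟩
    · refine ⟨(q : ℝ) - k.val, hsub, le_add_of_nonneg_left (by positivity), ?_⟩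
      have := key _ (k.val : ℝ) hsub (by ring) h
      rwa [show Real.pi * ((q : ℝ) - k.val) / q = Real.pi - Real.pi * k.val / q by field_simp,
        Real.sin_pi_sub] at this
  obtain ⟨m, hm, hm1, hm2⟩ := hlow
  have hz1 : z ≠ 1 := by
    intro h
    rw [h, sub_self, norm_zero] at hsin
    have : 0 < 2 * m / q := by positivity
    linarith
  rw [Finset.sum_congr rfl fun t _ => hpow t, geom_sum_eq hz1, norm_div, hsin]
  have hnum : ‖z ^ n - 1‖ ≤ 2 := by
    refine (norm_sub_le _ _).trans ?_
    rw [norm_pow, hzn]; norm_num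
  calc ‖z ^ n - 1‖ / (2 * Real.sin (Real.pi * k.val / q)) ≤ 2 / (2 * (2 * m / q)) := by
        have : 0 < 2 * m / q := by positivity
        gcongr
    _ = (q / 2 : ℝ) * (1 / m) := by field_simp
    _ ≤ _ := by gcongr

theorem sum_zmod_eq_sum_range {q : ℕ} [NeZero q] (F : ℕ → ℝ) :
    ∑ k : ZMod q, F k.val = ∑ j ∈ range q, F j := by
  refine Finset.sum_nbij (fun k => k.val) ?_ ?_ ?_ ?_
  · intro k _; exact mem_range.2 (ZMod.val_lt k)
  · intro a _ b _ h; exact ZMod.val_injective q h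
  · intro j hj
    exact ⟨(j : ZMod q), by simp, ZMod.val_cast_of_lt (mem_range.1 hj)⟩
  · intros; rfl

theorem sum_norm_sum_stdAddChar_le {q : ℕ} [NeZero q] (n : ℕ) (hn : n ≤ q) :
    (q : ℝ)⁻¹ * ∑ k : ZMod q, ‖∑ t ∈ range n, ZMod.stdAddChar (k * (t : ZMod q))‖ ≤
      2 + Real.log q := by
  have hq : (0 : ℝ) < q := by exact_mod_cast NeZero.pos q
  have hb : ∀ k : ZMod q, ‖∑ t ∈ range n, ZMod.stdAddChar (k * (t : ZMod q))‖ ≤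
      (if k.val = 0 then (q : ℝ) else
        (q / 2 : ℝ) * (1 / (k.val : ℝ) + 1 / ((q : ℝ) - k.val))) := by
    intro k
    split_ifs with h
    · rw [ZMod.val_eq_zero] at h
      subst h
      simp only [zero_mul, AddChar.map_zero_eq_one, sum_const, card_range, nsmul_eq_mul, mul_one]
      simpa using hn
    · exact norm_sum_stdAddChar_le (fun h' => h ((ZMod.val_eq_zero k).2 h')) n
  refine (mul_le_mul_of_nonneg_left (Finset.sum_le_sum fun k _ => hb k) (by positivity)).trans ?_
  rw [sum_zmod_eq_sum_range (fun j => if j = 0 then (q : ℝ) else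
    (q / 2 : ℝ) * (1 / (j : ℝ) + 1 / ((q : ℝ) - j)))]
  obtain ⟨p, rfl⟩ : ∃ p, q = p + 1 := ⟨q - 1, by have := NeZero.pos q; omega⟩
  rw [Finset.sum_range_succ']
  simp only [Nat.add_eq_zero_iff, one_ne_zero, and_false, if_false, if_true, ← mul_sum,
    sum_add_distrib]
  have h1 : ∑ j ∈ range p, (1 / ((j + 1 : ℕ) : ℝ)) ≤ 1 + Real.log p := by
    rw [show ∑ j ∈ range p, (1 / ((j + 1 : ℕ) : ℝ)) = ∑ j ∈ Ico 1 (p + 1), (1 / (j : ℝ)) by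
      rw [Finset.sum_Ico_eq_sum_range]
      exact Finset.sum_congr (by simp) fun j _ => by rw [add_comm]]
    exact harmonic_sum_le p
  have h2 : ∑ j ∈ range p, (1 / (((p + 1 : ℕ) : ℝ) - ((j + 1 : ℕ) : ℝ))) =
      ∑ j ∈ range p, (1 / ((j + 1 : ℕ) : ℝ)) := by
    rw [← Finset.sum_range_reflect]
    refine Finset.sum_congr rfl fun j hj => ?_
    have hj := mem_range.1 hj
    congr 1
    rw [Nat.cast_add, Nat.cast_add, Nat.sub_sub, Nat.cast_sub (by omega)]
    push_cast; ring
  rw [h2]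
  have hlog : Real.log p ≤ Real.log ((p + 1 : ℕ) : ℝ) := by
    rcases Nat.eq_zero_or_pos p with rfl | hp
    · simp
    · exact Real.log_le_log (by exact_mod_cast hp) (by push_cast; linarith)
  have hne : ((p + 1 : ℕ) : ℝ) ≠ 0 := hq.ne'
  rw [mul_add, inv_mul_cancel₀ hne]
  have : (((p + 1 : ℕ) : ℝ))⁻¹ * (((p + 1 : ℕ) : ℝ) / 2 * (∑ j ∈ range p, (1 / ((j + 1 : ℕ) : ℝ)) +
      ∑ j ∈ range p, (1 / ((j + 1 : ℕ) : ℝ)))) = ∑ j ∈ range p, (1 / ((j + 1 : ℕ) : ℝ)) := by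
    field_simp; ring
  rw [this]; linarith

theorem sum_stdAddChar_mul {q : ℕ} [NeZero q] (x : ZMod q) :
    ∑ k : ZMod q, ZMod.stdAddChar (k * x) = if x = 0 then (q : ℂ) else 0 := by
  have := AddChar.sum_mulShift x (ZMod.isPrimitive_stdAddChar q)
  simpa using this

/-- The inequality a < b means t + a + 1 = b for some t < n. The modulus 2n + 1 exceeds |t + a + 1 -
b|, so the congruence is an equality, and characters separate a from b. -/
theorem ite_lt_eq_sum_stdAddChar {n a b : ℕ} (ha : a < n) (hb : b ≤ n) :
    (if a < b then (1 : ℂ) else 0) = ∑ k : ZMod (2 * n + 1), ((2 * n + 1 : ℕ) : ℂ)⁻¹ *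
      (∑ t ∈ range n, ZMod.stdAddChar (k * (t : ZMod (2 * n + 1)))) *
      (ZMod.stdAddChar (k * ((a : ZMod (2 * n + 1)) + 1)) * ZMod.stdAddChar (k * (-(b : ZMod (2 * n + 1))))) := by
  have h1 : ∀ k : ZMod (2 * n + 1), ((2 * n + 1 : ℕ) : ℂ)⁻¹ *
      (∑ t ∈ range n, ZMod.stdAddChar (k * (t : ZMod (2 * n + 1)))) *
      (ZMod.stdAddChar (k * ((a : ZMod (2 * n + 1)) + 1)) * ZMod.stdAddChar (k * (-(b : ZMod (2 * n + 1))))) =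
      ((2 * n + 1 : ℕ) : ℂ)⁻¹ * ∑ t ∈ range n,
        ZMod.stdAddChar (k * ((t : ZMod (2 * n + 1)) + ((a : ZMod (2 * n + 1)) + 1) + -(b : ZMod (2 * n + 1)))) := by
    intro k
    rw [mul_assoc, Finset.sum_mul]
    congr 1
    refine Finset.sum_congr rfl fun t _ => ?_
    rw [← AddChar.map_add_eq_mul, ← AddChar.map_add_eq_mul]
    congr 1; ring
  rw [Finset.sum_congr rfl fun k _ => h1 k, ← Finset.mul_sum, Finset.sum_comm,
    Finset.sum_congr rfl fun t _ => sum_stdAddChar_mul _]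
  have h2 : ∀ t ∈ range n, (if ((t : ZMod (2 * n + 1)) + ((a : ZMod (2 * n + 1)) + 1) + -(b : ZMod (2 * n + 1)) = 0) then
      ((2 * n + 1 : ℕ) : ℂ) else 0) = if t = b - (a + 1) ∧ a < b then ((2 * n + 1 : ℕ) : ℂ) else 0 := by
    intro t ht
    have ht := mem_range.1 ht
    refine if_congr ?_ rfl rfl
    have : ((t : ZMod (2 * n + 1)) + ((a : ZMod (2 * n + 1)) + 1) + -(b : ZMod (2 * n + 1))) = ((t + a + 1 - b : ℤ) : ZMod (2 * n + 1)) := by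
      push_cast; ring
    rw [this, ZMod.intCast_zmod_eq_zero_iff_dvd]
    constructor
    · rintro ⟨c, hc⟩
      have hc0 : c = 0 := by
        push_cast at hc
        have h1 : c < 1 := by nlinarith
        have h2 : -1 < c := by nlinarith
        omega
      subst hc0
      omega
    · rintro ⟨h, h'⟩
      exact ⟨0, by omega⟩
  rw [Finset.sum_congr rfl h2]
  by_cases hab : a < b
  · simp only [hab, and_true, if_true]
    rw [Finset.sum_ite_eq' (range n), if_pos (mem_range.2 (by omega)), inv_mul_cancel₀]
    exact_mod_cast (by omega : 2 * n + 1 ≠ 0)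
  · simp [hab]

/-- Separation of variables: a bound for all bilinear forms with bounded coefficients survives the
restriction `f i < g j` at the cost of a logarithm. -/
theorem norm_bilinear_ite_lt_le {ι κ : Type*} (S : Finset ι) (T : Finset κ) (f : ι → ℝ) (g : κ → ℝ)
    (Φ : ι → κ → ℂ) {K : ℝ}
    (hK : ∀ (α : ι → ℂ) (β : κ → ℂ), (∀ i, ‖α i‖ ≤ 1) → (∀ j, ‖β j‖ ≤ 1) →
      ‖∑ i ∈ S, ∑ j ∈ T, α i * β j * Φ i j‖ ≤ K)
    (α : ι → ℂ) (β : κ → ℂ) (hα : ∀ i, ‖α i‖ ≤ 1) (hβ : ∀ j, ‖β j‖ ≤ 1) :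
    ‖∑ i ∈ S, ∑ j ∈ T, α i * β j * ((if f i < g j then 1 else 0) * Φ i j)‖ ≤
      K * (2 + Real.log (2 * #S + 1)) := by
  classical
  set n := #S with hn
  -- Real values are replaced by their ranks within S, so the comparison becomes one of integers at
  -- most #S and the loss depends only on #S.
  set a : ι → ℕ := fun i => #{i' ∈ S | f i' < f i} with ha
  set b : κ → ℕ := fun j => #{i' ∈ S | f i' < g j} with hb
  have hb' : ∀ j, b j ≤ n := fun j => card_filter_le _ _
  have ha' : ∀ i ∈ S, a i < n := fun i hi =>
    card_lt_card ⟨filter_subset _ _, fun h => by simpa using h hi⟩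
  have hab : ∀ i ∈ S, ∀ j, (f i < g j ↔ a i < b j) := by
    intro i hi j
    constructor
    · intro h
      refine card_lt_card ⟨fun x hx => ?_, fun h' => ?_⟩
      · rw [mem_filter] at hx ⊢; exact ⟨hx.1, hx.2.trans h⟩
      · have := h' (mem_filter.2 ⟨hi, h⟩)
        simp at this
    · intro h
      by_contra h'
      push Not at h'
      refine absurd h (not_lt.2 (card_le_card fun x hx => ?_))
      rw [mem_filter] at hx ⊢; exact ⟨hx.1, hx.2.trans_le h'⟩
  have hK0 : 0 ≤ K := (norm_nonneg _).trans (hK (fun _ => 0) (fun _ => 0) (by simp) (by simp))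
  have hexp : ∑ i ∈ S, ∑ j ∈ T, α i * β j * ((if f i < g j then 1 else 0) * Φ i j) =
      ∑ k : ZMod (2 * n + 1), ((2 * n + 1 : ℕ) : ℂ)⁻¹ *
      (∑ t ∈ range n, ZMod.stdAddChar (k * (t : ZMod (2 * n + 1)))) *
      ∑ i ∈ S, ∑ j ∈ T, (α i * ZMod.stdAddChar (k * ((a i : ZMod (2 * n + 1)) + 1))) *
        (β j * ZMod.stdAddChar (k * (-(b j : ZMod (2 * n + 1))))) * Φ i j := by
    simp only [Finset.mul_sum S, Finset.mul_sum T]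
    symm
    rw [Finset.sum_comm]
    refine Finset.sum_congr rfl fun i hi => ?_
    rw [Finset.sum_comm]
    refine Finset.sum_congr rfl fun j _ => ?_
    symm
    rw [if_congr (hab i hi j) rfl rfl, ite_lt_eq_sum_stdAddChar (ha' i hi) (hb' j), Finset.sum_mul,
      Finset.mul_sum]
    refine Finset.sum_congr rfl fun k _ => ?_
    ring
  rw [hexp]
  refine (norm_sum_le _ _).trans ?_
  have hterm : ∀ k : ZMod (2 * n + 1), ‖((2 * n + 1 : ℕ) : ℂ)⁻¹ *
      (∑ t ∈ range n, ZMod.stdAddChar (k * (t : ZMod (2 * n + 1)))) *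
      ∑ i ∈ S, ∑ j ∈ T, (α i * ZMod.stdAddChar (k * ((a i : ZMod (2 * n + 1)) + 1))) *
        (β j * ZMod.stdAddChar (k * (-(b j : ZMod (2 * n + 1))))) * Φ i j‖ ≤
      K * ((((2 * n + 1 : ℕ) : ℝ))⁻¹ *
        ‖∑ t ∈ range n, ZMod.stdAddChar (k * (t : ZMod (2 * n + 1)))‖) := by
    intro k
    rw [norm_mul, norm_mul, mul_comm K, norm_inv, Complex.norm_natCast]
    refine mul_le_mul_of_nonneg_left (hK _ _ ?_ ?_) (by positivity)
    · intro i; rw [norm_mul, AddChar.norm_apply, mul_one]; exact hα i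
    · intro j; rw [norm_mul, AddChar.norm_apply, mul_one]; exact hβ j
  refine (Finset.sum_le_sum fun k _ => hterm k).trans ?_
  rw [← Finset.mul_sum, ← Finset.mul_sum]
  refine mul_le_mul_of_nonneg_left ?_ hK0
  have := sum_norm_sum_stdAddChar_le (q := 2 * n + 1) n (by omega)
  push_cast at this ⊢
  exact this

/-! ### The Pólya–Vinogradov inequality for Jacobi symbols -/

/-- Some prime p divides n to an odd power. By the Chinese remainder theorem choose a non-residue
modulo p that is 1 modulo the prime-to-p part. -/
theorem exists_jacobiSym_eq_neg_one {n : ℕ} (hodd : n % 2 = 1) (hn : ¬ IsSquare n) :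
    ∃ a : ℤ, jacobiSym a n = -1 := by
  obtain ⟨a, b, hab, ha⟩ := Nat.sq_mul_squarefree n
  have hn0 : n ≠ 0 := by rintro rfl; simp at hodd
  have ha1 : a ≠ 1 := by
    rintro rfl
    exact hn ⟨b, by rw [← hab]; ring⟩
  obtain ⟨p, hp, hpa⟩ := Nat.exists_prime_and_dvd ha1
  obtain ⟨a', rfl⟩ := hpa
  have hpa' : ¬ p ∣ a' := by
    rintro ⟨c, rfl⟩
    have := ha p ⟨c, by ring⟩
    exact hp.one_lt.ne' (Nat.isUnit_iff.1 this)
  have hb0 : b ≠ 0 := by rintro rfl; simp at hab; exact hn0 hab.symm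
  obtain ⟨i, b', hpb', rfl⟩ := Nat.exists_eq_pow_mul_and_not_dvd hb0 p hp.ne_one
  have hfac : n = p ^ (2 * i + 1) * (a' * b' ^ 2) := by rw [← hab]; ring
  have hcop : Nat.Coprime p (a' * b' ^ 2) :=
    (Nat.Coprime.mul_right ((Nat.Prime.coprime_iff_not_dvd hp).2 hpa')
      (((Nat.Prime.coprime_iff_not_dvd hp).2 hpb').pow_right 2))
  have hc0 : a' * b' ^ 2 ≠ 0 := by rintro h; rw [h, mul_zero] at hfac; exact hn0 hfac
  have : Fact p.Prime := ⟨hp⟩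
  have hp2 : p ≠ 2 := by
    rintro rfl
    rw [hfac, pow_succ, mul_assoc, mul_left_comm] at hodd
    omega
  obtain ⟨x, hx⟩ := FiniteField.exists_nonsquare (F := ZMod p) (by rwa [ZMod.ringChar_zmod_n])
  obtain ⟨y, hy1, hy2⟩ := Nat.chineseRemainder hcop x.val 1
  refine ⟨(y : ℤ), ?_⟩
  have h1 : jacobiSym (y : ℤ) p = -1 := by
    rw [ZMod.nonsquare_iff_jacobiSym_eq_neg_one]
    have : ((y : ℤ) : ZMod p) = x := by
      rw [Int.cast_natCast, (ZMod.natCast_eq_natCast_iff _ _ _).2 hy1, ZMod.natCast_zmod_val]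
    rwa [this]
  have h2 : jacobiSym (y : ℤ) (a' * b' ^ 2) = 1 := by
    rw [← jacobiSym.one_left (a' * b' ^ 2)]
    refine jacobiSym.mod_left' ?_
    have := hy2
    unfold Nat.ModEq at this
    exact_mod_cast this
  rw [hfac, jacobiSym.mul_right' _ (pow_ne_zero _ hp.ne_zero) hc0, jacobiSym.pow_right, h1, h2,
    mul_one, pow_succ, pow_mul]
  norm_num

/-- The Jacobi symbol as a function on residue classes. -/
def jacobiFun (q : ℕ) (x : ZMod q) : ℂ := (jacobiSym (x.val : ℤ) q : ℂ)

theorem jacobiFun_intCast {q : ℕ} [NeZero q] (a : ℤ) :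
    jacobiFun q (a : ZMod q) = (jacobiSym a q : ℂ) := by
  unfold jacobiFun
  congr 1
  rw [ZMod.val_intCast, ← jacobiSym.mod_left]

theorem jacobiFun_mul {q : ℕ} [NeZero q] (x y : ZMod q) :
    jacobiFun q (x * y) = jacobiFun q x * jacobiFun q y := by
  have hx : x = ((x.val : ℤ) : ZMod q) := by simp
  have hy : y = ((y.val : ℤ) : ZMod q) := by simp
  rw [hx, hy, ← Int.cast_mul, jacobiFun_intCast, jacobiFun_intCast, jacobiFun_intCast,
    jacobiSym.mul_left]
  push_cast; rfl

theorem norm_jacobiFun_le {q : ℕ} (x : ZMod q) : ‖jacobiFun q x‖ ≤ 1 := by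
  unfold jacobiFun
  rcases jacobiSym.trichotomy (x.val : ℤ) q with h | h | h <;> simp [h]

theorem isUnit_of_jacobiFun_ne_zero {q : ℕ} [NeZero q] {x : ZMod q} (h : jacobiFun q x ≠ 0) :
    IsUnit x := by
  unfold jacobiFun at h
  have h' : jacobiSym (x.val : ℤ) q ≠ 0 := by exact_mod_cast h
  rw [Ne, jacobiSym.eq_zero_iff] at h'
  push Not at h'
  have := h' (NeZero.ne q)
  rw [← ZMod.natCast_zmod_val x, ZMod.isUnit_iff_coprime]
  rwa [Int.gcd_natCast_natCast] at this

theorem norm_jacobiFun_unit {q : ℕ} [NeZero q] (u : (ZMod q)ˣ) : ‖jacobiFun q u‖ = 1 := by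
  unfold jacobiFun
  have hc : Int.gcd ((u : ZMod q).val : ℤ) q = 1 := by
    rw [Int.gcd_natCast_natCast]; exact ZMod.val_coe_unit_coprime u
  rcases jacobiSym.eq_one_or_neg_one hc with h | h <;> rw [h] <;> simp

/-- Multiplying the variable by a class of symbol -1 permutes the residues and changes the sign of
the sum. -/
theorem sum_jacobiFun_eq_zero {q : ℕ} [NeZero q] (hodd : q % 2 = 1) (hq : ¬ IsSquare q) :
    ∑ x : ZMod q, jacobiFun q x = 0 := by
  obtain ⟨a, ha⟩ := exists_jacobiSym_eq_neg_one hodd hq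
  have hf : jacobiFun q (a : ZMod q) = -1 := by rw [jacobiFun_intCast, ha]; simp
  have hu : IsUnit (a : ZMod q) := isUnit_of_jacobiFun_ne_zero (by rw [hf]; norm_num)
  obtain ⟨u, hu⟩ := hu
  have h : ∑ x : ZMod q, jacobiFun q x = ∑ x : ZMod q, jacobiFun q (u * x) :=
    (Fintype.sum_equiv u.mulLeft _ _ fun x => by simp).symm
  rw [hu] at h
  simp only [jacobiFun_mul, hf, ← Finset.mul_sum] at h
  linear_combination h / 2

/-- The Fourier transform of a function on residue classes. -/
def fourierSum {q : ℕ} [NeZero q] (f : ZMod q → ℂ) (k : ZMod q) : ℂ :=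
  ∑ j, f j * ZMod.stdAddChar (-(k * j))

theorem fourierSum_inversion {q : ℕ} [NeZero q] (f : ZMod q → ℂ) (x : ZMod q) :
    (q : ℂ) * f x = ∑ k, fourierSum f k * ZMod.stdAddChar (k * x) := by
  unfold fourierSum
  simp only [Finset.sum_mul]
  rw [Finset.sum_comm]
  have : ∀ j : ZMod q, ∑ k, f j * ZMod.stdAddChar (-(k * j)) * ZMod.stdAddChar (k * x) =
      f j * (if x - j = 0 then (q : ℂ) else 0) := by
    intro j
    rw [← sum_stdAddChar_mul, Finset.mul_sum]
    refine Finset.sum_congr rfl fun k _ => ?_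
    rw [mul_assoc, ← AddChar.map_add_eq_mul]
    congr 2; ring
  rw [Finset.sum_congr rfl fun j _ => this j, Finset.sum_eq_single x]
  · simp [mul_comm]
  · intro j _ hj
    rw [if_neg (sub_ne_zero.2 hj.symm), mul_zero]
  · simp

theorem sum_norm_sq_fourierSum {q : ℕ} [NeZero q] (f : ZMod q → ℂ) :
    ∑ k, ‖fourierSum f k‖ ^ 2 = q * ∑ j, ‖f j‖ ^ 2 := by
  have h : ∑ k, fourierSum f k * (starRingEnd ℂ) (fourierSum f k) =
      (q : ℂ) * ∑ j, f j * (starRingEnd ℂ) (f j) := by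
    have h1 : ∀ k, (starRingEnd ℂ) (fourierSum f k) =
        ∑ j, (starRingEnd ℂ) (f j) * ZMod.stdAddChar (k * j) := by
      intro k
      unfold fourierSum
      rw [map_sum]
      refine Finset.sum_congr rfl fun j _ => ?_
      rw [map_mul, AddChar.map_neg_eq_conj, Complex.conj_conj]
    simp only [h1, Finset.mul_sum]
    rw [Finset.sum_comm]
    refine Finset.sum_congr rfl fun j _ => ?_
    rw [← mul_assoc, fourierSum_inversion, Finset.sum_mul]
    refine Finset.sum_congr rfl fun k _ => by ring
  simp only [Complex.mul_conj, Complex.normSq_eq_norm_sq] at h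
  exact_mod_cast h

theorem card_mul_eq_le {q : ℕ} [NeZero q] (k i : ZMod q) :
    #{x : ZMod q | x * k = i} ≤ Nat.gcd k.val q := by
  classical
  have hg : 0 < Nat.gcd k.val q := Nat.gcd_pos_of_pos_right _ (NeZero.pos q)
  have hzero : #{x : ZMod q | x * k = 0} ≤ Nat.gcd k.val q := by
    obtain ⟨q', hq'⟩ := Nat.gcd_dvd_right k.val q
    obtain ⟨k', hk'⟩ := Nat.gcd_dvd_left k.val q
    have hcop : Nat.Coprime q' k' := by
      have := Nat.coprime_div_gcd_div_gcd (m := k.val) (n := q) hg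
      have e1 : k.val / Nat.gcd k.val q = k' := Nat.div_eq_of_eq_mul_right hg hk'
      have e2 : q / Nat.gcd k.val q = q' := Nat.div_eq_of_eq_mul_right hg hq'
      rw [e1, e2] at this
      exact this.symm
    have hq0 : 0 < q' := Nat.pos_of_ne_zero (by
      rintro rfl; rw [mul_zero] at hq'; exact NeZero.ne q hq')
    have hdvd : ∀ x : ZMod q, x * k = 0 → q' ∣ x.val := by
      intro x hx
      have h1 : q ∣ x.val * k.val := by
        rw [← ZMod.natCast_eq_zero_iff]; push_cast; simpa using hx
      obtain ⟨c, hc⟩ := h1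
      refine hcop.dvd_of_dvd_mul_right ⟨c, ?_⟩
      refine Nat.eq_of_mul_eq_mul_left hg ?_
      calc _ = x.val * (Nat.gcd k.val q * k') := by ring
        _ = q * c := by rw [← hk', hc]
        _ = Nat.gcd k.val q * q' * c := by rw [← hq']
        _ = _ := by ring
    rw [← card_range (Nat.gcd k.val q)]
    refine card_le_card_of_injOn (fun x => x.val / q') ?_ ?_
    · intro x _
      simp only [coe_range, Set.mem_Iio]
      rw [Nat.div_lt_iff_lt_mul hq0, ← hq']
      exact ZMod.val_lt x
    · intro x hx y hy hxy
      simp only [coe_filter, mem_univ, true_and, Set.mem_ofPred_eq] at hx hy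
      refine ZMod.val_injective q ?_
      rw [← Nat.div_mul_cancel (hdvd x hx), ← Nat.div_mul_cancel (hdvd y hy)]
      simp only at hxy
      rw [hxy]
  rcases Finset.eq_empty_or_nonempty ({x : ZMod q | x * k = i} : Finset (ZMod q)) with h | ⟨x₀, h₀⟩
  · rw [h]; simp
  · refine le_trans (card_le_card_of_injOn (fun x => x - x₀) ?_ ?_) hzero
    · intro x hx
      simp only [coe_filter, mem_filter, mem_univ, true_and, Set.mem_ofPred_eq] at hx h₀ ⊢
      rw [sub_mul, hx, h₀, sub_self]
    · intro x _ y _ hxy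
      exact sub_left_injective hxy

/-- This replaces Gauss sum evaluations and applies to imprimitive symbols too. The size of the
transform is constant on the orbit of k under units, so φ(q)|F(k)|² is a sum over that orbit. Each
point of it is hit at most gcd(k, q) times, and Parseval bounds the total by q φ(q). -/
theorem norm_fourierSum_jacobiFun_sq_le {q : ℕ} [NeZero q] (k : ZMod q) :
    ‖fourierSum (jacobiFun q) k‖ ^ 2 ≤ q * Nat.gcd k.val q := by
  classical
  set F := fourierSum (jacobiFun q) with hF
  have hunit : ∀ u : (ZMod q)ˣ, ‖F k‖ = ‖F (u * k)‖ := by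
    intro u
    have h : F k = jacobiFun q u * F (u * k) := by
      rw [hF]; unfold fourierSum
      rw [Finset.mul_sum]
      refine Fintype.sum_equiv (u⁻¹).mulLeft _ _ fun j => ?_
      simp only [Units.mulLeft_apply]
      rw [← mul_assoc, ← jacobiFun_mul, Units.mul_inv_cancel_left]
      congr 3
      rw [show (u : ZMod q) * k * (((u⁻¹ : (ZMod q)ˣ) : ZMod q) * j) =
        (u : ZMod q) * ((u⁻¹ : (ZMod q)ˣ) : ZMod q) * (k * j) by ring, Units.mul_inv, one_mul]
    rw [h, norm_mul, norm_jacobiFun_unit, one_mul]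
  have hsum1 : ∑ u : (ZMod q)ˣ, ‖F (u * k)‖ ^ 2 ≤ Nat.gcd k.val q * ∑ i, ‖F i‖ ^ 2 := by
    rw [← Finset.sum_fiberwise univ (fun u : (ZMod q)ˣ => (u : ZMod q) * k)
      fun u : (ZMod q)ˣ => ‖F (u * k)‖ ^ 2, Finset.mul_sum]
    refine Finset.sum_le_sum fun i _ => ?_
    rw [Finset.sum_congr rfl (g := fun _ => ‖F i‖ ^ 2) (fun u hu => by
      rw [(mem_filter.1 hu).2]), sum_const, nsmul_eq_mul]
    refine mul_le_mul_of_nonneg_right ?_ (by positivity)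
    norm_cast
    refine le_trans ?_ (card_mul_eq_le k i)
    refine card_le_card_of_injOn (fun u => (u : ZMod q)) ?_ ?_
    · intro u hu; simpa using hu
    · intro u _ v _ h; exact Units.ext h
  have hsum2 : ∑ j, ‖jacobiFun q j‖ ^ 2 ≤ Fintype.card (ZMod q)ˣ := by
    have h1 : ∑ j, ‖jacobiFun q j‖ ^ 2 ≤ ∑ j : ZMod q, if IsUnit j then (1 : ℝ) else 0 := by
      refine Finset.sum_le_sum fun j _ => ?_
      split_ifs with h
      · exact pow_le_one₀ (norm_nonneg _) (norm_jacobiFun_le j)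
      · have : jacobiFun q j = 0 := by
          by_contra h'; exact h (isUnit_of_jacobiFun_ne_zero h')
        rw [this]; simp
    refine h1.trans (le_of_eq ?_)
    rw [Finset.sum_boole, ← Finset.card_univ]
    norm_cast
    refine Finset.card_bij' (fun j hj => (mem_filter.1 hj).2.unit) (fun u _ => (u : ZMod q))
      ?_ ?_ ?_ ?_
    · intros; simp
    · intros; simp
    · intros; simp
    · intros; simp
  simp only [← hunit] at hsum1
  rw [sum_norm_sq_fourierSum, sum_const, nsmul_eq_mul, card_univ] at hsum1
  have hpos : (0 : ℝ) < Fintype.card (ZMod q)ˣ := by exact_mod_cast Fintype.card_pos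
  have : (Fintype.card (ZMod q)ˣ : ℝ) * ‖F k‖ ^ 2 ≤
      Fintype.card (ZMod q)ˣ * (q * Nat.gcd k.val q) := by
    refine hsum1.trans ?_
    calc _ ≤ (Nat.gcd k.val q : ℝ) * (q * Fintype.card (ZMod q)ˣ) := by gcongr
      _ = _ := by ring
  exact le_of_mul_le_mul_left this hpos

/-- The map j ↦ (gcd(j, q), j / gcd(j, q)) is injective, which reduces the sum to a harmonic sum for
each divisor of q. -/
theorem sum_gcd_div_le (q : ℕ) :
    ∑ j ∈ Ico 1 q, (Nat.gcd j q : ℝ) / j ≤ #q.divisors * (1 + Real.log q) := by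
  classical
  have hpos : ∀ j ∈ Ico 1 q, 0 < Nat.gcd j q := fun j hj =>
    Nat.gcd_pos_of_pos_left _ (by simp at hj; omega)
  have h1 : ∑ j ∈ Ico 1 q, (Nat.gcd j q : ℝ) / j =
      ∑ p ∈ (Ico 1 q).image (fun j => (Nat.gcd j q, j / Nat.gcd j q)), 1 / (p.2 : ℝ) := by
    rw [Finset.sum_image]
    · refine Finset.sum_congr rfl fun j hj => ?_
      have hp : (0 : ℝ) < Nat.gcd j q := by exact_mod_cast hpos j hj
      rw [Nat.cast_div (Nat.gcd_dvd_left j q) hp.ne', one_div_div]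
    · intro a ha b hb hab
      simp only [Prod.mk.injEq] at hab
      rw [← Nat.div_mul_cancel (Nat.gcd_dvd_left a q), hab.2, hab.1,
        Nat.div_mul_cancel (Nat.gcd_dvd_left b q)]
  rw [h1]
  calc _ ≤ ∑ p ∈ q.divisors ×ˢ Ico 1 (q + 1), 1 / (p.2 : ℝ) := by
        refine Finset.sum_le_sum_of_subset_of_nonneg ?_ fun _ _ _ => by positivity
        intro p hp
        obtain ⟨j, hj, rfl⟩ := mem_image.1 hp
        have hj' := hpos j hj
        rw [mem_Ico] at hj
        rw [mem_product, Nat.mem_divisors, mem_Ico]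
        refine ⟨⟨Nat.gcd_dvd_right _ _, by omega⟩,
          Nat.div_pos (Nat.gcd_le_left _ (by omega)) hj', ?_⟩
        have := Nat.div_le_self j (Nat.gcd j q)
        omega
    _ = #q.divisors * ∑ j ∈ Ico 1 (q + 1), 1 / (j : ℝ) := by
        rw [Finset.sum_product]; simp
    _ ≤ _ := by gcongr; exact harmonic_sum_le q

/-- Pólya–Vinogradov: the frequency 0 drops out because q is not a square, and the others combine
the bound for F(k) with the geometric sum. The divisor count pays for imprimitivity. -/
theorem norm_sum_jacobiSym_le {q : ℕ} (hodd : q % 2 = 1) (hq : ¬ IsSquare q) (b : ℤ) (n : ℕ) :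
    ‖∑ t ∈ range n, (jacobiSym (b + t) q : ℂ)‖ ≤
      √q * (#q.divisors * (1 + Real.log q)) := by
  have : NeZero q := ⟨by rintro rfl; simp at hodd⟩
  have hq0 : (0 : ℝ) < q := by exact_mod_cast NeZero.pos q
  set F := fourierSum (jacobiFun q) with hF
  have hF0 : F 0 = 0 := by
    rw [hF, fourierSum]; simpa using sum_jacobiFun_eq_zero hodd hq
  -- The square root of the gcd is relaxed to the gcd itself, which suffices for `sum_gcd_div_le`.
  have hFb : ∀ k, ‖F k‖ ≤ √q * Nat.gcd k.val q := by
    intro k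
    have hg : (1 : ℝ) ≤ Nat.gcd k.val q := by
      exact_mod_cast Nat.gcd_pos_of_pos_right _ (NeZero.pos q)
    refine abs_le_of_sq_le_sq' ?_ (by positivity) |>.2
    rw [mul_pow, Real.sq_sqrt hq0.le]
    refine (norm_fourierSum_jacobiFun_sq_le k).trans ?_
    gcongr
    nlinarith
  have hexp : (q : ℂ) * ∑ t ∈ range n, (jacobiSym (b + t) q : ℂ) =
      ∑ k, F k * (ZMod.stdAddChar (k * (b : ZMod q)) *
        ∑ t ∈ range n, ZMod.stdAddChar (k * (t : ZMod q))) := by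
    simp only [Finset.mul_sum]
    symm
    rw [Finset.sum_comm]
    refine Finset.sum_congr rfl fun t _ => ?_
    rw [← jacobiFun_intCast, fourierSum_inversion]
    refine Finset.sum_congr rfl fun k _ => ?_
    rw [← AddChar.map_add_eq_mul]
    push_cast
    rw [mul_add]
  have hnorm : (q : ℝ) * ‖∑ t ∈ range n, (jacobiSym (b + t) q : ℂ)‖ ≤
      ∑ k : ZMod q, if k.val = 0 then 0 else √q * Nat.gcd k.val q *
        ((q / 2 : ℝ) * (1 / (k.val : ℝ) + 1 / ((q : ℝ) - k.val))) := by
    have := congrArg norm hexp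
    rw [norm_mul, Complex.norm_natCast] at this
    rw [this]
    refine (norm_sum_le _ _).trans (Finset.sum_le_sum fun k _ => ?_)
    split_ifs with h
    · rw [(ZMod.val_eq_zero k).1 h, hF0]; simp
    · rw [norm_mul, norm_mul, AddChar.norm_apply, one_mul]
      exact mul_le_mul (hFb k)
        (norm_sum_stdAddChar_le (fun h' => h ((ZMod.val_eq_zero k).2 h')) n)
        (norm_nonneg _) (by positivity)
  rw [sum_zmod_eq_sum_range (fun j => if j = 0 then 0 else √q * Nat.gcd j q *
        ((q / 2 : ℝ) * (1 / (j : ℝ) + 1 / ((q : ℝ) - j))))] at hnorm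
  have hsplit : ∑ j ∈ range q, (if j = 0 then 0 else √q * Nat.gcd j q *
        ((q / 2 : ℝ) * (1 / (j : ℝ) + 1 / ((q : ℝ) - j)))) =
      √q * q / 2 * (∑ j ∈ Ico 1 q, (Nat.gcd j q : ℝ) / j +
        ∑ j ∈ Ico 1 q, (Nat.gcd j q : ℝ) / ((q : ℝ) - j)) := by
    rw [← Finset.sum_add_distrib, Finset.mul_sum, range_eq_Ico,
      Finset.sum_eq_sum_Ico_succ_bot (NeZero.pos q)]
    simp only [if_true, zero_add]
    refine Finset.sum_congr rfl fun j hj => ?_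
    rw [mem_Ico] at hj
    rw [if_neg (by omega)]
    ring
  have hrefl : ∑ j ∈ Ico 1 q, (Nat.gcd j q : ℝ) / ((q : ℝ) - j) =
      ∑ j ∈ Ico 1 q, (Nat.gcd j q : ℝ) / j := by
    refine Finset.sum_nbij' (fun j => q - j) (fun j => q - j) ?_ ?_ ?_ ?_ ?_
    · intro j hj; rw [mem_Ico] at *; omega
    · intro j hj; rw [mem_Ico] at *; omega
    · intro j hj; rw [mem_Ico] at *; omega
    · intro j hj; rw [mem_Ico] at *; omega
    · intro j hj
      rw [mem_Ico] at hj
      rw [Nat.cast_sub (by omega), Nat.gcd_comm (q - j) q, Nat.gcd_self_sub_right (by omega),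
        Nat.gcd_comm]
  rw [hsplit, hrefl] at hnorm
  have hg := sum_gcd_div_le q
  refine le_of_mul_le_mul_left (hnorm.trans ?_) hq0
  calc _ = √q * q * ∑ j ∈ Ico 1 q, (Nat.gcd j q : ℝ) / j := by ring
    _ ≤ √q * q * (#q.divisors * (1 + Real.log q)) := by gcongr
    _ = _ := by ring

/-! ### Counting Gaussian integers -/

/-- The Gaussian integers of norm at most `X`. -/
def gaussBall (X : ℕ) : Finset GaussianInt :=
  ((Icc (-(Nat.sqrt X : ℤ)) (Nat.sqrt X) ×ˢ Icc (-(Nat.sqrt X : ℤ)) (Nat.sqrt X)).image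
    fun p => (⟨p.1, p.2⟩ : GaussianInt)).filter fun z => gnorm z ≤ X

theorem abs_le_sqrt_of_sq_le {a : ℤ} {X : ℕ} (h : a ^ 2 ≤ X) :
    -(Nat.sqrt X : ℤ) ≤ a ∧ a ≤ Nat.sqrt X := by
  have : a.natAbs ≤ Nat.sqrt X := by
    rw [Nat.le_sqrt]
    zify
    rw [← sq, sq_abs]; exact h
  omega

theorem mem_gaussBall {X : ℕ} {z : GaussianInt} : z ∈ gaussBall X ↔ gnorm z ≤ X := by
  unfold gaussBall
  rw [mem_filter, and_iff_right_iff_imp, mem_image]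
  intro h
  have h1 := gnorm_cast z
  refine ⟨(z.re, z.im), ?_, rfl⟩
  have h2 : (gnorm z : ℤ) ≤ X := by exact_mod_cast h
  rw [mem_product, mem_Icc, mem_Icc]
  exact ⟨abs_le_sqrt_of_sq_le (by nlinarith), abs_le_sqrt_of_sq_le (by nlinarith)⟩

theorem card_gaussBall_le {X : ℕ} (hX : 1 ≤ X) : #(gaussBall X) ≤ 9 * X := by
  have h1 : #(gaussBall X) ≤ (2 * Nat.sqrt X + 1) * (2 * Nat.sqrt X + 1) := by
    refine (card_filter_le _ _).trans (card_image_le.trans ?_)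
    rw [card_product, Int.card_Icc]
    refine le_of_eq ?_
    congr 1 <;> omega
  have h2 : Nat.sqrt X * Nat.sqrt X ≤ X := Nat.sqrt_le X
  have h3 : 1 ≤ Nat.sqrt X := by rw [Nat.le_sqrt]; omega
  nlinarith

/-- The Gaussian divisors of `z ≠ 0`. -/
def gaussDivisors (z : GaussianInt) : Finset GaussianInt := by
  classical exact (gaussBall (gnorm z)).filter fun w => w ∣ z

theorem gnorm_dvd {w z : GaussianInt} (h : w ∣ z) : gnorm w ∣ gnorm z := by
  obtain ⟨t, rfl⟩ := h
  exact ⟨gnorm t, gnorm_mul w t⟩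

theorem mem_gaussDivisors {z w : GaussianInt} (hz : z ≠ 0) : w ∈ gaussDivisors z ↔ w ∣ z := by
  classical
  unfold gaussDivisors
  rw [mem_filter, mem_gaussBall, and_iff_right_iff_imp]
  exact fun h => Nat.le_of_dvd (gnorm_pos hz) (gnorm_dvd h)

theorem gnorm_eq_one_of_isUnit {u : GaussianInt} (hu : IsUnit u) : gnorm u = 1 :=
  Zsqrtd.norm_eq_one_iff.2 hu

theorem gnorm_multiset_prod (s : Multiset GaussianInt) : gnorm s.prod = (s.map gnorm).prod := by
  induction s using Multiset.induction with
  | empty => simp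
  | cons a s ih => rw [Multiset.prod_cons, gnorm_mul, ih, Multiset.map_cons, Multiset.prod_cons]

theorem exists_succ_le_mul_rpow {η : ℝ} (hη : 0 < η) :
    ∃ C : ℝ, 1 ≤ C ∧ ∀ (a n : ℕ), 2 ≤ n → (a + 1 : ℝ) ≤ C * ((n : ℝ) ^ η) ^ a := by
  have hl : 0 < η * Real.log 2 := mul_pos hη (Real.log_pos (by norm_num))
  refine ⟨max 1 (1 / (η * Real.log 2)), le_max_left _ _, fun a n hn => ?_⟩
  have h2 : Real.exp (a * (η * Real.log 2)) ≤ ((n : ℝ) ^ η) ^ a := by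
    rw [Real.exp_nat_mul]
    gcongr
    rw [Real.rpow_def_of_pos (by positivity), mul_comm η]
    gcongr
    exact_mod_cast hn
  have h3 := Real.add_one_le_exp (a * (η * Real.log 2))
  set C := max 1 (1 / (η * Real.log 2)) with hC
  have hC1 : 1 ≤ C := le_max_left _ _
  have hC2 : 1 ≤ C * (η * Real.log 2) := by
    calc 1 = (1 / (η * Real.log 2)) * (η * Real.log 2) := by field_simp
      _ ≤ _ := by gcongr; exact le_max_right _ _
  calc (a + 1 : ℝ) ≤ C * (a * (η * Real.log 2) + 1) := by
        have : (a : ℝ) * 1 ≤ a * (C * (η * Real.log 2)) := by gcongr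
        nlinarith
    _ ≤ _ := by gcongr; exact h3.trans h2

/-- The usual divisor bound: the count is a product of (exponent + 1) over primes. Primes of norm
above P satisfy 2 ≤ N(p)^η and cost nothing; the boundedly many others cost a constant C₁ each. -/
theorem exists_card_gaussDivisors_le {η : ℝ} (hη : 0 < η) :
    ∃ C : ℝ, 1 ≤ C ∧ ∀ z : GaussianInt, z ≠ 0 →
      (#(gaussDivisors z) : ℝ) ≤ C * (gnorm z : ℝ) ^ η := by
  classical
  let _ : StrongNormalizationMonoid GaussianInt :=
    UniqueFactorizationMonoid.strongNormalizationMonoid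
  obtain ⟨C₁, hC₁, hC⟩ := exists_succ_le_mul_rpow hη
  obtain ⟨P, hP⟩ : ∃ P : ℕ, ∀ n : ℕ, P < n → (2 : ℝ) ≤ (n : ℝ) ^ η := by
    refine ⟨⌈(2 : ℝ) ^ (1 / η)⌉₊, fun n hn => ?_⟩
    have h1 : (2 : ℝ) ^ (1 / η) ≤ n := (Nat.le_ceil _).trans (by exact_mod_cast hn.le)
    calc (2 : ℝ) = ((2 : ℝ) ^ (1 / η)) ^ η := by
          rw [← Real.rpow_mul (by norm_num), one_div_mul_cancel hη.ne', Real.rpow_one]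
      _ ≤ _ := by gcongr
  refine ⟨9 * C₁ ^ #(gaussBall P), ?_, fun z hz => ?_⟩
  · have := one_le_pow₀ hC₁ (n := #(gaussBall P)); linarith
  set nf := UniqueFactorizationMonoid.normalizedFactors z with hnf
  -- Divisors with equal normalized factors differ by a unit, and units lie in the ball of norm 1,
  -- which has at most 9 elements.
  have hcard : #(gaussDivisors z) ≤ 9 * #(Finset.Iic nf) := by
    have h1 : #(gaussDivisors z) ≤
        9 * #((gaussDivisors z).image UniqueFactorizationMonoid.normalizedFactors) := by
      refine card_le_mul_card_image _ _ fun s hs => ?_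
      obtain ⟨w₀, hw₀, rfl⟩ := mem_image.1 hs
      rw [mem_gaussDivisors hz] at hw₀
      have hw₀0 : w₀ ≠ 0 := ne_zero_of_dvd_ne_zero hz hw₀
      refine le_trans ?_ ((card_image_le (s := gaussBall 1) (f := fun u => w₀ * u)).trans
        (card_gaussBall_le le_rfl))
      refine card_le_card fun w hw => ?_
      rw [mem_filter, mem_gaussDivisors hz] at hw
      have hw0 : w ≠ 0 := ne_zero_of_dvd_ne_zero hz hw.1
      have hass : Associated w₀ w :=
        (UniqueFactorizationMonoid.prod_normalizedFactors hw₀0).symm.trans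
          (hw.2 ▸ UniqueFactorizationMonoid.prod_normalizedFactors hw0)
      obtain ⟨u, rfl⟩ := hass
      exact mem_image.2 ⟨u, mem_gaussBall.2 (gnorm_eq_one_of_isUnit u.isUnit).le, rfl⟩
    refine h1.trans (Nat.mul_le_mul_left _ (card_le_card fun s hs => ?_))
    obtain ⟨w, hw, rfl⟩ := mem_image.1 hs
    rw [mem_gaussDivisors hz] at hw
    rw [Finset.mem_Iic]
    exact (UniqueFactorizationMonoid.dvd_iff_normalizedFactors_le_normalizedFactors
      (ne_zero_of_dvd_ne_zero hz hw) hz).1 hw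
  rw [Multiset.card_Iic] at hcard
  have hnorm : gnorm z = ∏ p ∈ nf.toFinset, gnorm p ^ nf.count p := by
    have h1 : gnorm z = gnorm nf.prod := by
      obtain ⟨u, hu⟩ := UniqueFactorizationMonoid.prod_normalizedFactors hz
      rw [← hu, gnorm_mul, gnorm_eq_one_of_isUnit u.isUnit, mul_one]
    rw [h1, gnorm_multiset_prod, Finset.prod_multiset_map_count]
  have hp2 : ∀ p ∈ nf.toFinset, 2 ≤ gnorm p := by
    intro p hp
    have hpp := UniqueFactorizationMonoid.prime_of_normalized_factor p (Multiset.mem_toFinset.1 hp)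
    have h1 := gnorm_pos hpp.ne_zero
    have h2 : gnorm p ≠ 1 := fun h => hpp.not_isUnit (Zsqrtd.norm_eq_one_iff.1 h)
    omega
  have hprod : ∏ p ∈ nf.toFinset, ((nf.count p : ℝ) + 1) ≤
      ∏ p ∈ nf.toFinset, ((if gnorm p ≤ P then C₁ else 1) *
        ((gnorm p : ℝ) ^ η) ^ nf.count p) := by
    refine Finset.prod_le_prod (fun p _ => by positivity) fun p hp => ?_
    split_ifs with h
    · exact hC _ _ (hp2 p hp)
    · rw [one_mul]
      calc ((nf.count p : ℝ) + 1) ≤ 2 ^ nf.count p := by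
            exact_mod_cast Nat.lt_two_pow_self
        _ ≤ _ := by gcongr; exact hP _ (by omega)
  have hsmall : ∏ p ∈ nf.toFinset, (if gnorm p ≤ P then C₁ else 1) ≤ C₁ ^ #(gaussBall P) := by
    rw [← Finset.prod_filter, prod_const]
    refine pow_le_pow_right₀ hC₁ (card_le_card fun p hp => ?_)
    exact mem_gaussBall.2 (mem_filter.1 hp).2
  have hbig : ∏ p ∈ nf.toFinset, ((gnorm p : ℝ) ^ η) ^ nf.count p = (gnorm z : ℝ) ^ η := by
    rw [hnorm]
    push_cast
    rw [← Real.finsetProd_rpow _ _ fun p _ => by positivity]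
    refine Finset.prod_congr rfl fun p _ => ?_
    rw [← Real.rpow_natCast, ← Real.rpow_mul (by positivity), ← Real.rpow_natCast,
      ← Real.rpow_mul (by positivity), mul_comm]
  rw [prod_mul_distrib, hbig] at hprod
  calc (#(gaussDivisors z) : ℝ) ≤ 9 * ∏ p ∈ nf.toFinset, ((nf.count p : ℝ) + 1) := by
        exact_mod_cast hcard
    _ ≤ 9 * (C₁ ^ #(gaussBall P) * (gnorm z : ℝ) ^ η) := by
        gcongr
        exact hprod.trans (by gcongr)
    _ = _ := by ring

theorem gnorm_natCast (n : ℕ) : gnorm (n : GaussianInt) = n ^ 2 := by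
  have := gnorm_cast (n : GaussianInt)
  simp at this
  exact_mod_cast this

/-- An element of norm n divides n, whose own norm is n²; hence the divisor bound is used with η/2.
-/
theorem exists_card_gnorm_eq_le {η : ℝ} (hη : 0 < η) :
    ∃ C : ℝ, 1 ≤ C ∧ ∀ n : ℕ, 1 ≤ n → ∀ S : Finset GaussianInt, (∀ z ∈ S, gnorm z = n) →
      (#S : ℝ) ≤ C * (n : ℝ) ^ η := by
  obtain ⟨C, hC1, hC⟩ := exists_card_gaussDivisors_le (half_pos hη)
  refine ⟨C, hC1, fun n hn S hS => ?_⟩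
  have hn0 : (n : GaussianInt) ≠ 0 := Nat.cast_ne_zero.2 (by omega)
  have h1 : #S ≤ #(gaussDivisors (n : GaussianInt)) := by
    refine card_le_card fun z hz => ?_
    rw [mem_gaussDivisors hn0]
    exact ⟨star z, by rw [mul_star_eq_gnorm, hS z hz]⟩
  calc (#S : ℝ) ≤ #(gaussDivisors (n : GaussianInt)) := by exact_mod_cast h1
    _ ≤ C * (gnorm (n : GaussianInt) : ℝ) ^ (η / 2) := hC _ hn0
    _ = C * (n : ℝ) ^ η := by
        rw [gnorm_natCast]
        push_cast
        rw [← Real.rpow_natCast, ← Real.rpow_mul (by positivity)]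
        congr 2; push_cast; ring

theorem exists_card_divisors_le {η : ℝ} (hη : 0 < η) :
    ∃ C : ℝ, 1 ≤ C ∧ ∀ n : ℕ, 1 ≤ n → (#n.divisors : ℝ) ≤ C * (n : ℝ) ^ η := by
  classical
  obtain ⟨C, hC1, hC⟩ := exists_card_gaussDivisors_le (half_pos hη)
  refine ⟨C, hC1, fun n hn => ?_⟩
  have hn0 : (n : GaussianInt) ≠ 0 := Nat.cast_ne_zero.2 (by omega)
  have h1 : #n.divisors ≤ #(gaussDivisors (n : GaussianInt)) := by
    refine card_le_card_of_injOn (fun a => (a : GaussianInt)) ?_ ?_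
    · intro a ha
      have ha := Nat.dvd_of_mem_divisors ha
      exact (mem_gaussDivisors hn0).2 (by exact_mod_cast Nat.cast_dvd_cast ha)
    · intro a _ b _ h
      have := congrArg Zsqrtd.re h
      simpa using this
  calc (#n.divisors : ℝ) ≤ #(gaussDivisors (n : GaussianInt)) := by exact_mod_cast h1
    _ ≤ C * (gnorm (n : GaussianInt) : ℝ) ^ (η / 2) := hC _ hn0
    _ = C * (n : ℝ) ^ η := by
        rw [gnorm_natCast]
        push_cast
        rw [← Real.rpow_natCast, ← Real.rpow_mul (by positivity)]
        congr 2; push_cast; ring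

/-! ### Sums of periodic functions over boxes -/

theorem sum_range_periodic {q : ℕ} [NeZero q] (h : ZMod q → ℂ) (c : ℤ) :
    ∑ t ∈ range q, h ((c + t : ℤ) : ZMod q) = ∑ x, h x := by
  refine Finset.sum_nbij (fun t => ((c + t : ℤ) : ZMod q)) (by simp) ?_ ?_ (by simp)
  · intro a ha b hb hab
    simp only [coe_range, Set.mem_Iio] at ha hb
    push_cast at hab
    have := add_left_cancel hab
    have h2 := congrArg ZMod.val this
    rwa [ZMod.val_cast_of_lt ha, ZMod.val_cast_of_lt hb] at h2
  · intro x _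
    refine ⟨(x - (c : ZMod q)).val, by simpa using ZMod.val_lt _, ?_⟩
    push_cast
    rw [ZMod.natCast_zmod_val]; ring

theorem sum_range_mul_periodic {q : ℕ} [NeZero q] (h : ZMod q → ℂ) (c : ℤ) (n : ℕ) :
    ∑ t ∈ range (n * q), h ((c + t : ℤ) : ZMod q) = n * ∑ x, h x := by
  induction n with
  | zero => simp
  | succ n ih =>
    rw [add_mul, one_mul, Finset.sum_range_add, ih]
    have : ∑ t ∈ range q, h ((c + (n * q + t : ℕ) : ℤ) : ZMod q) = ∑ x, h x := by
      rw [← sum_range_periodic h (c + n * q)]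
      refine Finset.sum_congr rfl fun t _ => ?_
      push_cast; congr 1; ring
    rw [this]; push_cast; ring

theorem norm_sum_range_sub_le {q : ℕ} [NeZero q] (h : ZMod q → ℂ) {B : ℝ} (hB : ∀ x, ‖h x‖ ≤ B)
    (c : ℤ) (n : ℕ) :
    ‖∑ t ∈ range n, h ((c + t : ℤ) : ZMod q) - (n / q : ℕ) * ∑ x, h x‖ ≤ q * B := by
  have hB0 : 0 ≤ B := (norm_nonneg _).trans (hB 0)
  have hn : range n = range ((n / q) * q + n % q) := by rw [Nat.div_add_mod']
  rw [hn, Finset.sum_range_add, sum_range_mul_periodic, add_sub_cancel_left]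
  refine (norm_sum_le _ _).trans ((Finset.sum_le_sum fun t _ => hB _).trans ?_)
  rw [sum_const, card_range, nsmul_eq_mul]
  gcongr
  exact_mod_cast (Nat.mod_lt n (NeZero.pos q)).le

/-- Complete periods cancel, so only an incomplete strip in each direction survives, each
contributing at most nq. -/
theorem norm_sum_box_le {q : ℕ} [NeZero q] (f : ZMod q → ZMod q → ℂ) (hf : ∀ x y, ‖f x y‖ ≤ 1)
    (h0 : ∑ x, ∑ y, f x y = 0) (c c' : ℤ) (n : ℕ) :
    ‖∑ a ∈ range n, ∑ b ∈ range n, f ((c + a : ℤ) : ZMod q) ((c' + b : ℤ) : ZMod q)‖ ≤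
      2 * n * q := by
  have hG : ∀ x, ‖∑ y, f x y‖ ≤ q := fun x =>
    (norm_sum_le _ _).trans ((Finset.sum_le_sum fun y _ => hf x y).trans (by simp [ZMod.card]))
  have h1 := norm_sum_range_sub_le (fun x => ∑ y, f x y) hG c n
  rw [h0, mul_zero, sub_zero] at h1
  have h2 : ∑ a ∈ range n, ∑ b ∈ range n, f ((c + a : ℤ) : ZMod q) ((c' + b : ℤ) : ZMod q) =
      ∑ a ∈ range n, (∑ b ∈ range n, f ((c + a : ℤ) : ZMod q) ((c' + b : ℤ) : ZMod q) -
        (n / q : ℕ) * ∑ y, f ((c + a : ℤ) : ZMod q) y) +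
      (n / q : ℕ) * ∑ a ∈ range n, ∑ y, f ((c + a : ℤ) : ZMod q) y := by
    rw [Finset.mul_sum, ← Finset.sum_add_distrib]
    exact Finset.sum_congr rfl fun a _ => by ring
  rw [h2]
  have h3 : ‖∑ a ∈ range n, (∑ b ∈ range n, f ((c + a : ℤ) : ZMod q) ((c' + b : ℤ) : ZMod q) -
        (n / q : ℕ) * ∑ y, f ((c + a : ℤ) : ZMod q) y)‖ ≤ n * q := by
    refine (norm_sum_le _ _).trans ((Finset.sum_le_sum fun (a : ℕ) _ =>
      norm_sum_range_sub_le (f ((c + a : ℤ) : ZMod q)) (hf _) c' n).trans ?_)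
    simp
  have h4 : ‖((n / q : ℕ) : ℂ) * ∑ a ∈ range n, ∑ y, f ((c + a : ℤ) : ZMod q) y‖ ≤ n * q := by
    rw [norm_mul, Complex.norm_natCast]
    calc ((n / q : ℕ) : ℝ) * _ ≤ ((n / q : ℕ) : ℝ) * (q * q) := by gcongr
      _ = ((n / q * q : ℕ) : ℝ) * q := by push_cast; ring
      _ ≤ n * q := by
        gcongr
        exact Nat.div_mul_le_self n q
  calc _ ≤ (n * q : ℝ) + n * q := (norm_add_le _ _).trans (add_le_add h3 h4)
    _ = _ := by ring

/-! ### Bilinear forms in the quadratic residue symbol -/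

/-- The Gaussian integers whose coordinates are at most `T` in absolute value. -/
def gaussBox (T : ℕ) : Finset GaussianInt :=
  (range (2 * T + 1) ×ˢ range (2 * T + 1)).image
    fun p => (⟨-(T : ℤ) + p.1, -(T : ℤ) + p.2⟩ : GaussianInt)

theorem mem_gaussBox_of {T : ℕ} {z : GaussianInt} (h : gnorm z ≤ T ^ 2) : z ∈ gaussBox T := by
  have h1 := gnorm_cast z
  have h2 : (gnorm z : ℤ) ≤ ((T ^ 2 : ℕ) : ℤ) := by exact_mod_cast h
  have hT : Nat.sqrt (T ^ 2) = T := Nat.sqrt_eq' T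
  have hre := abs_le_sqrt_of_sq_le (a := z.re) (X := T ^ 2) (by nlinarith)
  have him := abs_le_sqrt_of_sq_le (a := z.im) (X := T ^ 2) (by nlinarith)
  rw [hT] at hre him
  refine mem_image.2 ⟨((z.re + T).toNat, (z.im + T).toNat), ?_, ?_⟩
  · rw [mem_product, mem_range, mem_range]; omega
  · ext
    · simp only; omega
    · simp only; omega

theorem sum_gaussBox (T : ℕ) (F : GaussianInt → ℂ) :
    ∑ z ∈ gaussBox T, F z = ∑ a ∈ range (2 * T + 1), ∑ b ∈ range (2 * T + 1),
      F ⟨-(T : ℤ) + a, -(T : ℤ) + b⟩ := by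
  unfold gaussBox
  rw [Finset.sum_image, Finset.sum_product]
  rintro ⟨a, b⟩ _ ⟨a', b'⟩ _ h
  have h1 := congrArg Zsqrtd.re h
  have h2 := congrArg Zsqrtd.im h
  simp at h1 h2
  rw [h1, h2]

theorem card_gaussBox_le (T : ℕ) : #(gaussBox T) ≤ (2 * T + 1) ^ 2 := by
  refine card_image_le.trans ?_
  rw [card_product, card_range, sq]

/-- The summand is periodic modulo q = N(w)N(w') in both coordinates. Scaling z by a rational
integer m multiplies it by (m/q), and m can be chosen with (m/q) = -1 when q is not a square, so a
full period sums to zero. -/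
theorem norm_sum_dirichletSym_mul_le {w w' : GaussianInt} (hw : IsPrimary w) (hw' : IsPrimary w')
    (hsq : ¬ IsSquare (gnorm w * gnorm w')) (T : ℕ) :
    ‖∑ z ∈ gaussBox T, (dirichletSym z w : ℂ) * (dirichletSym z w' : ℂ)‖ ≤
      2 * (2 * T + 1) * (gnorm w * gnorm w') := by
  set q := gnorm w * gnorm w' with hq
  have hw0 := gnorm_pos hw.ne_zero
  have hw'0 := gnorm_pos hw'.ne_zero
  have : NeZero q := ⟨(Nat.mul_pos hw0 hw'0).ne'⟩
  have hodd : q % 2 = 1 := by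
    have h1 := hw.gnorm_mod_four
    have h2 := hw'.gnorm_mod_four
    rw [hq, Nat.mul_mod, show gnorm w % 2 = 1 by omega, show gnorm w' % 2 = 1 by omega]
  obtain ⟨m, hm⟩ := exists_jacobiSym_eq_neg_one hodd hsq
  have hu : IsUnit (m : ZMod q) := by
    refine isUnit_of_jacobiFun_ne_zero (q := q) ?_
    rw [jacobiFun_intCast, hm]; simp
  set f : ZMod q → ZMod q → ℂ := fun x y =>
    (dirichletSym ⟨x.val, y.val⟩ w : ℂ) * (dirichletSym ⟨x.val, y.val⟩ w' : ℂ) with hf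
  have hcongr : ∀ v : GaussianInt, gnorm v ∣ q → ∀ a b a' b' : ℤ, (q : ℤ) ∣ a - a' →
      (q : ℤ) ∣ b - b' → dirichletSym ⟨a, b⟩ v = dirichletSym ⟨a', b'⟩ v := by
    intro v hv a b a' b' ha hb
    unfold dirichletSym
    refine jacobiSym.mod_left' ((Int.modEq_iff_dvd).2 ?_)
    have hv' : (gnorm v : ℤ) ∣ q := by exact_mod_cast hv
    have h1 := (hv'.trans ha).mul_left v.re
    have h2 := (hv'.trans hb).mul_left v.im
    have := dvd_sub h2 h1
    have e : (v * ⟨a', b'⟩ : GaussianInt).re - (v * ⟨a, b⟩ : GaussianInt).re =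
        v.im * (b - b') - v.re * (a - a') := by
      simp only [Zsqrtd.re_mul]; ring
    rwa [e]
  have hval : ∀ a : ℤ, (q : ℤ) ∣ a - ((a : ZMod q).val : ℤ) := by
    intro a
    rw [← ZMod.intCast_zmod_eq_zero_iff_dvd]; simp
  have hdw : gnorm w ∣ q := ⟨_, rfl⟩
  have hdw' : gnorm w' ∣ q := ⟨gnorm w, mul_comm _ _⟩
  have hfint : ∀ a b : ℤ, (dirichletSym ⟨a, b⟩ w : ℂ) * (dirichletSym ⟨a, b⟩ w' : ℂ) =
      f (a : ZMod q) (b : ZMod q) := by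
    intro a b
    rw [hf]
    simp only
    rw [hcongr w hdw _ _ _ _ (hval a) (hval b), hcongr w' hdw' _ _ _ _ (hval a) (hval b)]
  have hscale : ∀ v : GaussianInt, ∀ a b : ℤ, dirichletSym ⟨m * a, m * b⟩ v =
      jacobiSym m (gnorm v) * dirichletSym ⟨a, b⟩ v := by
    intro v a b
    unfold dirichletSym
    rw [← jacobiSym.mul_left]
    congr 1
    simp only [Zsqrtd.re_mul]; ring
  have hneg : ∀ x y : ZMod q, f (m * x) (m * y) = - f x y := by
    intro x y
    have hx : x = ((x.val : ℤ) : ZMod q) := by simp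
    have hy : y = ((y.val : ℤ) : ZMod q) := by simp
    rw [hx, hy, ← Int.cast_mul, ← Int.cast_mul, ← hfint, ← hfint, hscale, hscale]
    rw [hq, jacobiSym.mul_right' _ hw0.ne' hw'0.ne'] at hm
    have hm' : (jacobiSym m (gnorm w) : ℂ) * (jacobiSym m (gnorm w') : ℂ) = -1 := by
      exact_mod_cast hm
    push_cast
    linear_combination ((dirichletSym ⟨x.val, y.val⟩ w : ℂ) *
      (dirichletSym ⟨x.val, y.val⟩ w' : ℂ)) * hm'
  have h0 : ∑ x, ∑ y, f x y = 0 := by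
    obtain ⟨u, hu⟩ := hu
    have h1 : ∑ x, ∑ y, f x y = ∑ x, ∑ y, f (u * x) (u * y) := by
      symm
      refine Fintype.sum_equiv u.mulLeft _ _ fun x => ?_
      exact Fintype.sum_equiv u.mulLeft _ _ fun y => by simp
    rw [hu] at h1
    simp only [hneg, sum_neg_distrib] at h1
    linear_combination h1 / 2
  have hf1 : ∀ x y, ‖f x y‖ ≤ 1 := by
    intro x y
    rw [hf]; simp only
    rw [norm_mul]
    exact mul_le_one₀ (norm_dirichletSym_le _ _) (norm_nonneg _) (norm_dirichletSym_le _ _)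
  rw [sum_gaussBox]
  simp only [hfint]
  refine (norm_sum_box_le f hf1 h0 _ _ _).trans (le_of_eq ?_)
  rw [hq]; push_cast; ring

/-- Group the pairs by z = ww'. Then N(z) = m² with m ≤ N, which leaves N values of m, few z for
each m, and few factorizations of each z. So the diagonal is hardly larger than N out of the N²
pairs. -/
theorem exists_card_square_pairs_le {η : ℝ} (hη : 0 < η) :
    ∃ C : ℝ, 1 ≤ C ∧ ∀ (N : ℕ) (T : Finset GaussianInt), 1 ≤ N →
      (∀ w ∈ T, w ≠ 0 ∧ gnorm w ≤ N) →
      (#{p ∈ T ×ˢ T | IsSquare (gnorm p.1 * gnorm p.2)} : ℝ) ≤ C * (N : ℝ) ^ (1 + η) := by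
  classical
  obtain ⟨C₁, hC₁, h₁⟩ := exists_card_gaussDivisors_le (η := η / 4) (by positivity)
  obtain ⟨C₂, hC₂, h₂⟩ := exists_card_gnorm_eq_le (η := η / 4) (by positivity)
  refine ⟨C₁ * C₂, one_le_mul_of_one_le_of_one_le hC₁ hC₂, fun N T hN hT => ?_⟩
  have hN' : (1 : ℝ) ≤ N := by exact_mod_cast hN
  set P := {p ∈ T ×ˢ T | IsSquare (gnorm p.1 * gnorm p.2)} with hP
  have hPmem : ∀ p ∈ P, (p.1 ≠ 0 ∧ gnorm p.1 ≤ N) ∧ (p.2 ≠ 0 ∧ gnorm p.2 ≤ N) ∧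
      IsSquare (gnorm p.1 * gnorm p.2) := by
    intro p hp
    rw [hP, mem_filter, mem_product] at hp
    exact ⟨hT _ hp.1.1, hT _ hp.1.2, hp.2⟩
  set I := P.image fun p => p.1 * p.2 with hI
  set D : ℝ := C₁ * ((N : ℝ) ^ 2) ^ (η / 4) with hD
  have hfib : ∀ z ∈ I, (#{p ∈ P | p.1 * p.2 = z} : ℝ) ≤ D := by
    intro z hz
    obtain ⟨p, hp, rfl⟩ := mem_image.1 hz
    obtain ⟨⟨h1, h2⟩, ⟨h3, h4⟩, _⟩ := hPmem p hp
    have hz0 : p.1 * p.2 ≠ 0 := mul_ne_zero h1 h3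
    have hle : #{p' ∈ P | p'.1 * p'.2 = p.1 * p.2} ≤ #(gaussDivisors (p.1 * p.2)) := by
      refine card_le_card_of_injOn (fun p' => p'.1) ?_ ?_
      · intro p' hp'
        have hp' := mem_filter.1 hp'
        exact (mem_gaussDivisors hz0).2 ⟨p'.2, hp'.2.symm⟩
      · intro a ha b hb hab
        have ha := mem_filter.1 ha
        have hb := mem_filter.1 hb
        simp only at hab
        refine Prod.ext hab (mul_left_cancel₀ (hPmem a ha.1).1.1 ?_)
        rw [ha.2, hab, hb.2]
    calc (#{p' ∈ P | p'.1 * p'.2 = p.1 * p.2} : ℝ) ≤ #(gaussDivisors (p.1 * p.2)) := by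
          exact_mod_cast hle
      _ ≤ C₁ * (gnorm (p.1 * p.2) : ℝ) ^ (η / 4) := h₁ _ hz0
      _ ≤ _ := by
          rw [hD]
          gcongr
          rw [gnorm_mul, sq]
          exact_mod_cast Nat.mul_le_mul h2 h4
  have hcardP : (#P : ℝ) ≤ D * #I := by
    have : #P = ∑ z ∈ I, #{p ∈ P | p.1 * p.2 = z} := card_eq_sum_card_image _ _
    rw [this]
    push_cast
    refine (Finset.sum_le_sum hfib).trans (le_of_eq ?_)
    rw [sum_const, nsmul_eq_mul, mul_comm]
  have hIcard : (#I : ℝ) ≤ N * (C₂ * ((N : ℝ) ^ 2) ^ (η / 4)) := by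
    have hsub : I ⊆ (Icc 1 N).biUnion fun m => {z ∈ I | gnorm z = m ^ 2} := by
      intro z hz
      obtain ⟨p, hp, hpz⟩ := mem_image.1 hz
      obtain ⟨⟨h1, h2⟩, ⟨h3, h4⟩, ⟨m, hm⟩⟩ := hPmem p hp
      rw [mem_biUnion]
      have hg : gnorm z = m ^ 2 := by rw [← hpz, gnorm_mul, hm, sq]
      have hpos : 0 < m * m := hm ▸ Nat.mul_pos (gnorm_pos h1) (gnorm_pos h3)
      refine ⟨m, mem_Icc.2 ⟨Nat.pos_of_ne_zero (by rintro rfl; simp at hpos), ?_⟩,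
        mem_filter.2 ⟨hz, hg⟩⟩
      by_contra h
      have := Nat.mul_le_mul h2 h4
      rw [hm] at this
      nlinarith
    have hle : #I ≤ ∑ m ∈ Icc 1 N, #{z ∈ I | gnorm z = m ^ 2} :=
      (card_le_card hsub).trans card_biUnion_le
    calc (#I : ℝ) ≤ ∑ m ∈ Icc 1 N, (#{z ∈ I | gnorm z = m ^ 2} : ℝ) := by exact_mod_cast hle
      _ ≤ ∑ m ∈ Icc 1 N, C₂ * ((N : ℝ) ^ 2) ^ (η / 4) := by
          refine Finset.sum_le_sum fun m hm => ?_
          rw [mem_Icc] at hm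
          refine (h₂ (m ^ 2) (Nat.one_le_pow _ _ hm.1) _ fun z hz => (mem_filter.1 hz).2).trans ?_
          gcongr
          push_cast
          gcongr
          exact_mod_cast hm.2
      _ = _ := by simp
  have hDpos : 0 ≤ D := by positivity
  calc (#P : ℝ) ≤ D * (N * (C₂ * ((N : ℝ) ^ 2) ^ (η / 4))) :=
        hcardP.trans (mul_le_mul_of_nonneg_left hIcard hDpos)
    _ = C₁ * C₂ * ((N : ℝ) * (((N : ℝ) ^ 2) ^ (η / 4) * ((N : ℝ) ^ 2) ^ (η / 4))) := by
        rw [hD]; ring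
    _ = _ := by
        congr 1
        rw [← Real.rpow_natCast, ← Real.rpow_mul (by positivity), ← Real.rpow_add (by positivity)]
        conv_lhs => rw [← Real.rpow_one (N : ℝ), ← Real.rpow_mul (by positivity),
          ← Real.rpow_add (by positivity)]
        congr 1; push_cast; ring

theorem sum_norm_sq_le_sum_correlation {ι κ : Type*} (B : Finset ι) (T : Finset κ) (s : ι → κ → ℤ)
    (θ : κ → ℂ) (hθ : ∀ w, ‖θ w‖ ≤ 1) :
    ∑ z ∈ B, ‖∑ w ∈ T, θ w * (s z w : ℂ)‖ ^ 2 ≤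
      ∑ p ∈ T ×ˢ T, ‖∑ z ∈ B, (s z p.1 : ℂ) * (s z p.2 : ℂ)‖ := by
  have h : ((∑ z ∈ B, ‖∑ w ∈ T, θ w * (s z w : ℂ)‖ ^ 2 : ℝ) : ℂ) =
      ∑ p ∈ T ×ˢ T, θ p.1 * (starRingEnd ℂ) (θ p.2) *
        ∑ z ∈ B, (s z p.1 : ℂ) * (s z p.2 : ℂ) := by
    push_cast
    simp only [Finset.mul_sum]
    rw [Finset.sum_comm]
    refine Finset.sum_congr rfl fun z _ => ?_
    rw [← Complex.mul_conj', map_sum, Finset.sum_mul_sum, ← Finset.sum_product']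
    refine Finset.sum_congr rfl fun p _ => ?_
    rw [map_mul, map_intCast]; ring
  have h0 : 0 ≤ ∑ z ∈ B, ‖∑ w ∈ T, θ w * (s z w : ℂ)‖ ^ 2 :=
    Finset.sum_nonneg fun _ _ => by positivity
  rw [← Real.norm_of_nonneg h0, ← Complex.norm_real, h]
  refine (norm_sum_le _ _).trans (Finset.sum_le_sum fun p _ => ?_)
  rw [norm_mul, norm_mul, RCLike.norm_conj]
  exact mul_le_of_le_one_left (norm_nonneg _)
    (mul_le_one₀ (hθ _) (norm_nonneg _) (hθ _))

/-- The side M³ is that of a box containing products of six elements of norm at most M. Pairs with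
square norm product contribute M⁶N^(1+η). The others contribute O(N²·M³N²), which is no larger
because N ≤ M; this is why six factors are taken. -/
theorem exists_second_moment_le {η : ℝ} (hη : 0 < η) :
    ∃ C : ℝ, 1 ≤ C ∧ ∀ (M N : ℕ), 1 ≤ N → N ≤ M → ∀ T : Finset GaussianInt,
      (∀ w ∈ T, IsPrimary w ∧ gnorm w ≤ N) → ∀ θ : GaussianInt → ℂ, (∀ w, ‖θ w‖ ≤ 1) →
      ∑ z ∈ gaussBox (M ^ 3), ‖∑ w ∈ T, θ w * (dirichletSym z w : ℂ)‖ ^ 2 ≤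
        C * ((M : ℝ) ^ 6 * (N : ℝ) ^ (1 + η)) := by
  classical
  obtain ⟨C, hC, h⟩ := exists_card_square_pairs_le hη
  refine ⟨9 * C + 486, by linarith, fun M N hN hNM T hT θ hθ => ?_⟩
  have hN' : (1 : ℝ) ≤ N := by exact_mod_cast hN
  have hNM' : (N : ℝ) ≤ M := by exact_mod_cast hNM
  have hM1 : (1 : ℝ) ≤ M := hN'.trans hNM'
  have hM3 : (1 : ℝ) ≤ (M : ℝ) ^ 3 := one_le_pow₀ hM1
  refine (sum_norm_sq_le_sum_correlation _ T (fun z w => dirichletSym z w) θ hθ).trans ?_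
  have hpt : ∀ p ∈ T ×ˢ T, ‖∑ z ∈ gaussBox (M ^ 3), (dirichletSym z p.1 : ℂ) *
      (dirichletSym z p.2 : ℂ)‖ ≤ (if IsSquare (gnorm p.1 * gnorm p.2) then 9 * (M : ℝ) ^ 6 else 0) +
        6 * (M : ℝ) ^ 3 * (N : ℝ) ^ 2 := by
    intro p hp
    rw [mem_product] at hp
    split_ifs with hsq
    · have h1 : ‖∑ z ∈ gaussBox (M ^ 3), (dirichletSym z p.1 : ℂ) * (dirichletSym z p.2 : ℂ)‖ ≤
          #(gaussBox (M ^ 3)) := by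
        refine (norm_sum_le _ _).trans ((Finset.sum_le_sum (g := fun _ => (1 : ℝ))
          fun z _ => ?_).trans (by simp))
        rw [norm_mul]
        exact mul_le_one₀ (norm_dirichletSym_le _ _) (norm_nonneg _) (norm_dirichletSym_le _ _)
      have h2 : (#(gaussBox (M ^ 3)) : ℝ) ≤ (2 * (M : ℝ) ^ 3 + 1) ^ 2 := by
        exact_mod_cast card_gaussBox_le (M ^ 3)
      have h3 : (2 * (M : ℝ) ^ 3 + 1) ^ 2 ≤ 9 * (M : ℝ) ^ 6 := by nlinarith
      have h4 : (0 : ℝ) ≤ 6 * (M : ℝ) ^ 3 * (N : ℝ) ^ 2 := by positivity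
      linarith
    · rw [zero_add]
      refine (norm_sum_dirichletSym_mul_le (hT _ hp.1).1 (hT _ hp.2).1 hsq _).trans ?_
      have h1 : (gnorm p.1 : ℝ) ≤ N := by exact_mod_cast (hT _ hp.1).2
      have h2 : (gnorm p.2 : ℝ) ≤ N := by exact_mod_cast (hT _ hp.2).2
      push_cast
      calc 2 * (2 * (M : ℝ) ^ 3 + 1) * (gnorm p.1 * gnorm p.2)
          ≤ 2 * (3 * (M : ℝ) ^ 3) * (N * N) := by gcongr; linarith
        _ = _ := by ring
  refine (Finset.sum_le_sum hpt).trans ?_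
  rw [Finset.sum_add_distrib, ← Finset.sum_filter, sum_const, sum_const, nsmul_eq_mul,
    nsmul_eq_mul, card_product]
  have hP := h N T hN fun w hw => ⟨(hT w hw).1.ne_zero, (hT w hw).2⟩
  have hTc : (#T : ℝ) ≤ 9 * N := by
    have : #T ≤ #(gaussBall N) := card_le_card fun w hw => mem_gaussBall.2 (hT w hw).2
    exact_mod_cast this.trans (card_gaussBall_le hN)
  have hpow : (N : ℝ) ≤ (N : ℝ) ^ (1 + η) := by
    conv_lhs => rw [← Real.rpow_one (N : ℝ)]
    exact Real.rpow_le_rpow_of_exponent_le hN' (by linarith)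
  push_cast
  calc _ ≤ C * (N : ℝ) ^ (1 + η) * (9 * (M : ℝ) ^ 6) +
        (9 * N) * (9 * N) * (6 * (M : ℝ) ^ 3 * (N : ℝ) ^ 2) := by gcongr
    _ = 9 * C * ((M : ℝ) ^ 6 * (N : ℝ) ^ (1 + η)) + 486 * ((M : ℝ) ^ 3 * (N : ℝ) ^ 3 * N) := by
        ring
    _ ≤ 9 * C * ((M : ℝ) ^ 6 * (N : ℝ) ^ (1 + η)) +
        486 * ((M : ℝ) ^ 3 * (M : ℝ) ^ 3 * (N : ℝ) ^ (1 + η)) := by gcongr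
    _ = _ := by ring

theorem gnorm_prod {ι : Type*} (s : Finset ι) (t : ι → GaussianInt) :
    gnorm (∏ i ∈ s, t i) = ∏ i ∈ s, gnorm (t i) := by
  classical
  induction s using Finset.induction with
  | empty => simp
  | insert a s ha ih => rw [prod_insert ha, prod_insert ha, gnorm_mul, ih]

theorem dirichletSym_prod {w : GaussianInt} (hw : IsPrimary w) (hp : IsPrimitive w) {n : ℕ}
    (t : Fin n → GaussianInt) :
    dirichletSym (∏ i, t i) w = ∏ i, dirichletSym (t i) w := by
  induction n with
  | zero =>
    simp only [univ_eq_empty, prod_empty]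
    unfold dirichletSym
    rw [mul_one]; exact jacobiSym_re_gnorm hw hp
  | succ n ih => rw [Fin.prod_univ_succ, Fin.prod_univ_succ, dirichletSym_mul_left hw hp, ih]

/-- Raising the z-sum to the sixth power makes the variable z range over products of norm up to M⁶,
long enough compared with N² for the second moment to be diagonal. Unwinding Hölder and Cauchy gives
b¹² ≪ N¹⁰·M⁶·M⁶·N up to η-powers, hence the exponent 11/12. -/
theorem exists_bilinear_dirichletSym_le {η : ℝ} (hη : 0 < η) :
    ∃ C : ℝ, 1 ≤ C ∧ ∀ (M N : ℕ), 1 ≤ N → N ≤ M → ∀ S T : Finset GaussianInt,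
      (∀ z ∈ S, z ≠ 0 ∧ gnorm z ≤ M) →
      (∀ w ∈ T, IsPrimary w ∧ IsPrimitive w ∧ gnorm w ≤ N) →
      ∀ α β : GaussianInt → ℂ, (∀ z, ‖α z‖ ≤ 1) → (∀ w, ‖β w‖ ≤ 1) →
      ‖∑ z ∈ S, ∑ w ∈ T, α z * β w * (dirichletSym z w : ℂ)‖ ≤
        C * ((M : ℝ) ^ (1 + η) * (N : ℝ) ^ (11 / 12 : ℝ)) := by
  classical
  obtain ⟨C₁, hC₁, h₁⟩ := exists_card_gaussDivisors_le (η := η / 6) (by positivity)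
  obtain ⟨C₂, hC₂, h₂⟩ := exists_second_moment_le (η := 6 * η) (by positivity)
  set K : ℝ := 9 ^ 16 * (C₁ ^ 6 * C₂) with hK
  have hK1 : 1 ≤ K := by
    have : 1 ≤ C₁ ^ 6 * C₂ := one_le_mul_of_one_le_of_one_le (one_le_pow₀ hC₁) hC₂
    rw [hK]; nlinarith
  refine ⟨K, hK1, fun M N hN hNM S T hS hT α β hα hβ => ?_⟩
  have hN' : (1 : ℝ) ≤ N := by exact_mod_cast hN
  have hNM' : (N : ℝ) ≤ M := by exact_mod_cast hNM
  have hM1 : (1 : ℝ) ≤ M := hN'.trans hNM'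
  have hTc : (#T : ℝ) ≤ 9 * N := by
    have : #T ≤ #(gaussBall N) := card_le_card fun w hw => mem_gaussBall.2 (hT w hw).2.2
    exact_mod_cast this.trans (card_gaussBall_le hN)
  have hSc : (#S : ℝ) ≤ 9 * M := by
    have : #S ≤ #(gaussBall M) := card_le_card fun w hw => mem_gaussBall.2 (hS w hw).2
    exact_mod_cast this.trans (card_gaussBall_le (hN.trans hNM))
  set A : GaussianInt → ℂ := fun w => ∑ z ∈ S, α z * (dirichletSym z w : ℂ) with hA
  -- Hölder's inequality in the modulus
  have hB : ‖∑ z ∈ S, ∑ w ∈ T, α z * β w * (dirichletSym z w : ℂ)‖ ≤ ∑ w ∈ T, ‖A w‖ := by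
    rw [Finset.sum_comm]
    refine (norm_sum_le _ _).trans (Finset.sum_le_sum fun w _ => ?_)
    have : ∑ z ∈ S, α z * β w * (dirichletSym z w : ℂ) = β w * A w := by
      rw [hA]; simp only
      rw [Finset.mul_sum]
      exact Finset.sum_congr rfl fun z _ => by ring
    rw [this, norm_mul]
    exact mul_le_of_le_one_left (norm_nonneg _) (hβ w)
  have hHolder : (∑ w ∈ T, ‖A w‖) ^ 6 ≤ (#T : ℝ) ^ 5 * ∑ w ∈ T, ‖A w‖ ^ 6 :=
    pow_sum_le_card_mul_sum_pow (fun w _ => norm_nonneg (A w)) 5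
  -- opening the sixth power
  set θ : GaussianInt → ℂ := fun w => (starRingEnd ℂ) (A w ^ 6) / (‖A w ^ 6‖ : ℂ) with hθ
  have hθ1 : ∀ w, ‖θ w‖ ≤ 1 := by
    intro w
    rw [hθ]; simp only
    rw [norm_div, RCLike.norm_conj, Complex.norm_real, norm_norm]
    exact div_self_le_one _
  have hθA : ∀ w, θ w * A w ^ 6 = ((‖A w‖ ^ 6 : ℝ) : ℂ) := by
    intro w
    rw [hθ]; simp only
    rw [div_mul_eq_mul_div, Complex.conj_mul', ← norm_pow]
    by_cases h0 : ‖A w ^ 6‖ = 0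
    · rw [h0]; simp
    · rw [sq, mul_div_assoc, div_self (by exact_mod_cast h0), mul_one]
  set X : GaussianInt → ℂ := fun z => ∑ w ∈ T, θ w * (dirichletSym z w : ℂ) with hX
  set P := Fintype.piFinset fun _ : Fin 6 => S with hP
  have hPmem : ∀ t ∈ P, ∀ i, t i ∈ S := fun t ht i => Fintype.mem_piFinset.1 ht i
  have hpow : ∀ w ∈ T, A w ^ 6 = ∑ t ∈ P, (∏ i, α (t i)) * (dirichletSym (∏ i, t i) w : ℂ) := by
    intro w hw
    rw [hA]; simp only
    have : (∑ z ∈ S, α z * (dirichletSym z w : ℂ)) ^ 6 =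
        ∏ _i : Fin 6, ∑ z ∈ S, α z * (dirichletSym z w : ℂ) := by
      rw [prod_const, card_univ, Fintype.card_fin]
    rw [this, Finset.prod_univ_sum]
    refine Finset.sum_congr rfl fun t _ => ?_
    rw [prod_mul_distrib, dirichletSym_prod (hT w hw).1 (hT w hw).2.1]
    push_cast; rfl
  have hsixth : ∑ w ∈ T, ‖A w‖ ^ 6 ≤ ∑ t ∈ P, ‖X (∏ i, t i)‖ := by
    have h1 : ((∑ w ∈ T, ‖A w‖ ^ 6 : ℝ) : ℂ) = ∑ t ∈ P, (∏ i, α (t i)) * X (∏ i, t i) := by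
      push_cast
      rw [hX]; simp only [Finset.mul_sum]
      rw [Finset.sum_comm]
      refine Finset.sum_congr rfl fun w hw => ?_
      have := hθA w
      push_cast at this
      rw [← this, hpow w hw, Finset.mul_sum]
      exact Finset.sum_congr rfl fun t _ => by ring
    have h0 : 0 ≤ ∑ w ∈ T, ‖A w‖ ^ 6 := Finset.sum_nonneg fun _ _ => by positivity
    rw [← Real.norm_of_nonneg h0, ← Complex.norm_real, h1]
    refine (norm_sum_le _ _).trans (Finset.sum_le_sum fun t _ => ?_)
    rw [norm_mul, norm_prod]
    refine mul_le_of_le_one_left (norm_nonneg _) (Finset.prod_le_one (fun _ _ => norm_nonneg _)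
      fun i _ => hα _)
  -- Cauchy's inequality over the six-tuples
  have hcauchy : (∑ t ∈ P, ‖X (∏ i, t i)‖) ^ 2 ≤ (#P : ℝ) * ∑ t ∈ P, ‖X (∏ i, t i)‖ ^ 2 :=
    sq_sum_le_card_mul_sum_sq
  have hPcard : (#P : ℝ) = (#S : ℝ) ^ 6 := by
    rw [hP, Fintype.card_piFinset, prod_const, card_univ, Fintype.card_fin]; push_cast; rfl
  set D : ℝ := (C₁ * ((M : ℝ) ^ 6) ^ (η / 6)) ^ 6 with hD
  have hmap : ∀ t ∈ P, (∏ i, t i) ∈ gaussBox (M ^ 3) ∧ (∏ i, t i) ≠ 0 ∧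
      gnorm (∏ i, t i) ≤ M ^ 6 := by
    intro t ht
    have h6 : gnorm (∏ i, t i) ≤ M ^ 6 := by
      rw [gnorm_prod]
      refine (Finset.prod_le_prod' (g := fun _ => M) fun i _ => (hS _ (hPmem t ht i)).2).trans ?_
      rw [prod_const, card_univ, Fintype.card_fin]
    refine ⟨mem_gaussBox_of (h6.trans (by rw [← pow_mul])), ?_, h6⟩
    exact prod_ne_zero_iff.2 fun i _ => (hS _ (hPmem t ht i)).1
  -- In a six-tuple with given product every entry divides that product, so a fibre has at most the
  -- sixth power of the number of divisors.
  have hfiber : ∑ t ∈ P, ‖X (∏ i, t i)‖ ^ 2 ≤ D * ∑ z ∈ gaussBox (M ^ 3), ‖X z‖ ^ 2 := by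
    rw [← Finset.sum_fiberwise_of_maps_to (s := P) (t := gaussBox (M ^ 3))
      (g := fun t => ∏ i, t i) (fun t ht => (hmap t ht).1), Finset.mul_sum]
    refine Finset.sum_le_sum fun z _ => ?_
    rw [Finset.sum_congr rfl (g := fun _ => ‖X z‖ ^ 2) (fun t ht => by
      rw [(mem_filter.1 ht).2]), sum_const, nsmul_eq_mul]
    refine mul_le_mul_of_nonneg_right ?_ (by positivity)
    rcases Finset.eq_empty_or_nonempty ({t ∈ P | ∏ i, t i = z}) with he | ⟨t₀, ht₀⟩
    · rw [he, hD]; simp only [card_empty, Nat.cast_zero]; positivity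
    · obtain ⟨ht₀', rfl⟩ := mem_filter.1 ht₀
      obtain ⟨-, hz0, hz6⟩ := hmap t₀ ht₀'
      have hle : #{t ∈ P | ∏ i, t i = ∏ i, t₀ i} ≤ #(gaussDivisors (∏ i, t₀ i)) ^ 6 := by
        have : #(Fintype.piFinset fun _ : Fin 6 => gaussDivisors (∏ i, t₀ i)) =
            #(gaussDivisors (∏ i, t₀ i)) ^ 6 := by
          rw [Fintype.card_piFinset, prod_const, card_univ, Fintype.card_fin]
        rw [← this]
        refine card_le_card fun t ht => Fintype.mem_piFinset.2 fun i => ?_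
        rw [mem_gaussDivisors hz0, ← (mem_filter.1 ht).2]
        exact dvd_prod_of_mem _ (mem_univ i)
      calc (#{t ∈ P | ∏ i, t i = ∏ i, t₀ i} : ℝ) ≤ (#(gaussDivisors (∏ i, t₀ i)) : ℝ) ^ 6 := by
            exact_mod_cast hle
        _ ≤ (C₁ * (gnorm (∏ i, t₀ i) : ℝ) ^ (η / 6)) ^ 6 := by gcongr; exact h₁ _ hz0
        _ ≤ D := by
            rw [hD]; gcongr
            exact_mod_cast hz6
  have hmoment := h₂ M N hN hNM T (fun w hw => ⟨(hT w hw).1, (hT w hw).2.2⟩) θ hθ1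
  have hDval : D = C₁ ^ 6 * (M : ℝ) ^ (6 * η) := by
    rw [hD, mul_pow]
    congr 1
    rw [← Real.rpow_natCast, ← Real.rpow_natCast, ← Real.rpow_mul (by positivity),
      ← Real.rpow_mul (by positivity)]
    congr 1; push_cast; ring
  have hD0 : 0 ≤ D := by rw [hD]; positivity
  have hb0 := norm_nonneg (∑ z ∈ S, ∑ w ∈ T, α z * β w * (dirichletSym z w : ℂ))
  have hx0 : 0 ≤ ∑ t ∈ P, ‖X (∏ i, t i)‖ := Finset.sum_nonneg fun _ _ => norm_nonneg _
  rw [hPcard] at hcauchy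
  clear_value D
  generalize ‖∑ z ∈ S, ∑ w ∈ T, α z * β w * (dirichletSym z w : ℂ)‖ = b at hB hb0 ⊢
  generalize ∑ w ∈ T, ‖A w‖ = a₁ at hB hHolder
  generalize ∑ w ∈ T, ‖A w‖ ^ 6 = a₆ at hHolder hsixth
  generalize ∑ t ∈ P, ‖X (∏ i, t i)‖ ^ 2 = x₂ at hcauchy hfiber
  generalize ∑ t ∈ P, ‖X (∏ i, t i)‖ = x₁ at hsixth hcauchy hx0
  generalize ∑ z ∈ gaussBox (M ^ 3), ‖X z‖ ^ 2 = y₂ at hfiber hmoment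
  have h12 : b ^ 12 ≤ (9 * N : ℝ) ^ 10 * ((9 * M : ℝ) ^ 6 *
      (D * (C₂ * ((M : ℝ) ^ 6 * (N : ℝ) ^ (1 + 6 * η))))) := by
    have e1 : b ^ 6 ≤ (9 * N : ℝ) ^ 5 * x₁ := by
      calc b ^ 6 ≤ a₁ ^ 6 := by gcongr
        _ ≤ _ := hHolder
        _ ≤ (#T : ℝ) ^ 5 * x₁ := by gcongr
        _ ≤ _ := by gcongr
    have e2 : x₁ ^ 2 ≤ (9 * M : ℝ) ^ 6 *
        (D * (C₂ * ((M : ℝ) ^ 6 * (N : ℝ) ^ (1 + 6 * η)))) := by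
      calc x₁ ^ 2 ≤ (#S : ℝ) ^ 6 * x₂ := hcauchy
        _ ≤ (#S : ℝ) ^ 6 * (D * (C₂ * ((M : ℝ) ^ 6 * (N : ℝ) ^ (1 + 6 * η)))) := by
            gcongr
            exact hfiber.trans (by gcongr)
        _ ≤ _ := by gcongr
    calc b ^ 12 = (b ^ 6) ^ 2 := by ring
      _ ≤ ((9 * N : ℝ) ^ 5 * x₁) ^ 2 := by gcongr
      _ = (9 * N : ℝ) ^ 10 * x₁ ^ 2 := by ring
      _ ≤ _ := by gcongr
  have hfin : (9 * N : ℝ) ^ 10 * ((9 * M : ℝ) ^ 6 *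
      (D * (C₂ * ((M : ℝ) ^ 6 * (N : ℝ) ^ (1 + 6 * η))))) ≤
      (K * ((M : ℝ) ^ (1 + η) * (N : ℝ) ^ (11 / 12 : ℝ))) ^ 12 := by
    have f1 : ((M : ℝ) ^ (1 + η)) ^ 12 = (M : ℝ) ^ 12 * ((M : ℝ) ^ (6 * η) * (M : ℝ) ^ (6 * η)) := by
      rw [← Real.rpow_natCast, ← Real.rpow_mul (by positivity), ← Real.rpow_add (by positivity),
        ← Real.rpow_natCast, ← Real.rpow_add (by positivity)]
      congr 1; push_cast; ring
    have f2 : ((N : ℝ) ^ (11 / 12 : ℝ)) ^ 12 = (N : ℝ) ^ 11 := by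
      rw [← Real.rpow_natCast, ← Real.rpow_mul (by positivity), ← Real.rpow_natCast]
      congr 1; norm_num
    have f3 : (N : ℝ) ^ (1 + 6 * η) ≤ N * (M : ℝ) ^ (6 * η) := by
      rw [Real.rpow_add (by positivity), Real.rpow_one]
      gcongr
    have f4 : K ≤ K ^ 12 := le_self_pow₀ hK1 (by norm_num)
    rw [mul_pow K, mul_pow ((M : ℝ) ^ (1 + η)), f1, f2, hDval]
    calc _ = K * ((N : ℝ) ^ 10 * ((M : ℝ) ^ 12 * ((M : ℝ) ^ (6 * η) * (N : ℝ) ^ (1 + 6 * η)))) := by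
          rw [hK]; ring
      _ ≤ K ^ 12 * ((N : ℝ) ^ 10 * ((M : ℝ) ^ 12 * ((M : ℝ) ^ (6 * η) *
          (N * (M : ℝ) ^ (6 * η))))) := by gcongr
      _ = _ := by ring
  exact le_of_pow_le_pow_left₀ (by norm_num) (by positivity) (h12.trans hfin)

/-! ### Bilinear forms in the Jacobi–Kubota symbol -/

/-- The symmetry of the symbol lets the longer variable play the role of z, so a saving y^(-1/12)
holds in either order once both lengths are at least y. -/
theorem exists_bilinear_primitive_le {η : ℝ} (hη : 0 < η) :
    ∃ C : ℝ, 1 ≤ C ∧ ∀ (M N : ℕ) (y : ℝ), 1 ≤ y → y ≤ M → y ≤ N → ∀ S T : Finset GaussianInt,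
      (∀ z ∈ S, IsPrimary z ∧ IsPrimitive z ∧ gnorm z ≤ M) →
      (∀ w ∈ T, IsPrimary w ∧ IsPrimitive w ∧ gnorm w ≤ N) →
      ∀ α β : GaussianInt → ℂ, (∀ z, ‖α z‖ ≤ 1) → (∀ w, ‖β w‖ ≤ 1) →
      ‖∑ z ∈ S, ∑ w ∈ T, α z * β w * (dirichletSym w z : ℂ)‖ ≤
        C * (((M * N : ℕ) : ℝ) ^ (1 + η) * y ^ (-(1 / 12) : ℝ)) := by
  obtain ⟨C, hC, h⟩ := exists_bilinear_dirichletSym_le hη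
  refine ⟨C, hC, fun M N y hy hyM hyN S T hS hT α β hα hβ => ?_⟩
  have key : ∀ M N : ℕ, y ≤ M → y ≤ N → (M : ℝ) ^ (1 + η) * (N : ℝ) ^ (11 / 12 : ℝ) ≤
      ((M * N : ℕ) : ℝ) ^ (1 + η) * y ^ (-(1 / 12) : ℝ) := by
    intro M N _ hyN
    have hN0 : (1 : ℝ) ≤ N := hy.trans hyN
    push_cast
    rw [Real.mul_rpow (by positivity) (by positivity), mul_assoc]
    gcongr
    calc (N : ℝ) ^ (11 / 12 : ℝ) = (N : ℝ) ^ (1 : ℝ) * (N : ℝ) ^ (-(1 / 12) : ℝ) := by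
          rw [← Real.rpow_add (by positivity)]; norm_num
      _ ≤ (N : ℝ) ^ (1 + η) * y ^ (-(1 / 12) : ℝ) := by
          refine mul_le_mul (Real.rpow_le_rpow_of_exponent_le hN0 (by linarith)) ?_
            (by positivity) (by positivity)
          exact Real.rpow_le_rpow_of_nonpos (by linarith) hyN (by norm_num)
  have hM1 : 1 ≤ M := by exact_mod_cast hy.trans hyM
  have hN1 : 1 ≤ N := by exact_mod_cast hy.trans hyN
  rcases le_total M N with hMN | hNM
  · have := h N M hM1 hMN T S (fun z hz => ⟨(hT z hz).1.ne_zero, (hT z hz).2.2⟩) hS β α hβ hα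
    rw [Finset.sum_comm] at this
    calc _ = _ := by
          congr 1
          exact Finset.sum_congr rfl fun z _ => Finset.sum_congr rfl fun w _ => by
            rw [mul_comm (α z)]
      _ ≤ _ := this
      _ ≤ C * (((N * M : ℕ) : ℝ) ^ (1 + η) * y ^ (-(1 / 12) : ℝ)) := by
          exact mul_le_mul_of_nonneg_left (key N M hyN hyM) (by linarith)
      _ = _ := by rw [mul_comm N M]
  · have := h M N hN1 hNM S T (fun z hz => ⟨(hS z hz).1.ne_zero, (hS z hz).2.2⟩) hT α β hα hβ
    calc _ = _ := by
          congr 1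
          exact Finset.sum_congr rfl fun z hz => Finset.sum_congr rfl fun w hw => by
            rw [dirichletSym_symm (hS z hz).1 (hS z hz).2.1 (hT w hw).1 (hT w hw).2.1]
      _ ≤ _ := this
      _ ≤ _ := mul_le_mul_of_nonneg_left (key M N hyM hyN) (by linarith)

theorem kubotaSign_congr {u v r R r' R' : ℤ} (hr : r.sign = r'.sign) (hR : R < 0 ↔ R' < 0) :
    kubotaSign u v r R = kubotaSign u v r' R' := by
  have hr' : r < 0 ↔ r' < 0 := by rw [← Int.sign_eq_neg_one_iff_neg, hr, Int.sign_eq_neg_one_iff_neg]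
  unfold kubotaSign
  rw [hr, realHilbert_congr hr' hR, realHilbert_congr Iff.rfl hR, realHilbert_congr Iff.rfl hr']

theorem norm_kubotaSign_le (u v r R : ℤ) : ‖(kubotaSign u v r R : ℂ)‖ ≤ 1 := by
  have h1 : ∀ a b, ‖(realHilbert a b : ℂ)‖ ≤ 1 := by
    intro a b; unfold realHilbert; split_ifs <;> simp
  have h2 : ‖(r.sign : ℂ)‖ ≤ 1 := by
    rcases Int.sign_trichotomy r with h | h | h <;> rw [h] <;> simp
  unfold kubotaSign
  push_cast
  simp only [norm_mul]
  refine mul_le_one₀ (mul_le_one₀ (mul_le_one₀ (mul_le_one₀ h2 (norm_nonneg _) (h1 _ _))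
    (norm_nonneg _) (h1 _ _)) (norm_nonneg _) (h1 _ _)) (norm_nonneg _) (h1 _ _)

/-- Since R = vr(u/v - s/r), its sign is that of vr or its opposite according to one comparison
between a quantity attached to w and one attached to z. This is the only entanglement of the two
variables, besides the sign of r. -/
theorem kubotaSign_eq_ite {u v r s : ℤ} (hv : v ≠ 0) (hr : r ≠ 0) (hR : u * r - v * s ≠ 0) :
    kubotaSign u v r (u * r - v * s) =
      if (u : ℝ) / v < (s : ℝ) / r then kubotaSign u v r.sign (-(r.sign * v))
      else kubotaSign u v r.sign (r.sign * v) := by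
  have hv' : (v : ℝ) ≠ 0 := by exact_mod_cast hv
  have hr' : (r : ℝ) ≠ 0 := by exact_mod_cast hr
  have hR' : ((u * r - v * s : ℤ) : ℝ) = (v * r : ℝ) * (u / v - s / r) := by
    push_cast; field_simp
  have hsign : r.sign = r.sign.sign := Int.sign_sign.symm
  have hneg : (u * r - v * s < 0) ↔ (v * r : ℝ) * (u / v - s / r) < 0 := by
    rw [← hR']; exact_mod_cast Iff.rfl
  have hne : (u : ℝ) / v - s / r ≠ 0 := by
    intro h; rw [h, mul_zero] at hR'
    exact hR (by exact_mod_cast hR')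
  have hvr : (v * r : ℝ) < 0 ↔ r.sign * v < 0 := by
    rcases lt_or_gt_of_ne hr with h | h
    · rw [Int.sign_eq_neg_one_of_neg h]
      have : (r : ℝ) < 0 := by exact_mod_cast h
      constructor
      · intro h1
        have h2 : (0 : ℝ) < v := by nlinarith
        have : 0 < v := by exact_mod_cast h2
        omega
      · intro h1
        have h2 : 0 < v := by omega
        have : (0 : ℝ) < v := by exact_mod_cast h2
        nlinarith
    · rw [Int.sign_eq_one_of_pos h]
      have : (0 : ℝ) < r := by exact_mod_cast h
      constructor
      · intro h1
        have h2 : (v : ℝ) < 0 := by nlinarith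
        have : v < 0 := by exact_mod_cast h2
        omega
      · intro h1
        have h2 : v < 0 := by omega
        have : (v : ℝ) < 0 := by exact_mod_cast h2
        nlinarith
  have hvr0 : r.sign * v ≠ 0 := mul_ne_zero (by simpa using hr) hv
  split_ifs with h
  · refine kubotaSign_congr hsign ?_
    rw [hneg, Left.neg_neg_iff]
    have h0 : (u : ℝ) / v - s / r < 0 := by linarith
    constructor
    · intro h1
      have h2 : (0 : ℝ) < v * r := by nlinarith
      have := hvr.not.1 h2.not_gt
      omega
    · intro h1
      have h2 := hvr.not.2 h1.not_gt
      have h3 : (0 : ℝ) < v * r := lt_of_le_of_ne (not_lt.1 h2) (mul_ne_zero hv' hr').symm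
      nlinarith
  · refine kubotaSign_congr hsign ?_
    rw [hneg, ← hvr]
    have h0 : 0 < (u : ℝ) / v - s / r := lt_of_le_of_ne (by linarith) hne.symm
    constructor <;> intro h1 <;> nlinarith

/-- Bilinear forms in the Jacobi–Kubota symbol reduce to those in the quadratic residue symbol. -/
theorem norm_bilinear_jacobiKubota_le {w : GaussianInt} (hw : IsPrimary w)
    (S T : Finset GaussianInt)
    (hS : ∀ z ∈ S, IsPrimary z ∧ IsPrimitive (w * z) ∧ 1 < gnorm z)
    (hT : ∀ z ∈ T, IsPrimary z ∧ IsPrimitive z) {K : ℝ}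
    (hK : ∀ α β : GaussianInt → ℂ, (∀ z, ‖α z‖ ≤ 1) → (∀ z, ‖β z‖ ≤ 1) →
      ‖∑ z ∈ S, ∑ t ∈ T, α z * β t * (dirichletSym t z : ℂ)‖ ≤ K)
    (α β : GaussianInt → ℂ) (hα : ∀ z, ‖α z‖ ≤ 1) (hβ : ∀ z, ‖β z‖ ≤ 1) :
    ‖∑ z ∈ S, ∑ t ∈ T, α z * β t * jacobiKubota (w * z * t)‖ ≤
      K * (2 + 4 * (2 + Real.log (2 * #S + 1))) := by
  set f : GaussianInt → ℝ := fun z => ((w * z).re : ℝ) / (w * z).im with hf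
  set g : GaussianInt → ℝ := fun t => (t.im : ℝ) / t.re with hg
  set a₀ : ℤ → GaussianInt → ℂ := fun ρ z => α z * jacobiKubota (w * z) *
    (kubotaSign (w * z).re (w * z).im ρ (ρ * (w * z).im) : ℂ) with ha₀
  -- Half the jump of the sign across the comparison: the division by 2 keeps the coefficient
  -- bounded by 1 and is repaid by the factor 2 in `hterm`.
  set a₁ : ℤ → GaussianInt → ℂ := fun ρ z => α z * jacobiKubota (w * z) *
    (((kubotaSign (w * z).re (w * z).im ρ (-(ρ * (w * z).im)) : ℂ) -
      (kubotaSign (w * z).re (w * z).im ρ (ρ * (w * z).im) : ℂ)) / 2) with ha₁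
  set b : ℤ → GaussianInt → ℂ := fun ρ t => β t * jacobiKubota t * (dirichletSym t w : ℂ) *
    (if t.re.sign = ρ then 1 else 0) with hb
  have hαk : ∀ z, ‖α z * jacobiKubota (w * z)‖ ≤ 1 := by
    intro z; rw [norm_mul]
    exact mul_le_one₀ (hα z) (norm_nonneg _) (norm_jacobiKubota_le _)
  have ha₀1 : ∀ ρ z, ‖a₀ ρ z‖ ≤ 1 := by
    intro ρ z
    rw [ha₀]; simp only
    rw [norm_mul]
    exact mul_le_one₀ (hαk z) (norm_nonneg _) (norm_kubotaSign_le _ _ _ _)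
  have ha₁1 : ∀ ρ z, ‖a₁ ρ z‖ ≤ 1 := by
    intro ρ z
    rw [ha₁]; simp only
    rw [norm_mul]
    refine mul_le_one₀ (hαk z) (norm_nonneg _) ?_
    rw [norm_div, Complex.norm_ofNat, div_le_one (by norm_num)]
    refine (norm_sub_le _ _).trans ?_
    have h1 := norm_kubotaSign_le (w * z).re (w * z).im ρ (-(ρ * (w * z).im))
    have h2 := norm_kubotaSign_le (w * z).re (w * z).im ρ (ρ * (w * z).im)
    linarith
  have hb1 : ∀ ρ t, ‖b ρ t‖ ≤ 1 := by
    intro ρ t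
    rw [hb]; simp only
    rw [norm_mul, norm_mul, norm_mul]
    refine mul_le_one₀ (mul_le_one₀ (mul_le_one₀ (hβ t) (norm_nonneg _) (norm_jacobiKubota_le _))
      (norm_nonneg _) (norm_dirichletSym_le _ _)) (norm_nonneg _) ?_
    split_ifs <;> simp
  have hterm : ∀ z ∈ S, ∀ t ∈ T, α z * β t * jacobiKubota (w * z * t) =
      ∑ ρ ∈ ({1, -1} : Finset ℤ), (a₀ ρ z * b ρ t * (dirichletSym t z : ℂ) +
        2 * (a₁ ρ z * b ρ t * ((if f z < g t then 1 else 0) * (dirichletSym t z : ℂ)))) := by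
    intro z hz t ht
    obtain ⟨hzp, hzq, hz1⟩ := hS z hz
    obtain ⟨htp, htq⟩ := hT t ht
    have hwz := hw.mul hzp
    -- A primitive primary number with zero imaginary part is 1, which N(z) > 1 excludes.
    have him : (w * z).im ≠ 0 := by
      intro h
      have := hwz.eq_one_of_im_eq_zero hzq h
      have h2 : gnorm (w * z) = 1 := by rw [this, gnorm_one]
      rw [gnorm_mul] at h2
      have := Nat.eq_one_of_mul_eq_one_left h2
      omega
    have hR := (hwz.mul htp).re_ne_zero
    have hRe : (w * z * t).re = (w * z).re * t.re - (w * z).im * t.im := by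
      rw [Zsqrtd.re_mul]; ring
    rw [hRe] at hR
    have hks := kubotaSign_eq_ite (u := (w * z).re) (v := (w * z).im) (r := t.re) (s := t.im)
      him htp.re_ne_zero hR
    rw [jacobiKubota_mul hwz htp hzq him, dirichletSym_mul_right hw hzp hzq htp htq, hRe, hks]
    have hρ : t.re.sign = 1 ∨ t.re.sign = -1 := by
      rcases lt_or_gt_of_ne htp.re_ne_zero with h | h
      · right; exact Int.sign_eq_neg_one_of_neg h
      · left; exact Int.sign_eq_one_of_pos h
    rw [Finset.sum_pair (by norm_num)]
    rw [ha₀, ha₁, hb, hf, hg]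
    simp only
    have h1 : ¬(1 : ℤ) = -1 := by norm_num
    have h2 : ¬(-1 : ℤ) = 1 := by norm_num
    rcases hρ with h | h <;> simp only [h, h1, h2, if_true, if_false] <;> split_ifs <;>
      push_cast <;> ring
  have hsum : ∑ z ∈ S, ∑ t ∈ T, α z * β t * jacobiKubota (w * z * t) =
      ∑ ρ ∈ ({1, -1} : Finset ℤ), (∑ z ∈ S, ∑ t ∈ T, a₀ ρ z * b ρ t * (dirichletSym t z : ℂ) +
        2 * ∑ z ∈ S, ∑ t ∈ T, a₁ ρ z * b ρ t *
          ((if f z < g t then 1 else 0) * (dirichletSym t z : ℂ))) := by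
    rw [Finset.sum_congr rfl fun z hz => Finset.sum_congr rfl fun t ht => hterm z hz t ht]
    simp only [Finset.sum_pair (show (1 : ℤ) ≠ -1 by norm_num), Finset.sum_add_distrib,
      Finset.mul_sum]
  rw [hsum]
  have hone : ∀ ρ, ‖∑ z ∈ S, ∑ t ∈ T, a₀ ρ z * b ρ t * (dirichletSym t z : ℂ) +
        2 * ∑ z ∈ S, ∑ t ∈ T, a₁ ρ z * b ρ t *
          ((if f z < g t then 1 else 0) * (dirichletSym t z : ℂ))‖ ≤
      K + 2 * (K * (2 + Real.log (2 * #S + 1))) := by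
    intro ρ
    refine (norm_add_le _ _).trans (add_le_add (hK _ _ (ha₀1 ρ) (hb1 ρ)) ?_)
    rw [norm_mul, Complex.norm_ofNat]
    gcongr
    exact norm_bilinear_ite_lt_le S T f g (fun z t => (dirichletSym t z : ℂ)) hK _ _
      (ha₁1 ρ) (hb1 ρ)
  rw [Finset.sum_pair (by norm_num)]
  refine (norm_add_le _ _).trans ((add_le_add (hone 1) (hone (-1))).trans (le_of_eq ?_))
  ring

/-! ### Type II sums -/

open Classical in
/-- The primary Gaussian integers of norm at most `X`. -/
def primaryBall (X : ℕ) : Finset GaussianInt := (gaussBall X).filter IsPrimary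

theorem mem_primaryBall {X : ℕ} {z : GaussianInt} :
    z ∈ primaryBall X ↔ IsPrimary z ∧ gnorm z ≤ X := by
  classical
  rw [primaryBall, Finset.mem_filter, mem_gaussBall, and_comm]

theorem card_primaryBall_le {X : ℕ} (hX : 1 ≤ X) : #(primaryBall X) ≤ 9 * X := by
  classical
  exact (Finset.card_filter_le _ _).trans (card_gaussBall_le hX)

theorem two_add_log_le_rpow {η : ℝ} (hη : 0 < η) {X : ℝ} (hX : 1 ≤ X) :
    2 + Real.log (18 * X + 1) ≤ (21 + 1 / η) * X ^ η := by
  have h1 : Real.log (18 * X + 1) ≤ Real.log (19 * X) :=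
    Real.log_le_log (by linarith) (by linarith)
  rw [Real.log_mul (by norm_num) (by linarith)] at h1
  have h2 : Real.log 19 ≤ 19 := (Real.log_le_sub_one_of_pos (by norm_num)).trans (by norm_num)
  have h3 := Real.log_le_rpow_div (x := X) (by linarith) hη
  have h4 : (1 : ℝ) ≤ X ^ η := Real.one_le_rpow hX hη.le
  calc _ ≤ 21 + X ^ η / η := by linarith
    _ ≤ 21 * X ^ η + X ^ η / η := by linarith
    _ = _ := by ring

theorem natLog_two_add_one_le {X : ℕ} (hX : 1 ≤ X) :
    ((Nat.log 2 X + 1 : ℕ) : ℝ) ≤ 2 * (2 + Real.log (18 * X + 1)) := by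
  have hX' : (1 : ℝ) ≤ X := by exact_mod_cast hX
  have h1 : ((2 ^ Nat.log 2 X : ℕ) : ℝ) ≤ X := by
    exact_mod_cast Nat.pow_log_le_self 2 (by omega)
  have h2 := Real.log_le_log (by positivity) h1
  push_cast at h2
  rw [Real.log_pow] at h2
  have h3 := Real.log_two_gt_d9
  have h4 : Real.log X ≤ Real.log (18 * X + 1) := Real.log_le_log (by linarith) (by linarith)
  push_cast
  have h5 : (0 : ℝ) ≤ Nat.log 2 X := by positivity
  nlinarith

set_option maxHeartbeats 1000000 in
-- Splitting N(z) dyadically makes the two lengths multiply to at most 2X instead of X². Three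
-- logarithms are lost, to the dyadic pieces, to the sign in the twist and to the hyperbola
-- condition; with ε = η/4 they turn X^(1+ε) into X^(1+η).
theorem exists_bilinear_hyperbola_le {η : ℝ} (hη : 0 < η) :
    ∃ C : ℝ, 1 ≤ C ∧ ∀ (X : ℕ) (y : ℝ), 1 ≤ X → 1 ≤ y → ∀ w, IsPrimary w →
      ∀ a b : GaussianInt → ℂ, (∀ z, ‖a z‖ ≤ 1) → (∀ z, ‖b z‖ ≤ 1) →
      (∀ z, (gnorm z : ℝ) ≤ y → a z = 0) → (∀ z, (gnorm z : ℝ) ≤ y → b z = 0) →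
      ‖∑ z ∈ primaryBall X, ∑ t ∈ primaryBall X, a z * b t *
          (if gnorm z * gnorm t ≤ X then jacobiKubota (w * z * t) else 0)‖ ≤
        C * ((X : ℝ) ^ (1 + η) * y ^ (-(1 / 12) : ℝ)) := by
  classical
  set ε := η / 4 with hε
  have hε0 : 0 < ε := by positivity
  obtain ⟨C₁, hC₁, hbil⟩ := exists_bilinear_primitive_le hε0
  set D := 21 + 1 / ε with hD
  have hD1 : 1 ≤ D := by have : 0 < 1 / ε := by positivity
                         linarith
  refine ⟨C₁ * 2 ^ (1 + ε) * (10 * D ^ 3), ?_, ?_⟩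
  · have h2 : (1 : ℝ) ≤ 2 ^ (1 + ε) := Real.one_le_rpow (by norm_num) (by linarith)
    have h3 : 1 ≤ D ^ 3 := one_le_pow₀ hD1
    exact one_le_mul_of_one_le_of_one_le (one_le_mul_of_one_le_of_one_le hC₁ h2) (by linarith)
  intro X y hX hy w hw a b ha hb ha0 hb0
  have hX' : (1 : ℝ) ≤ X := by exact_mod_cast hX
  set L := 2 + Real.log (18 * X + 1) with hL
  have hLlog : 0 ≤ Real.log (18 * (X : ℝ) + 1) := Real.log_nonneg (by linarith)
  set S : ℕ → Finset GaussianInt := fun i => (primaryBall X).filter fun z =>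
    Nat.log 2 (gnorm z) = i ∧ y < gnorm z ∧ IsPrimitive (w * z) with hS
  set T : ℕ → Finset GaussianInt := fun i => (primaryBall X).filter fun t =>
    IsPrimitive t ∧ y < gnorm t ∧ gnorm t ≤ X / 2 ^ i with hT
  set F : GaussianInt → GaussianInt → ℂ := fun z t => a z * b t *
          (if gnorm z * gnorm t ≤ X then jacobiKubota (w * z * t) else 0) with hF
  have hsplit : ∑ z ∈ primaryBall X, ∑ t ∈ primaryBall X, F z t =
      ∑ i ∈ range (Nat.log 2 X + 1), ∑ z ∈ S i, ∑ t ∈ T i, F z t := by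
    have h1 : ∀ z ∈ primaryBall X, Nat.log 2 (gnorm z) ∈ range (Nat.log 2 X + 1) := by
      intro z hz
      rw [mem_primaryBall] at hz
      exact Finset.mem_range.2 (Nat.lt_succ_of_le (Nat.log_mono_right hz.2))
    rw [← Finset.sum_fiberwise_of_maps_to h1]
    refine Finset.sum_congr rfl fun i _ => ?_
    have h2 : S i ⊆ (primaryBall X).filter fun z => Nat.log 2 (gnorm z) = i := by
      intro z hz
      rw [hS, Finset.mem_filter] at hz
      exact Finset.mem_filter.2 ⟨hz.1, hz.2.1⟩
    rw [← Finset.sum_subset h2]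
    · refine Finset.sum_congr rfl fun z hz => ?_
      rw [hS, Finset.mem_filter, mem_primaryBall] at hz
      obtain ⟨⟨hzp, hzX⟩, hzi, hyz, hzq⟩ := hz
      symm
      refine Finset.sum_subset (Finset.filter_subset _ _) fun t ht htn => ?_
      have htp := (mem_primaryBall.1 ht).1
      have hgt := gnorm_pos htp.ne_zero
      rw [hF]; simp only
      by_cases h3 : gnorm z * gnorm t ≤ X
      · rw [if_pos h3]
        by_cases h4 : IsPrimitive t
        · have h5 : gnorm t ≤ X / 2 ^ i := by
            rw [Nat.le_div_iff_mul_le (by positivity)]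
            have : 2 ^ i ≤ gnorm z := hzi ▸ Nat.pow_log_le_self 2 (gnorm_pos hzp.ne_zero).ne'
            nlinarith
          have h6 : (gnorm t : ℝ) ≤ y := by
            by_contra h6
            exact htn (Finset.mem_filter.2 ⟨ht, h4, not_le.1 h6, h5⟩)
          rw [hb0 t h6]; ring
        · rw [jacobiKubota_eq_zero ((hw.mul hzp).mul htp).re_ne_zero, mul_zero]
          exact fun h => h4 (h.of_dvd (dvd_mul_left _ _))
      · rw [if_neg h3, mul_zero]
    · intro z hz hzn
      rw [Finset.mem_filter] at hz
      have hzp := (mem_primaryBall.1 hz.1).1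
      refine Finset.sum_eq_zero fun t ht => ?_
      have htp := (mem_primaryBall.1 ht).1
      rw [hF]; simp only
      by_cases h4 : IsPrimitive (w * z)
      · have h6 : (gnorm z : ℝ) ≤ y := by
          by_contra h6
          exact hzn (Finset.mem_filter.2 ⟨hz.1, hz.2, not_le.1 h6, h4⟩)
        rw [ha0 z h6]; ring
      · rw [jacobiKubota_eq_zero ((hw.mul hzp).mul htp).re_ne_zero, ite_self, mul_zero]
        exact fun h => h4 (h.of_dvd (dvd_mul_right _ _))
  rw [hsplit]
  set K := C₁ * ((2 * X : ℝ) ^ (1 + ε) * y ^ (-(1 / 12) : ℝ)) with hK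
  have hK0 : 0 ≤ K := by positivity
  have hpiece : ∀ i, ‖∑ z ∈ S i, ∑ t ∈ T i, F z t‖ ≤ K * (5 * L) * L := by
    intro i
    have hSm : ∀ z ∈ S i, (IsPrimary z ∧ gnorm z ≤ X) ∧ Nat.log 2 (gnorm z) = i ∧ y < gnorm z ∧
        IsPrimitive (w * z) := by
      intro z hz
      rw [hS, Finset.mem_filter, mem_primaryBall] at hz
      exact hz
    have hTm : ∀ t ∈ T i, (IsPrimary t ∧ gnorm t ≤ X) ∧ IsPrimitive t ∧ y < gnorm t ∧
        gnorm t ≤ X / 2 ^ i := by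
      intro z hz
      rw [hT, Finset.mem_filter, mem_primaryBall] at hz
      exact hz
    have hlog : 2 + Real.log (2 * #(S i) + 1) ≤ L := by
      have : #(S i) ≤ 9 * X := (Finset.card_filter_le _ _).trans (card_primaryBall_le hX)
      have : (#(S i) : ℝ) ≤ 9 * X := by exact_mod_cast this
      have := Real.log_le_log (x := 2 * #(S i) + 1) (by positivity)
        (show 2 * (#(S i) : ℝ) + 1 ≤ 18 * X + 1 by linarith)
      linarith
    have hSlt : ∀ z ∈ S i, gnorm z < 2 ^ (i + 1) := by
      intro z hz
      rw [← (hSm z hz).2.1]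
      exact Nat.lt_pow_succ_log_self (by norm_num) _
    have hdir : ∀ α β : GaussianInt → ℂ, (∀ z, ‖α z‖ ≤ 1) → (∀ z, ‖β z‖ ≤ 1) →
        ‖∑ z ∈ S i, ∑ t ∈ T i, α z * β t * (dirichletSym t z : ℂ)‖ ≤ K := by
      intro α β hα hβ
      rcases (S i).eq_empty_or_nonempty with h | ⟨z₀, hz₀⟩
      · rw [h, Finset.sum_empty, norm_zero]; exact hK0
      rcases (T i).eq_empty_or_nonempty with h | ⟨t₀, ht₀⟩
      · simp only [h, Finset.sum_empty, Finset.sum_const_zero, norm_zero]; exact hK0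
      refine (hbil (2 ^ (i + 1)) (X / 2 ^ i) y hy ?_ ?_ (S i) (T i)
        (fun z hz => ⟨(hSm z hz).1.1, (hSm z hz).2.2.2.of_dvd (dvd_mul_left _ _),
          (hSlt z hz).le⟩)
        (fun t ht => ⟨(hTm t ht).1.1, (hTm t ht).2.1, (hTm t ht).2.2.2⟩) α β hα hβ).trans ?_
      · exact ((hSm z₀ hz₀).2.2.1.trans (by exact_mod_cast hSlt z₀ hz₀)).le
      · exact (hTm t₀ ht₀).2.2.1.le.trans (by exact_mod_cast (hTm t₀ ht₀).2.2.2)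
      · rw [hK]
        have : 2 ^ (i + 1) * (X / 2 ^ i) ≤ 2 * X := by
          have := Nat.mul_div_le X (2 ^ i)
          rw [pow_succ]; nlinarith
        have : ((2 ^ (i + 1) * (X / 2 ^ i) : ℕ) : ℝ) ≤ 2 * X := by exact_mod_cast this
        gcongr
    have hkub : ∀ α β : GaussianInt → ℂ, (∀ z, ‖α z‖ ≤ 1) → (∀ z, ‖β z‖ ≤ 1) →
        ‖∑ z ∈ S i, ∑ t ∈ T i, α z * β t * jacobiKubota (w * z * t)‖ ≤ K * (5 * L) := by
      intro α β hα hβ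
      refine (norm_bilinear_jacobiKubota_le hw (S i) (T i) (fun z hz => ⟨(hSm z hz).1.1,
        (hSm z hz).2.2.2, ?_⟩) (fun t ht => ⟨(hTm t ht).1.1, (hTm t ht).2.1⟩) hdir α β hα hβ).trans
        (mul_le_mul_of_nonneg_left (by linarith) hK0)
      exact_mod_cast hy.trans_lt (hSm z hz).2.2.1
    have := norm_bilinear_ite_lt_le (S i) (T i) (fun z => (gnorm z : ℝ))
      (fun t => ((X / gnorm t + 1 : ℕ) : ℝ)) (fun z t => jacobiKubota (w * z * t)) hkub a b ha hb
    calc _ = _ := by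
          congr 1
          refine Finset.sum_congr rfl fun z hz => Finset.sum_congr rfl fun t ht => ?_
          -- Adding 1 to the integer quotient turns the weak hyperbola inequality into the strict
          -- one handled by `norm_bilinear_ite_lt_le`.
          have hiff : ((gnorm z : ℝ) < ((X / gnorm t + 1 : ℕ) : ℝ)) ↔ gnorm z * gnorm t ≤ X := by
            rw [Nat.cast_lt, Nat.lt_succ_iff,
              Nat.le_div_iff_mul_le (gnorm_pos (hTm t ht).1.1.ne_zero)]
          rw [hF]; simp only [hiff, ite_mul, one_mul, zero_mul]
      _ ≤ _ := this
      _ ≤ _ := by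
          have : 0 ≤ K * (5 * L) := by positivity
          gcongr
  calc _ ≤ ∑ i ∈ range (Nat.log 2 X + 1), K * (5 * L) * L :=
        (norm_sum_le _ _).trans (Finset.sum_le_sum fun i _ => hpiece i)
    _ = ((Nat.log 2 X + 1 : ℕ) : ℝ) * (K * (5 * L) * L) := by
        rw [Finset.sum_const, Finset.card_range, nsmul_eq_mul]
    _ ≤ (2 * L) * (K * (5 * L) * L) := by
        gcongr
        exact natLog_two_add_one_le hX
    _ = K * 10 * L ^ 3 := by ring
    _ ≤ K * 10 * (D * (X : ℝ) ^ ε) ^ 3 := by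
        gcongr
        exact two_add_log_le_rpow hε0 hX'
    _ = C₁ * 2 ^ (1 + ε) * (10 * D ^ 3) * (((X : ℝ) ^ (1 + ε) * ((X : ℝ) ^ ε) ^ 3) *
          y ^ (-(1 / 12) : ℝ)) := by
        rw [hK, Real.mul_rpow (by norm_num) (by positivity)]; ring
    _ = _ := by
        rw [← Real.rpow_natCast ((X : ℝ) ^ ε), ← Real.rpow_mul (by positivity), ← Real.rpow_add (by positivity)]
        congr 3
        rw [hε]; push_cast; ring

/-! ### Jacobi symbols against periodic weights -/

theorem exists_eq_Ico_of_ordConnected (S : Finset ℤ)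
    (hS : ∀ a ∈ S, ∀ b ∈ S, ∀ c, a ≤ c → c ≤ b → c ∈ S) : ∃ A B : ℤ, S = Ico A B := by
  rcases S.eq_empty_or_nonempty with rfl | h
  · exact ⟨0, 0, by simp⟩
  · refine ⟨S.min' h, S.max' h + 1, ?_⟩
    ext c
    rw [mem_Ico, Int.lt_add_one_iff]
    exact ⟨fun hc => ⟨S.min'_le c hc, S.le_max' c hc⟩,
      fun hc => hS _ (S.min'_mem h) _ (S.max'_mem h) c hc.1 hc.2⟩

theorem sum_Ico_int_eq_sum_range {E : Type*} [AddCommMonoid E] (f : ℤ → E) (A B : ℤ) :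
    ∑ s ∈ Ico A B, f s = ∑ t ∈ range (B - A).toNat, f (A + t) := by
  symm
  refine Finset.sum_bij (fun t _ => A + (t : ℤ)) ?_ ?_ ?_ ?_
  · intro t ht
    rw [Finset.mem_range] at ht
    rw [mem_Ico]; omega
  · intro a _ b _ h; omega
  · intro s hs
    rw [mem_Ico] at hs
    exact ⟨(s - A).toNat, by rw [Finset.mem_range]; omega, by omega⟩
  · intro t _; rfl

theorem jacobiSym_congr {a a' : ℤ} {b : ℕ} (h : (b : ℤ) ∣ a - a') :
    jacobiSym a b = jacobiSym a' b :=
  jacobiSym.mod_left' ((Int.modEq_iff_dvd).2 h).symm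

/-- Splitting off the part of `n` built from the primes dividing `D`. -/
theorem exists_coprime_part (D : ℕ) (n : ℕ) (hn : 1 ≤ n) :
    ∃ a b : ℕ, n = a * b ∧ Nat.Coprime b D ∧
      (∀ s s' : ℤ, (D : ℤ) ∣ s - s' → jacobiSym s a = jacobiSym s' a) ∧
      ∃ e g : ℕ, e ∣ D ∧ a = e * g ^ 2 := by
  induction n using Nat.strong_induction_on with
  | _ n ih =>
    by_cases hc : Nat.Coprime n D
    · exact ⟨1, n, by simp, hc, by simp, 1, 1, one_dvd _, rfl⟩
    · obtain ⟨p, hp, hpn, hpD⟩ := Nat.Prime.not_coprime_iff_dvd.1 hc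
      obtain ⟨m, rfl⟩ := hpn
      have hm : 1 ≤ m := Nat.pos_of_ne_zero fun h => by simp [h] at hn
      obtain ⟨a, b, rfl, hb, hper, e, g, heD, rfl⟩ := ih m (by nlinarith [hp.two_le]) hm
      have ha0 : e * g ^ 2 ≠ 0 := fun h => by simp [h] at hm
      refine ⟨p * (e * g ^ 2), b, by ring, hb, ?_, ?_⟩
      · intro s s' hs
        rw [jacobiSym.mul_right' s hp.ne_zero ha0, jacobiSym.mul_right' s' hp.ne_zero ha0,
          hper s s' hs, jacobiSym_congr ((Int.natCast_dvd_natCast.2 hpD).trans hs)]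
      -- A repeated prime moves into the square part: p·(pe')·g² = e'(pg)².
      · by_cases hpe : p ∣ e
        · obtain ⟨e', rfl⟩ := hpe
          exact ⟨e', p * g, (Dvd.intro_left p rfl).trans heD, by ring⟩
        · exact ⟨p * e, g, ((Nat.Prime.coprime_iff_not_dvd hp).2 hpe).mul_dvd_of_dvd_of_dvd hpD heD,
            by ring⟩

/-- With D' inverse to D modulo b, tD + v ≡ D(vD' + t), so a progression reduces to an interval. -/
theorem norm_sum_jacobiSym_progression_le {b D : ℕ} (hb : b % 2 = 1) (hsq : ¬ IsSquare b)
    (hbD : Nat.Coprime b D) (v A B : ℤ) :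
    ‖∑ t ∈ Ico A B, (jacobiSym (t * D + v) b : ℂ)‖ ≤
      Real.sqrt b * (#b.divisors * (1 + Real.log b)) := by
  obtain ⟨D', hD'⟩ : ∃ D' : ℤ, (b : ℤ) ∣ 1 - D' * D := by
    obtain ⟨x, y, h⟩ := Int.isCoprime_iff_gcd_eq_one.2 (by simpa using hbD : Int.gcd b D = 1)
    exact ⟨y, x, by linarith⟩
  have h1 : ∀ t : ℤ, (jacobiSym (t * D + v) b : ℂ) =
      (jacobiSym D b : ℂ) * (jacobiSym (v * D' + t) b : ℂ) := by
    intro t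
    rw [← Int.cast_mul, ← jacobiSym.mul_left]
    congr 1
    refine jacobiSym_congr ?_
    have : t * D + v - D * (v * D' + t) = v * (1 - D' * D) := by ring
    rw [this]; exact hD'.mul_left v
  simp only [h1]
  rw [← Finset.mul_sum, norm_mul, sum_Ico_int_eq_sum_range]
  have h2 : ‖(jacobiSym D b : ℂ)‖ ≤ 1 := by
    rcases jacobiSym.trichotomy (D : ℤ) b with h | h | h <;> rw [h] <;> simp
  have h3 := norm_sum_jacobiSym_le hb hsq (v * D' + A) (B - A).toNat
  simp only [add_assoc] at h3 ⊢
  calc _ ≤ 1 * _ := mul_le_mul_of_nonneg_right h2 (norm_nonneg _)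
    _ ≤ _ := by rw [one_mul]; exact h3

/-- On a residue class modulo D both the weight and the symbol modulo a are constant, and the symbol
modulo the nonsquare b is left. The factor D counts the classes. -/
theorem norm_sum_periodic_mul_jacobiSym_le {n a b D : ℕ} (hD : 1 ≤ D) (hn : n % 2 = 1)
    (hnab : n = a * b) (hbD : Nat.Coprime b D)
    (hper : ∀ s s' : ℤ, (D : ℤ) ∣ s - s' → jacobiSym s a = jacobiSym s' a)
    (hsq : ¬ IsSquare b) (g : ℤ → ℂ) (hg : ∀ s, ‖g s‖ ≤ 1)
    (hgper : ∀ s s' : ℤ, (D : ℤ) ∣ s - s' → g s = g s') (A B : ℤ) :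
    ‖∑ s ∈ Ico A B, g s * (jacobiSym s n : ℂ)‖ ≤
      D * (Real.sqrt n * (#n.divisors * (1 + Real.log n))) := by
  have hn0 : n ≠ 0 := by omega
  have ha0 : a ≠ 0 := by rintro rfl; simp at hnab; omega
  have hb0 : b ≠ 0 := by rintro rfl; simp at hnab; omega
  have hb : b % 2 = 1 := by
    rw [hnab] at hn
    exact Nat.odd_iff.1 (Nat.odd_mul.1 (Nat.odd_iff.2 hn)).2
  have hDpos : (0 : ℤ) < D := by exact_mod_cast hD
  have hmaps : ∀ s ∈ Ico A B, s % (D : ℤ) ∈ Ico (0 : ℤ) D := fun s _ =>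
    mem_Ico.2 ⟨Int.emod_nonneg _ hDpos.ne', Int.emod_lt_of_pos _ hDpos⟩
  rw [← Finset.sum_fiberwise_of_maps_to hmaps]
  have hclass : ∀ v ∈ Ico (0 : ℤ) D,
      ‖∑ s ∈ Ico A B with s % (D : ℤ) = v, g s * (jacobiSym s n : ℂ)‖ ≤
        Real.sqrt n * (#n.divisors * (1 + Real.log n)) := by
    intro v hv
    rw [mem_Ico] at hv
    have hset : (Ico A B).filter (fun s => s % (D : ℤ) = v) =
        (Ico A B).filter (fun s => s ≡ v [ZMOD D]) := by
      refine Finset.filter_congr fun s _ => ?_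
      rw [Int.ModEq, Int.emod_eq_of_lt hv.1 hv.2]
    rw [hset, Int.Ico_filter_modEq_eq, Int.Ico_filter_dvd_eq _ _ hDpos]
    rw [Finset.sum_map, Finset.sum_map]
    simp only [Function.Embedding.coeFn_mk]
    have hterm : ∀ t : ℤ, g (t * D + v) * (jacobiSym (t * D + v) n : ℂ) =
        g v * (jacobiSym v a : ℂ) * (jacobiSym (t * D + v) b : ℂ) := by
      intro t
      have hdvd : (D : ℤ) ∣ t * D + v - v := ⟨t, by ring⟩
      rw [hgper _ _ hdvd, hnab, jacobiSym.mul_right' _ ha0 hb0, hper _ _ hdvd]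
      push_cast; ring
    simp only [hterm]
    rw [← Finset.mul_sum, norm_mul]
    have h1 : ‖g v * (jacobiSym v a : ℂ)‖ ≤ 1 := by
      rw [norm_mul]
      refine mul_le_one₀ (hg v) (norm_nonneg _) ?_
      rcases jacobiSym.trichotomy v a with h | h | h <;> rw [h] <;> simp
    have hbn : b ≤ n := Nat.le_of_dvd (by omega) ⟨a, by rw [hnab, mul_comm]⟩
    have hb1 : (1 : ℝ) ≤ b := by exact_mod_cast Nat.one_le_iff_ne_zero.2 hb0
    have hbn' : (b : ℝ) ≤ n := by exact_mod_cast hbn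
    have hdiv : #b.divisors ≤ #n.divisors :=
      Finset.card_le_card (Nat.divisors_subset_of_dvd hn0 ⟨a, by rw [hnab, mul_comm]⟩)
    have hlog : 0 ≤ Real.log b := Real.log_nonneg hb1
    calc _ ≤ 1 * (Real.sqrt b * (#b.divisors * (1 + Real.log b))) :=
          mul_le_mul h1 (norm_sum_jacobiSym_progression_le hb hsq hbD _ _ _) (norm_nonneg _)
            zero_le_one
      _ ≤ _ := by
          rw [one_mul]
          gcongr
  refine (norm_sum_le _ _).trans ((Finset.sum_le_sum hclass).trans ?_)
  rw [Finset.sum_const, Int.card_Ico, nsmul_eq_mul]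
  simp

/-- The integers in `[1, H]` that are a square times a divisor of `D` are rare. -/
theorem card_divisor_mul_sq_le (D H : ℕ) (hD : 1 ≤ D) (S : Finset ℕ)
    (hS : ∀ n ∈ S, 1 ≤ n ∧ n ≤ H ∧ ∃ e g : ℕ, e ∣ D ∧ n = e * g ^ 2) :
    #S ≤ D * Nat.sqrt H := by
  have hsub : S ⊆ (D.divisors ×ˢ Icc 1 (Nat.sqrt H)).image fun p => p.1 * p.2 ^ 2 := by
    intro n hn
    obtain ⟨h1, h2, e, g, he, rfl⟩ := hS n hn
    have he0 : 1 ≤ e := Nat.pos_of_ne_zero fun h => by simp [h] at h1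
    have hg0 : 1 ≤ g := Nat.pos_of_ne_zero fun h => by simp [h] at h1
    refine mem_image.2 ⟨(e, g), ?_, rfl⟩
    rw [mem_product, mem_Icc, Nat.mem_divisors, Nat.le_sqrt]
    exact ⟨⟨he, by omega⟩, hg0, by nlinarith⟩
  refine (card_le_card hsub).trans (card_image_le.trans ?_)
  rw [card_product, Nat.card_Icc, Nat.add_sub_cancel]
  exact Nat.mul_le_mul_right _ (Nat.card_divisors_le_self D)

/-! ### Partial summation -/

theorem norm_sum_range_mul_le (f G : ℕ → ℂ) (n : ℕ) {Q V : ℝ} (hQ0 : 0 ≤ Q)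
    (hQ : ∀ m ≤ n, ‖∑ j ∈ range m, G j‖ ≤ Q) (hf : ∀ j, ‖f j‖ ≤ 1)
    (hV : ∑ j ∈ range (n - 1), ‖f (j + 1) - f j‖ ≤ V) :
    ‖∑ j ∈ range n, f j * G j‖ ≤ Q * (1 + V) := by
  have h := Finset.sum_range_by_parts f G n
  simp only [smul_eq_mul] at h
  rw [h]
  refine (norm_sub_le _ _).trans ?_
  have h1 : ‖f (n - 1) * ∑ i ∈ range n, G i‖ ≤ Q := by
    rw [norm_mul]
    calc _ ≤ 1 * Q := mul_le_mul (hf _) (hQ n le_rfl) (norm_nonneg _) zero_le_one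
      _ = Q := one_mul Q
  have h2 : ‖∑ i ∈ range (n - 1), (f (i + 1) - f i) * ∑ j ∈ range (i + 1), G j‖ ≤ V * Q := by
    refine (norm_sum_le _ _).trans ?_
    calc _ ≤ ∑ i ∈ range (n - 1), ‖f (i + 1) - f i‖ * Q := by
          refine Finset.sum_le_sum fun i hi => ?_
          rw [norm_mul]
          rw [Finset.mem_range] at hi
          exact mul_le_mul_of_nonneg_left (hQ _ (by omega)) (norm_nonneg _)
      _ = (∑ i ∈ range (n - 1), ‖f (i + 1) - f i‖) * Q := by rw [Finset.sum_mul]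
      _ ≤ V * Q := mul_le_mul_of_nonneg_right hV hQ0
  linarith

theorem norm_exp_I_mul_sub_le (a b : ℝ) :
    ‖Complex.exp (Complex.I * a) - Complex.exp (Complex.I * b)‖ ≤ |a - b| := by
  have h : Complex.exp (Complex.I * a) - Complex.exp (Complex.I * b) =
      Complex.exp (Complex.I * b) * (Complex.exp (Complex.I * ((a - b : ℝ) : ℂ)) - 1) := by
    rw [mul_sub, ← Complex.exp_add, mul_one]
    congr 2
    push_cast; ring
  rw [h, norm_mul, mul_comm Complex.I (b : ℂ), Complex.norm_exp_ofReal_mul_I, one_mul]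
  exact Real.norm_exp_I_mul_ofReal_sub_one_le

/-- Partial summation against `e^{ikθ}` with a monotone or antitone phase of bounded range. -/
theorem norm_sum_Ico_mul_exp_le (G : ℤ → ℂ) {Q : ℝ} (hQ : ∀ A B : ℤ, ‖∑ s ∈ Ico A B, G s‖ ≤ Q)
    (θ : ℤ → ℝ) (hθ : Monotone θ ∨ Antitone θ) {R : ℝ} (hR : ∀ s t, |θ s - θ t| ≤ R)
    (k : ℤ) (A B : ℤ) :
    ‖∑ s ∈ Ico A B, Complex.exp (Complex.I * ((k * θ s : ℝ) : ℂ)) * G s‖ ≤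
      Q * (1 + |(k : ℝ)| * R) := by
  have hQ0 : 0 ≤ Q := (norm_nonneg _).trans (hQ 0 0)
  rw [sum_Ico_int_eq_sum_range]
  refine norm_sum_range_mul_le (fun j : ℕ => Complex.exp (Complex.I * ((k * θ (A + j) : ℝ) : ℂ)))
    (fun j : ℕ => G (A + j)) _ hQ0 ?_ ?_ ?_
  · intro m _
    have := hQ A (A + m)
    rw [sum_Ico_int_eq_sum_range] at this
    simpa using this
  · intro j
    rw [mul_comm Complex.I, Complex.norm_exp_ofReal_mul_I]
  · set n := (B - A).toNat - 1
    calc _ ≤ ∑ j ∈ range n, |(k : ℝ)| * |θ (A + (j + 1 : ℕ)) - θ (A + j)| := by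
          refine Finset.sum_le_sum fun j _ => (norm_exp_I_mul_sub_le _ _).trans (le_of_eq ?_)
          rw [← mul_sub, abs_mul]
      _ = |(k : ℝ)| * |∑ j ∈ range n, (θ (A + (j + 1 : ℕ)) - θ (A + j))| := by
          rw [← Finset.mul_sum]
          congr 1
          rcases hθ with h | h
          · rw [Finset.abs_sum_of_nonneg fun j _ => sub_nonneg.2 (h (by push_cast; omega))]
            exact Finset.sum_congr rfl fun j _ =>
              abs_of_nonneg (sub_nonneg.2 (h (by push_cast; omega)))
          · rw [← abs_neg, ← Finset.sum_neg_distrib, Finset.abs_sum_of_nonneg fun j _ => by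
              rw [neg_sub]; exact sub_nonneg.2 (h (by push_cast; omega))]
            exact Finset.sum_congr rfl fun j _ =>
              abs_of_nonpos (sub_nonpos.2 (h (by push_cast; omega)))
      _ ≤ _ := by
          rw [Finset.sum_range_sub (fun j : ℕ => θ (A + j))]
          exact mul_le_mul_of_nonneg_left (hR _ _) (abs_nonneg _)

/-! ### Grössencharacters -/

theorem residueChar_congr {d : ℕ} (χ : ResidueChar d) {z w : GaussianInt}
    (hre : (4 * d : ℤ) ∣ z.re - w.re) (him : (4 * d : ℤ) ∣ z.im - w.im) :
    χ (Ideal.Quotient.mk _ z) = χ (Ideal.Quotient.mk _ w) := by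
  congr 1
  rw [Ideal.Quotient.eq, Ideal.mem_span_singleton]
  obtain ⟨a, ha⟩ := hre
  obtain ⟨b, hb⟩ := him
  refine ⟨⟨a, b⟩, ?_⟩
  have h4 : (4 * d : GaussianInt) = ((4 * d : ℤ) : GaussianInt) := by push_cast; rfl
  rw [h4]
  apply Zsqrtd.ext
  · simp [ha]
  · simp [hb]

theorem finite_residue {d : ℕ} (hd : 1 ≤ d) :
    Finite (GaussianInt ⧸ Ideal.span {(4 * d : GaussianInt)}) := by
  have h0 : (0 : ℤ) < 4 * d := by omega
  refine Finite.of_surjective (α := (Set.Ico (0 : ℤ) (4 * d)) × (Set.Ico (0 : ℤ) (4 * d)))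
    (fun p => Ideal.Quotient.mk _ (⟨p.1, p.2⟩ : GaussianInt)) ?_
  intro x
  obtain ⟨z, rfl⟩ := Ideal.Quotient.mk_surjective x
  refine ⟨(⟨z.re % (4 * d), Int.emod_nonneg _ h0.ne', Int.emod_lt_of_pos _ h0⟩,
    ⟨z.im % (4 * d), Int.emod_nonneg _ h0.ne', Int.emod_lt_of_pos _ h0⟩), ?_⟩
  rw [Ideal.Quotient.eq, Ideal.mem_span_singleton]
  refine ⟨⟨-(z.re / (4 * d)), -(z.im / (4 * d))⟩, ?_⟩
  have h4 : (4 * d : GaussianInt) = ((4 * d : ℤ) : GaussianInt) := by push_cast; rfl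
  have h1 := Int.emod_add_mul_ediv z.re (4 * d)
  have h2 := Int.emod_add_mul_ediv z.im (4 * d)
  rw [h4]
  apply Zsqrtd.ext
  · simp only [Zsqrtd.re_sub, Zsqrtd.re_mul, Zsqrtd.re_intCast, Zsqrtd.im_intCast]
    linarith
  · simp only [Zsqrtd.im_sub, Zsqrtd.im_mul, Zsqrtd.re_intCast, Zsqrtd.im_intCast]
    linarith

/-- The residue ring is finite as d ≥ 1, so values at units are roots of unity. -/
theorem norm_residueChar_le {d : ℕ} (hd : 1 ≤ d) (χ : ResidueChar d)
    (x : GaussianInt ⧸ Ideal.span {(4 * d : GaussianInt)}) : ‖χ x‖ ≤ 1 := by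
  have := finite_residue hd
  by_cases hx : IsUnit x
  · obtain ⟨u, rfl⟩ := hx
    obtain ⟨n, hn, h⟩ := isOfFinOrder_iff_pow_eq_one.1 (isOfFinOrder_of_finite u)
    have h1 : (χ (u : GaussianInt ⧸ Ideal.span {(4 * d : GaussianInt)})) ^ n = 1 := by
      rw [← map_pow, ← Units.val_pow_eq_pow_val, h]; simp
    have h2 := congrArg norm h1
    rw [norm_pow, norm_one] at h2
    exact ((pow_eq_one_iff_of_nonneg (norm_nonneg _) hn.ne').1 h2).le
  · rw [MulChar.map_nonunit χ hx]; simp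

theorem norm_div_norm_zpow_le (c : ℂ) (k : ℤ) (hc : c ≠ 0) : ‖(c / (‖c‖ : ℂ)) ^ k‖ = 1 := by
  rw [norm_zpow, norm_div, Complex.norm_real, norm_norm, div_self (norm_ne_zero_iff.2 hc),
    one_zpow]

theorem norm_grossenchar_le {d : ℕ} (hd : 1 ≤ d) (χ : ResidueChar d) (k : ℤ) {z : GaussianInt}
    (hz : z ≠ 0) : ‖grossenchar χ k z‖ ≤ 1 := by
  unfold grossenchar
  rw [norm_mul, norm_div_norm_zpow_le _ _ (by simpa using hz), mul_one]
  exact norm_residueChar_le hd χ _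

theorem grossenchar_mul {d : ℕ} (χ : ResidueChar d) (k : ℤ) (z w : GaussianInt) :
    grossenchar χ k (z * w) = grossenchar χ k z * grossenchar χ k w := by
  unfold grossenchar
  rw [map_mul, map_mul, map_mul, norm_mul, Complex.ofReal_mul, mul_div_mul_comm, mul_zpow]
  ring

/-- Writing z = r(1 + is/r) exhibits the phase as arctan(s/r), monotone in s and of range less than
π along a row; this makes partial summation cost only O(|k| + 1). -/
theorem unitary_part_eq (r s : ℤ) (hr : r ≠ 0) (k : ℤ) :
    (GaussianInt.toComplex ⟨r, s⟩ / (‖GaussianInt.toComplex ⟨r, s⟩‖ : ℂ)) ^ k =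
      (r.sign : ℂ) ^ k * Complex.exp (Complex.I * ((k * Real.arctan (s / r) : ℝ) : ℂ)) := by
  have hr' : (r : ℝ) ≠ 0 := by exact_mod_cast hr
  set x : ℝ := s / r with hx
  have hpos : (0 : ℝ) < 1 + x ^ 2 := by positivity
  have hz : GaussianInt.toComplex ⟨r, s⟩ = (r : ℂ) * (1 + x * Complex.I) := by
    rw [GaussianInt.toComplex_def₂]
    apply Complex.ext
    · simp
    · simp [hx]; field_simp
  have h1 : (1 + x * Complex.I : ℂ) =
      (Real.sqrt (1 + x ^ 2) : ℂ) * Complex.exp (Complex.I * (Real.arctan x : ℂ)) := by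
    rw [mul_comm Complex.I, Complex.exp_mul_I, ← Complex.ofReal_cos, ← Complex.ofReal_sin,
      Real.cos_arctan, Real.sin_arctan]
    have : (Real.sqrt (1 + x ^ 2) : ℂ) ≠ 0 := by
      exact_mod_cast (Real.sqrt_pos.2 hpos).ne'
    push_cast
    field_simp
  have hsqrt : (Real.sqrt (1 + x ^ 2) : ℂ) ≠ 0 := by
    exact_mod_cast (Real.sqrt_pos.2 hpos).ne'
  have hsign : (r : ℂ) = (r.sign : ℂ) * ((|(r : ℝ)| : ℝ) : ℂ) := by
    have : (r : ℝ) = r.sign * |(r : ℝ)| := by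
      have := Int.sign_mul_abs r
      exact_mod_cast this.symm
    exact_mod_cast this
  have habs : ((|(r : ℝ)| : ℝ) : ℂ) ≠ 0 := by
    exact_mod_cast abs_ne_zero.2 hr'
  have h2 : GaussianInt.toComplex ⟨r, s⟩ / (‖GaussianInt.toComplex ⟨r, s⟩‖ : ℂ) =
      (r.sign : ℂ) * Complex.exp (Complex.I * (Real.arctan x : ℂ)) := by
    have hnorm : (‖GaussianInt.toComplex ⟨r, s⟩‖ : ℂ) =
        ((|(r : ℝ)| : ℝ) : ℂ) * (Real.sqrt (1 + x ^ 2) : ℂ) := by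
      rw [hz, h1, norm_mul, norm_mul, mul_comm Complex.I, Complex.norm_exp_ofReal_mul_I, mul_one,
        Complex.norm_real, Complex.norm_intCast, Real.norm_of_nonneg (Real.sqrt_nonneg _)]
      push_cast; rfl
    rw [hnorm, hz, h1]
    nth_rewrite 1 [hsign]
    field_simp
  rw [h2, mul_zpow, ← Complex.exp_int_mul]
  congr 2
  push_cast; ring

/-! ### Type I sums: a single row -/

theorem jacobiKubota_mul_of_primitive {w z : GaussianInt} (hw : IsPrimary w) (hz : IsPrimary z)
    (hp : IsPrimitive w) :
    jacobiKubota (w * z) = jacobiKubota w * jacobiKubota z * (dirichletSym z w : ℂ) *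
      (kubotaSign w.re w.im z.re (w * z).re : ℂ) := by
  by_cases him : w.im = 0
  · have h1 := hw.eq_one_of_im_eq_zero hp him
    subst h1
    have h2 : kubotaSign 1 0 z.re z.re = 1 := by
      unfold kubotaSign realHilbert
      rcases lt_or_gt_of_ne hz.re_ne_zero with h | h
      · simp [h, Int.sign_eq_neg_one_of_neg h]
      · simp [h.not_gt, Int.sign_eq_one_of_pos h]
    have h3 : jacobiKubota 1 = 1 := by simp [jacobiKubota]
    have h4 : dirichletSym z 1 = 1 := by
      unfold dirichletSym; rw [gnorm_one]; simp
    rw [one_mul, h3, h4, Zsqrtd.re_one, Zsqrtd.im_one, h2]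
    simp
  · exact jacobiKubota_mul hw hz hp him

open Classical in
/-- The summand of a type I sum along the row `re z = r`. -/
def rowTerm {d : ℕ} (χ : ResidueChar d) (k : ℤ) (W : GaussianInt) (r s : ℤ) : ℂ :=
  if IsPrimary ⟨r, s⟩ then grossenchar χ k ⟨r, s⟩ * jacobiKubota (W * ⟨r, s⟩) else 0

theorem norm_rowTerm_le {d : ℕ} (hd : 1 ≤ d) (χ : ResidueChar d) (k : ℤ) (W : GaussianInt)
    (r s : ℤ) : ‖rowTerm χ k W r s‖ ≤ 1 := by
  unfold rowTerm
  split_ifs with h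
  · rw [norm_mul]
    exact mul_le_one₀ (norm_grossenchar_le hd χ k h.ne_zero) (norm_nonneg _)
      (norm_jacobiKubota_le _)
  · simp

/-- On a row the twist rule leaves (s/|r|) times a weight of period 4d·N(W) (the residue character,
the primary condition and the symbol modulo W), times the sign and the phase. The constant 12 is 3
for the sign times 4 as a bound for π. -/
theorem norm_sum_row_le {d : ℕ} (hd : 1 ≤ d) (χ : ResidueChar d) (k : ℤ) {W : GaussianInt}
    (hW : IsPrimary W) (hWp : IsPrimitive W) {r : ℤ} (hr : r % 2 = 1) {a b : ℕ}
    (hab : r.natAbs = a * b) (hbD : Nat.Coprime b (4 * d * gnorm W))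
    (hper : ∀ s s' : ℤ, ((4 * d * gnorm W : ℕ) : ℤ) ∣ s - s' → jacobiSym s a = jacobiSym s' a)
    (hsq : ¬ IsSquare b) (A B : ℤ) :
    ‖∑ s ∈ Ico A B, rowTerm χ k W r s‖ ≤
      12 * (|(k : ℝ)| + 1) * ((4 * d * gnorm W : ℕ) *
        (Real.sqrt r.natAbs * (#r.natAbs.divisors * (1 + Real.log r.natAbs)))) := by
  classical
  have hr0 : r ≠ 0 := by rintro rfl; simp at hr
  have hq := gnorm_pos hW.ne_zero
  set n := r.natAbs with hn
  set D := 4 * d * gnorm W with hD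
  have hD1 : 1 ≤ D := Nat.mul_pos (by omega) hq
  set g : ℤ → ℂ := fun s => if IsPrimary ⟨r, s⟩ then
    χ (Ideal.Quotient.mk _ ⟨r, s⟩) * (dirichletSym ⟨r, s⟩ W : ℂ) else 0 with hg
  have hg1 : ∀ s, ‖g s‖ ≤ 1 := by
    intro s
    rw [hg]; simp only
    split_ifs
    · rw [norm_mul]
      exact mul_le_one₀ (norm_residueChar_le hd χ _) (norm_nonneg _) (norm_dirichletSym_le _ _)
    · simp
  have hgper : ∀ s s' : ℤ, (D : ℤ) ∣ s - s' → g s = g s' := by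
    intro s s' h
    have h4d : (4 * d : ℤ) ∣ s - s' := by
      refine dvd_trans ?_ h
      rw [hD]; push_cast; exact dvd_mul_right _ _
    have hqd : (gnorm W : ℤ) ∣ s - s' := by
      refine dvd_trans ?_ h
      rw [hD]; push_cast; exact dvd_mul_left _ _
    have h4 : (4 : ℤ) ∣ s - s' := (dvd_mul_right _ _).trans h4d
    have hiff : IsPrimary ⟨r, s⟩ ↔ IsPrimary ⟨r, s'⟩ := by
      rw [isPrimary_iff, isPrimary_iff]; simp only; omega
    have hχ : χ (Ideal.Quotient.mk _ ⟨r, s⟩) = χ (Ideal.Quotient.mk _ ⟨r, s'⟩) :=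
      residueChar_congr χ (by simp) h4d
    have hsym : dirichletSym ⟨r, s⟩ W = dirichletSym ⟨r, s'⟩ W := by
      unfold dirichletSym
      refine jacobiSym_congr ?_
      rw [Zsqrtd.re_mul, Zsqrtd.re_mul]
      simp only
      obtain ⟨t, ht⟩ := hqd
      exact ⟨-W.im * t, by linear_combination (-W.im) * ht⟩
    rw [hg]; simp only [hiff, hχ, hsym]
  set P : ℝ := D * (Real.sqrt n * (#n.divisors * (1 + Real.log n))) with hP
  have hG1 : ∀ A B : ℤ, ‖∑ s ∈ Ico A B, g s * (jacobiSym s n : ℂ)‖ ≤ P :=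
    norm_sum_periodic_mul_jacobiSym_le hD1 (by omega) hab hbD hper hsq g hg1 hgper
  have hP0 : 0 ≤ P := (norm_nonneg _).trans (hG1 0 0)
  set R : ℤ → ℤ := fun s => W.re * r - W.im * s with hR
  set κ₁ : ℂ := (kubotaSign W.re W.im r 1 : ℂ) with hκ₁
  set κ₂ : ℂ := (kubotaSign W.re W.im r (-1) : ℂ) with hκ₂
  have hk : ∀ s, (kubotaSign W.re W.im r (R s) : ℂ) = κ₁ + (κ₂ - κ₁) * (if R s < 0 then 1 else 0) := by
    intro s
    split_ifs with h
    · rw [kubotaSign_congr (R' := -1) rfl (by simp [h])]; ring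
    · rw [kubotaSign_congr (R' := 1) rfl (by simp [h])]; ring
  set G : ℤ → ℂ := fun s => g s * (jacobiSym s n : ℂ) * (kubotaSign W.re W.im r (R s) : ℂ) with hG
  -- As R is affine in s, {R < 0} cuts an interval in an interval. The sum is κ₁ times the whole
  -- plus a jump of size at most 2 times a part.
  have hG3 : ∀ A B : ℤ, ‖∑ s ∈ Ico A B, G s‖ ≤ 3 * P := by
    intro A B
    obtain ⟨A', B', hAB⟩ := exists_eq_Ico_of_ordConnected ((Ico A B).filter fun s => R s < 0) (by
      intro a ha b hb c hac hcb
      rw [mem_filter, mem_Ico] at ha hb ⊢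
      refine ⟨⟨by omega, by omega⟩, ?_⟩
      have h1 := ha.2
      have h2 := hb.2
      rw [hR] at h1 h2 ⊢
      simp only at h1 h2 ⊢
      rcases le_total 0 W.im with h | h <;> nlinarith)
    have hsum : ∑ s ∈ Ico A B, G s = κ₁ * ∑ s ∈ Ico A B, g s * (jacobiSym s n : ℂ) +
        (κ₂ - κ₁) * ∑ s ∈ Ico A' B', g s * (jacobiSym s n : ℂ) := by
      rw [← hAB, Finset.sum_filter, Finset.mul_sum, Finset.mul_sum, ← Finset.sum_add_distrib]
      refine Finset.sum_congr rfl fun s _ => ?_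
      rw [hG]; simp only
      rw [hk]
      split_ifs <;> ring
    rw [hsum]
    have h1 : ‖κ₁‖ ≤ 1 := norm_kubotaSign_le _ _ _ _
    have h2 : ‖κ₂‖ ≤ 1 := norm_kubotaSign_le _ _ _ _
    have h3 : ‖κ₂ - κ₁‖ ≤ 2 := (norm_sub_le _ _).trans (by linarith)
    refine (norm_add_le _ _).trans ?_
    rw [norm_mul, norm_mul]
    calc _ ≤ 1 * P + 2 * P := add_le_add (mul_le_mul h1 (hG1 _ _) (norm_nonneg _) zero_le_one)
          (mul_le_mul h3 (hG1 _ _) (norm_nonneg _) zero_le_two)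
      _ = _ := by ring
  set θ : ℤ → ℝ := fun s => Real.arctan (s / r) with hθ
  have hθmono : Monotone θ ∨ Antitone θ := by
    rcases lt_or_gt_of_ne hr0 with h | h
    · right
      intro s t hst
      have h' : (r : ℝ) < 0 := by exact_mod_cast h
      have hst' : (s : ℝ) ≤ t := by exact_mod_cast hst
      exact Real.arctan_strictMono.monotone (div_le_div_of_nonpos_of_le h'.le hst')
    · left
      intro s t hst
      have h' : (0 : ℝ) < r := by exact_mod_cast h
      have hst' : (s : ℝ) ≤ t := by exact_mod_cast hst
      exact Real.arctan_strictMono.monotone (div_le_div_of_nonneg_right hst' h'.le)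
  have hθR : ∀ s t, |θ s - θ t| ≤ Real.pi := by
    intro s t
    have h1 := Real.arctan_lt_pi_div_two (s / r : ℝ)
    have h2 := Real.neg_pi_div_two_lt_arctan (s / r : ℝ)
    have h3 := Real.arctan_lt_pi_div_two (t / r : ℝ)
    have h4 := Real.neg_pi_div_two_lt_arctan (t / r : ℝ)
    rw [abs_le]
    constructor <;> rw [hθ] <;> simp only <;> linarith
  have hmain := norm_sum_Ico_mul_exp_le G hG3 θ hθmono hθR k A B
  set c₀ : ℂ := (r.sign : ℂ) ^ k * jacobiKubota W * Complex.I ^ ((r - 1) / 2) with hc₀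
  have hc₀1 : ‖c₀‖ ≤ 1 := by
    rw [hc₀, norm_mul, norm_mul, norm_zpow, norm_zpow, Complex.norm_I, one_zpow, mul_one]
    have : ‖(r.sign : ℂ)‖ = 1 := by
      rcases lt_or_gt_of_ne hr0 with h | h
      · rw [Int.sign_eq_neg_one_of_neg h]; simp
      · rw [Int.sign_eq_one_of_pos h]; simp
    rw [this, one_zpow, one_mul]
    exact norm_jacobiKubota_le _
  have hterm : ∀ s, rowTerm χ k W r s =
      c₀ * (Complex.exp (Complex.I * ((k * θ s : ℝ) : ℂ)) * G s) := by
    intro s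
    by_cases hs : IsPrimary ⟨r, s⟩
    · have h1 : rowTerm χ k W r s = grossenchar χ k ⟨r, s⟩ * jacobiKubota (W * ⟨r, s⟩) := if_pos hs
      have h2 : g s = χ (Ideal.Quotient.mk _ ⟨r, s⟩) * (dirichletSym ⟨r, s⟩ W : ℂ) := if_pos hs
      have h3 : (W * ⟨r, s⟩ : GaussianInt).re = R s := by
        rw [Zsqrtd.re_mul, hR]; simp only; ring
      rw [h1, jacobiKubota_mul_of_primitive hW hs hWp, h3, hG]
      simp only
      rw [h2, grossenchar, unitary_part_eq r s hr0 k]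
      have h4 : jacobiKubota ⟨r, s⟩ = Complex.I ^ ((r - 1) / 2) * (jacobiSym s n : ℂ) := rfl
      rw [h4, hc₀]
      ring
    · have h1 : rowTerm χ k W r s = 0 := if_neg hs
      have h2 : g s = 0 := if_neg hs
      rw [h1, hG]; simp only
      rw [h2]; ring
  rw [Finset.sum_congr rfl fun s _ => hterm s, ← Finset.mul_sum, norm_mul]
  have hpi := Real.pi_le_four
  have hk0 := abs_nonneg (k : ℝ)
  calc _ ≤ 1 * (3 * P * (1 + |(k : ℝ)| * Real.pi)) :=
        mul_le_mul hc₀1 hmain (norm_nonneg _) zero_le_one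
    _ ≤ 1 * (3 * P * (4 + |(k : ℝ)| * 4)) := by gcongr; norm_num
    _ = _ := by ring

/-! ### Type I sums -/

theorem sum_primaryBall_eq_sum_rowTerm {d : ℕ} (χ : ResidueChar d) (k : ℤ) (W : GaussianInt)
    (X : ℕ) :
    ∑ z ∈ primaryBall X, grossenchar χ k z * jacobiKubota (W * z) =
      ∑ r ∈ Icc (-(Nat.sqrt X : ℤ)) (Nat.sqrt X),
        ∑ s ∈ Icc (-(Nat.sqrt X : ℤ)) (Nat.sqrt X) with r ^ 2 + s ^ 2 ≤ X, rowTerm χ k W r s := by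
  classical
  simp only [Finset.sum_filter]
  rw [← Finset.sum_product', ← Finset.sum_filter]
  unfold rowTerm
  rw [← Finset.sum_filter]
  refine Finset.sum_nbij' (fun z => (z.re, z.im)) (fun p => ⟨p.1, p.2⟩) ?_ ?_ ?_ ?_ ?_
  · intro z hz
    rw [mem_primaryBall] at hz
    have h1 := gnorm_cast z
    have h2 : (gnorm z : ℤ) ≤ X := by exact_mod_cast hz.2
    rw [mem_filter, mem_filter, mem_product, mem_Icc, mem_Icc]
    exact ⟨⟨⟨abs_le_sqrt_of_sq_le (by nlinarith), abs_le_sqrt_of_sq_le (by nlinarith)⟩,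
      by rw [← h1]; exact h2⟩, hz.1⟩
  · intro p hp
    rw [mem_filter, mem_filter] at hp
    rw [mem_primaryBall]
    refine ⟨hp.2, ?_⟩
    have h1 := gnorm_cast ⟨p.1, p.2⟩
    have h2 := hp.1.2
    simp only at h1
    rw [← h1] at h2
    exact_mod_cast h2
  · intro z _; rfl
  · intro p _; rfl
  · intro z _; rfl

/-- There are O(√X) rows. A row whose |r| is not a divisor of D times a square costs about
D·H^(1/2), with H = ⌊√X⌋. The O(D·√H) exceptional rows are bounded trivially by 3H. Both
contributions are D·H^(3/2) up to η-powers. -/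
theorem exists_sum_grossenchar_jacobiKubota_le {η : ℝ} (hη : 0 < η) :
    ∃ C : ℝ, 1 ≤ C ∧ ∀ d : ℕ, 1 ≤ d → ∀ (χ : ResidueChar d) (k : ℤ) (W : GaussianInt) (X : ℕ),
      IsPrimary W → 1 ≤ X →
      ‖∑ z ∈ primaryBall X, grossenchar χ k z * jacobiKubota (W * z)‖ ≤
        C * (d * gnorm W * (|(k : ℝ)| + 1)) * (X : ℝ) ^ (3 / 4 + η) := by
  classical
  obtain ⟨C₁, hC₁, hdiv⟩ := exists_card_divisors_le hη
  set C₂ := 1 + 1 / η with hC₂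
  have hC₂1 : 1 ≤ C₂ := by have : 0 < 1 / η := by positivity
                           linarith
  refine ⟨4 * (36 * (C₁ * C₂) + 6), by nlinarith, fun d hd χ k W X hW hX => ?_⟩
  have hk0 := abs_nonneg (k : ℝ)
  have hq := gnorm_pos hW.ne_zero
  by_cases hWp : IsPrimitive W
  swap
  · rw [Finset.sum_eq_zero, norm_zero]
    · positivity
    · intro z hz
      rw [jacobiKubota_eq_zero (hW.mul (mem_primaryBall.1 hz).1).re_ne_zero, mul_zero]
      exact fun h => hWp (h.of_dvd (dvd_mul_right _ _))
  rw [sum_primaryBall_eq_sum_rowTerm]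
  set H := Nat.sqrt X with hH
  have hH1 : 1 ≤ H := by rw [hH, Nat.le_sqrt]; omega
  have hH1' : (1 : ℝ) ≤ H := by exact_mod_cast hH1
  set D := 4 * d * gnorm W with hD
  have hD1 : 1 ≤ D := Nat.mul_pos (by omega) hq
  set bad : ℤ → Prop := fun r => ∃ e g : ℕ, e ∣ D ∧ r.natAbs = e * g ^ 2 with hbad
  set E : ℝ := 12 * (|(k : ℝ)| + 1) * (D * ((C₁ * C₂) * (H : ℝ) ^ (1 / 2 + 2 * η))) with hE
  have hE0 : 0 ≤ E := by positivity
  have hcard : #(Icc (-(H : ℤ)) H) = 2 * H + 1 := by rw [Int.card_Icc]; omega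
  have hrow : ∀ r ∈ Icc (-(H : ℤ)) H,
      ‖∑ s ∈ Icc (-(H : ℤ)) H with r ^ 2 + s ^ 2 ≤ X, rowTerm χ k W r s‖ ≤
        E + if r ≠ 0 ∧ bad r then 3 * (H : ℝ) else 0 := by
    intro r hr
    rw [mem_Icc] at hr
    by_cases hr2 : r % 2 = 1
    swap
    · have hz : ∀ s, rowTerm χ k W r s = 0 := fun s =>
        if_neg fun h => hr2 ((isPrimary_iff _).1 h).1
      simp only [hz, Finset.sum_const_zero, norm_zero]
      split_ifs <;> positivity
    have hr0 : r ≠ 0 := by rintro rfl; simp at hr2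
    by_cases hb : bad r
    · rw [if_pos ⟨hr0, hb⟩]
      refine le_trans ?_ (le_add_of_nonneg_left hE0)
      refine (norm_sum_le_of_le _ fun s _ => norm_rowTerm_le hd χ k W r s).trans ?_
      rw [Finset.sum_const, nsmul_eq_mul, mul_one]
      have h1 := (Finset.card_filter_le (Icc (-(H : ℤ)) H) fun s => r ^ 2 + s ^ 2 ≤ X)
      rw [hcard] at h1
      have h2 : (#((Icc (-(H : ℤ)) H).filter fun s => r ^ 2 + s ^ 2 ≤ X) : ℝ) ≤ 2 * H + 1 := by
        exact_mod_cast h1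
      linarith
    · rw [if_neg fun h => hb h.2, add_zero]
      have hn1 : 1 ≤ r.natAbs := by omega
      obtain ⟨a, b, hab, hbD, hper, e, g, heD, hag⟩ := exists_coprime_part D r.natAbs hn1
      -- If b = c² then |r| = e(gc)² with e ∣ D, an exceptional row.
      have hsq : ¬ IsSquare b := by
        rintro ⟨c, rfl⟩
        exact hb ⟨e, g * c, heD, by rw [hab, hag]; ring⟩
      obtain ⟨A, B, hAB⟩ := exists_eq_Ico_of_ordConnected
        ((Icc (-(H : ℤ)) H).filter fun s => r ^ 2 + s ^ 2 ≤ X) (by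
          intro a ha b hb c hac hcb
          rw [mem_filter, mem_Icc] at ha hb ⊢
          refine ⟨⟨by omega, by omega⟩, ?_⟩
          rcases le_total 0 c with h | h
          · have : c ^ 2 ≤ b ^ 2 := by nlinarith
            linarith [hb.2]
          · have : c ^ 2 ≤ a ^ 2 := by nlinarith
            linarith [ha.2])
      rw [hAB]
      refine (norm_sum_row_le hd χ k hW hWp hr2 hab hbD hper hsq A B).trans ?_
      rw [← hD, hE]
      have hn1' : (1 : ℝ) ≤ r.natAbs := by exact_mod_cast hn1
      have hnH : r.natAbs ≤ H := by omega
      have hnH' : (r.natAbs : ℝ) ≤ H := by exact_mod_cast hnH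
      set n : ℝ := (r.natAbs : ℝ) with hn
      have h1 : 1 + Real.log n ≤ C₂ * (H : ℝ) ^ η := by
        have h2 := Real.log_le_rpow_div (x := n) (by linarith) hη
        have h3 : n ^ η ≤ (H : ℝ) ^ η := Real.rpow_le_rpow (by linarith) hnH' hη.le
        have h4 : (1 : ℝ) ≤ (H : ℝ) ^ η := Real.one_le_rpow hH1' hη.le
        have h5 : n ^ η / η ≤ (H : ℝ) ^ η / η := div_le_div_of_nonneg_right h3 hη.le
        calc _ ≤ (H : ℝ) ^ η + (H : ℝ) ^ η / η := by linarith
          _ = _ := by rw [hC₂]; ring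
      have h2 : (#r.natAbs.divisors : ℝ) ≤ C₁ * (H : ℝ) ^ η :=
        (hdiv r.natAbs hn1).trans (mul_le_mul_of_nonneg_left
          (Real.rpow_le_rpow (by linarith) hnH' hη.le) (by linarith))
      have h3 : Real.sqrt n ≤ (H : ℝ) ^ (1 / 2 : ℝ) := by
        rw [← Real.sqrt_eq_rpow]; exact Real.sqrt_le_sqrt hnH'
      have hlog : 0 ≤ Real.log n := Real.log_nonneg hn1'
      have h4 : Real.sqrt n * (#r.natAbs.divisors * (1 + Real.log n)) ≤
          (C₁ * C₂) * (H : ℝ) ^ (1 / 2 + 2 * η) := by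
        calc _ ≤ (H : ℝ) ^ (1 / 2 : ℝ) * ((C₁ * (H : ℝ) ^ η) * (C₂ * (H : ℝ) ^ η)) := by gcongr
          _ = (C₁ * C₂) * ((H : ℝ) ^ (1 / 2 : ℝ) * (H : ℝ) ^ η * (H : ℝ) ^ η) := by ring
          _ = _ := by
              rw [← Real.rpow_add (by linarith), ← Real.rpow_add (by linarith)]
              congr 2; ring
      gcongr
  have hcount : #((Icc (-(H : ℤ)) H).filter fun r => r ≠ 0 ∧ bad r) ≤ 2 * (D * Nat.sqrt H) := by
    set U := (Icc (-(H : ℤ)) H).filter fun r => r ≠ 0 ∧ bad r with hU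
    have h1 : #(U.image Int.natAbs) ≤ D * Nat.sqrt H := by
      refine card_divisor_mul_sq_le D H hD1 _ fun n hn => ?_
      obtain ⟨r, hr, rfl⟩ := mem_image.1 hn
      rw [hU, mem_filter, mem_Icc] at hr
      exact ⟨by omega, by omega, hr.2.2⟩
    have h2 : #U ≤ 2 * #(U.image Int.natAbs) := by
      refine Finset.card_le_mul_card_image U 2 fun n _ => ?_
      have : (U.filter fun r => r.natAbs = n) ⊆ {(n : ℤ), -(n : ℤ)} := by
        intro r hr
        rw [mem_filter] at hr
        rw [mem_insert, mem_singleton]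
        omega
      exact (card_le_card this).trans card_le_two
    omega
  have hsqrtH : (Nat.sqrt H : ℝ) ≤ (H : ℝ) ^ (1 / 2 : ℝ) := by
    rw [← Real.sqrt_eq_rpow]; exact Real.nat_sqrt_le_real_sqrt
  have hHX : (H : ℝ) ≤ (X : ℝ) ^ (1 / 2 : ℝ) := by
    rw [← Real.sqrt_eq_rpow]; exact Real.nat_sqrt_le_real_sqrt
  have hHpow : (H : ℝ) ^ (3 / 2 + 2 * η) ≤ (X : ℝ) ^ (3 / 4 + η) := by
    calc (H : ℝ) ^ (3 / 2 + 2 * η) ≤ ((X : ℝ) ^ (1 / 2 : ℝ)) ^ (3 / 2 + 2 * η) :=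
          Real.rpow_le_rpow (by linarith) hHX (by linarith)
      _ = _ := by
          rw [← Real.rpow_mul (by positivity)]
          congr 1; ring
  have hHe : ∀ e : ℝ, (H : ℝ) * (H : ℝ) ^ e = (H : ℝ) ^ (1 + e) := by
    intro e
    rw [Real.rpow_add (by linarith), Real.rpow_one]
  calc _ ≤ ∑ r ∈ Icc (-(H : ℤ)) H, (E + if r ≠ 0 ∧ bad r then 3 * (H : ℝ) else 0) :=
        norm_sum_le_of_le _ hrow
    _ = (2 * H + 1 : ℕ) * E +
        #((Icc (-(H : ℤ)) H).filter fun r => r ≠ 0 ∧ bad r) * (3 * (H : ℝ)) := by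
        rw [Finset.sum_add_distrib, Finset.sum_const, hcard, nsmul_eq_mul, ← Finset.sum_filter,
          Finset.sum_const, nsmul_eq_mul]
    _ ≤ (3 * H) * E + (2 * (D * (H : ℝ) ^ (1 / 2 : ℝ))) * (3 * (H : ℝ)) := by
        have h1 : ((2 * H + 1 : ℕ) : ℝ) ≤ 3 * H := by push_cast; linarith
        have h2 : (#((Icc (-(H : ℤ)) H).filter fun r => r ≠ 0 ∧ bad r) : ℝ) ≤
            2 * (D * Nat.sqrt H) := by exact_mod_cast hcount
        have h3 : 2 * ((D : ℝ) * Nat.sqrt H) ≤ 2 * (D * (H : ℝ) ^ (1 / 2 : ℝ)) := by gcongr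
        have h4 := h2.trans h3
        gcongr
    _ = 36 * (|(k : ℝ)| + 1) * D * (C₁ * C₂) * (H * (H : ℝ) ^ (1 / 2 + 2 * η)) +
        6 * D * (H * (H : ℝ) ^ (1 / 2 : ℝ)) := by rw [hE]; ring
    _ = 36 * (|(k : ℝ)| + 1) * D * (C₁ * C₂) * (H : ℝ) ^ (3 / 2 + 2 * η) +
        6 * D * (H : ℝ) ^ (3 / 2 : ℝ) := by
        rw [hHe, hHe]
        congr 3 <;> ring
    _ ≤ 36 * (|(k : ℝ)| + 1) * D * (C₁ * C₂) * (X : ℝ) ^ (3 / 4 + η) +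
        6 * D * ((|(k : ℝ)| + 1) * (X : ℝ) ^ (3 / 4 + η)) := by
        have h1 : (H : ℝ) ^ (3 / 2 : ℝ) ≤ (X : ℝ) ^ (3 / 4 + η) :=
          (Real.rpow_le_rpow_of_exponent_le hH1' (by linarith)).trans hHpow
        have h2 : (X : ℝ) ^ (3 / 4 + η) ≤ (|(k : ℝ)| + 1) * (X : ℝ) ^ (3 / 4 + η) :=
          le_mul_of_one_le_left (by positivity) (by linarith)
        have h3 := h1.trans h2
        gcongr
    _ = _ := by
        rw [hD]; push_cast; ring

/-! ### Logarithmic weights -/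

theorem sum_Ico_log_sub (m n : ℕ) (h : m ≤ n) :
    ∑ j ∈ Ico m n, (Real.log (j + 1 : ℕ) - Real.log j) = Real.log n - Real.log m :=
  Finset.sum_Ico_sub (fun j : ℕ => Real.log j) h

/-- Partial summation: log z is log X minus the increments of the logarithm from z to X, and the
increments are nonnegative with total log X. -/
theorem norm_sum_log_mul_le (G : ℕ → ℂ) {X : ℕ} {Q : ℝ}
    (hQ : ∀ n ≤ X, ‖∑ z ∈ Icc 1 n, G z‖ ≤ Q) :
    ‖∑ z ∈ Icc 1 X, (Real.log z : ℂ) * G z‖ ≤ Q * (2 * Real.log X) := by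
  classical
  have hterm : ∀ z ∈ Icc 1 X, (Real.log z : ℂ) * G z =
      (Real.log X : ℂ) * G z - ∑ j ∈ range X,
        (((Real.log (j + 1 : ℕ) - Real.log j : ℝ)) : ℂ) * (if z ≤ j then G z else 0) := by
    intro z hz
    rw [mem_Icc] at hz
    have h1 : ∑ j ∈ range X, (((Real.log (j + 1 : ℕ) - Real.log j : ℝ)) : ℂ) *
        (if z ≤ j then G z else 0) =
        ((∑ j ∈ Ico z X, (Real.log (j + 1 : ℕ) - Real.log j) : ℝ) : ℂ) * G z := by
      have h2 : Ico z X = (range X).filter fun j => z ≤ j := by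
        ext j; rw [mem_Ico, mem_filter, Finset.mem_range, and_comm]
      rw [h2, Finset.sum_filter]
      push_cast
      rw [Finset.sum_mul]
      refine Finset.sum_congr rfl fun j _ => ?_
      split_ifs <;> simp
    rw [h1, sum_Ico_log_sub _ _ hz.2]
    push_cast; ring
  have hball : ∀ j ∈ range X, ∑ z ∈ Icc 1 X, (if z ≤ j then G z else 0) =
      ∑ z ∈ Icc 1 j, G z := by
    intro j hj
    rw [Finset.mem_range] at hj
    rw [← Finset.sum_filter]
    congr 1
    ext z
    rw [mem_filter, mem_Icc, mem_Icc]
    omega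
  rw [Finset.sum_congr rfl hterm, Finset.sum_sub_distrib, ← Finset.mul_sum, Finset.sum_comm]
  simp only [← Finset.mul_sum]
  have hswap : ∑ j ∈ range X, (((Real.log (j + 1 : ℕ) - Real.log j : ℝ)) : ℂ) *
      ∑ z ∈ Icc 1 X, (if z ≤ j then G z else 0) =
      ∑ j ∈ range X, (((Real.log (j + 1 : ℕ) - Real.log j : ℝ)) : ℂ) *
        ∑ z ∈ Icc 1 j, G z :=
    Finset.sum_congr rfl fun j hj => by rw [hball j hj]
  rw [hswap]
  have hlogX : 0 ≤ Real.log X := Real.log_natCast_nonneg X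
  -- For j = 0 the increment is log 1 - log 0 = 0, with `Real.log 0 = 0`.
  have hmono : ∀ j : ℕ, 0 ≤ Real.log (j + 1 : ℕ) - Real.log j := by
    intro j
    rcases Nat.eq_zero_or_pos j with rfl | hj
    · simp
    · exact sub_nonneg.2 (Real.log_le_log (by exact_mod_cast hj) (by push_cast; linarith))
  refine (norm_sub_le _ _).trans ?_
  have h1 : ‖(Real.log X : ℂ) * ∑ z ∈ Icc 1 X, G z‖ ≤ Real.log X * Q := by
    rw [norm_mul, Complex.norm_real, Real.norm_of_nonneg hlogX]
    exact mul_le_mul_of_nonneg_left (hQ X le_rfl) hlogX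
  have h2 : ‖∑ j ∈ range X, (((Real.log (j + 1 : ℕ) - Real.log j : ℝ)) : ℂ) *
      ∑ z ∈ Icc 1 j, G z‖ ≤ Real.log X * Q := by
    calc _ ≤ ∑ j ∈ range X, (Real.log (j + 1 : ℕ) - Real.log j) * Q := by
          refine norm_sum_le_of_le _ fun j hj => ?_
          rw [Finset.mem_range] at hj
          rw [norm_mul, Complex.norm_real, Real.norm_of_nonneg (hmono j)]
          exact mul_le_mul_of_nonneg_left (hQ j hj.le) (hmono j)
      _ = _ := by
          rw [← Finset.sum_mul, Finset.range_eq_Ico, sum_Ico_log_sub _ _ (Nat.zero_le X)]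
          simp
  linarith

/-! ### Vaughan's identity -/

theorem sum_Icc_arithmeticFunction_mul (f g : ArithmeticFunction ℝ) (S : ℕ → ℂ) (X : ℕ) :
    ∑ n ∈ Icc 1 X, ((f * g) n : ℂ) * S n =
      ∑ a ∈ Icc 1 X, (f a : ℂ) * ∑ b ∈ Icc 1 (X / a), (g b : ℂ) * S (a * b) := by
  have h1 : ∀ n ∈ Icc 1 X, ((f * g) n : ℂ) * S n =
      ∑ p ∈ (Icc 1 X ×ˢ Icc 1 X) with p.1 * p.2 = n, (f p.1 : ℂ) * ((g p.2 : ℂ) * S (p.1 * p.2)) := by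
    intro n hn
    rw [mem_Icc] at hn
    have hset : ((Icc 1 X ×ˢ Icc 1 X).filter fun p : ℕ × ℕ => p.1 * p.2 = n) =
        n.divisorsAntidiagonal := by
      ext p
      rw [mem_filter, mem_product, mem_Icc, mem_Icc, Nat.mem_divisorsAntidiagonal]
      constructor
      · rintro ⟨_, h⟩; exact ⟨h, by omega⟩
      · rintro ⟨h, _⟩
        have h1 : p.1 ≠ 0 := by intro h0; rw [h0] at h; omega
        have h2 : p.2 ≠ 0 := by intro h0; rw [h0] at h; omega
        have h3 : p.1 ≤ p.1 * p.2 := Nat.le_mul_of_pos_right _ (by omega)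
        have h4 : p.2 ≤ p.1 * p.2 := Nat.le_mul_of_pos_left _ (by omega)
        exact ⟨⟨by omega, by omega⟩, h⟩
    rw [hset, ArithmeticFunction.mul_apply]
    push_cast
    rw [Finset.sum_mul]
    refine Finset.sum_congr rfl fun p hp => ?_
    rw [(Nat.mem_divisorsAntidiagonal.1 hp).1]
    ring
  have h2 : ∀ a ∈ Icc 1 X, (f a : ℂ) * ∑ b ∈ Icc 1 (X / a), (g b : ℂ) * S (a * b) =
      ∑ b ∈ Icc 1 X, if a * b ≤ X then (f a : ℂ) * ((g b : ℂ) * S (a * b)) else 0 := by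
    intro a ha
    rw [mem_Icc] at ha
    rw [← Finset.sum_filter, Finset.mul_sum]
    refine Finset.sum_congr ?_ fun _ _ => rfl
    ext b
    rw [mem_filter, mem_Icc, mem_Icc, Nat.le_div_iff_mul_le (by omega), mul_comm b a]
    constructor
    · rintro ⟨h1, h2⟩
      have : b ≤ a * b := Nat.le_mul_of_pos_left _ (by omega)
      exact ⟨⟨h1, by omega⟩, h2⟩
    · rintro ⟨h1, h2⟩; exact ⟨h1.1, h2⟩
  rw [Finset.sum_congr rfl h1, Finset.sum_congr rfl h2, ← Finset.sum_product',
    ← Finset.sum_filter]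
  rw [← Finset.sum_fiberwise_of_maps_to (s := (Icc 1 X ×ˢ Icc 1 X).filter
    fun p : ℕ × ℕ => p.1 * p.2 ≤ X) (t := Icc 1 X) (g := fun p => p.1 * p.2)]
  · refine Finset.sum_congr rfl fun n hn => ?_
    rw [mem_Icc] at hn
    refine Finset.sum_congr ?_ fun _ _ => rfl
    ext p
    simp only [mem_filter]
    constructor
    · rintro ⟨h1, h2⟩; exact ⟨⟨h1, by omega⟩, h2⟩
    · rintro ⟨⟨h1, _⟩, h2⟩; exact ⟨h1, h2⟩
  · intro p hp
    rw [mem_filter, mem_product, mem_Icc, mem_Icc] at hp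
    rw [mem_Icc]
    exact ⟨Nat.mul_pos (by omega) (by omega), hp.2⟩

/-- The part of an arithmetic function supported on `n ≤ U`. -/
def lowPart (U : ℕ) (f : ArithmeticFunction ℝ) : ArithmeticFunction ℝ :=
  ⟨fun n => if n ≤ U then f n else 0, by simp⟩

theorem lowPart_apply (U : ℕ) (f : ArithmeticFunction ℝ) (n : ℕ) :
    lowPart U f n = if n ≤ U then f n else 0 := rfl

theorem highPart_apply (U : ℕ) (f : ArithmeticFunction ℝ) (n : ℕ) :
    (f - lowPart U f) n = if n ≤ U then 0 else f n := by
  have : (f - lowPart U f) n = f n - lowPart U f n := by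
    rw [sub_eq_add_neg, ArithmeticFunction.add_apply]
    rfl
  rw [this, lowPart_apply]
  split_ifs <;> simp

open ArithmeticFunction in
-- Expand the last product and use μ * ζ = 1 and Λ * ζ = log.
theorem vaughan_identity (U : ℕ) :
    vonMangoldt = lowPart U vonMangoldt + lowPart U (moebius : ArithmeticFunction ℝ) * log
      - lowPart U (moebius : ArithmeticFunction ℝ) * lowPart U vonMangoldt * (zeta : ArithmeticFunction ℝ)
      + ((moebius : ArithmeticFunction ℝ) - lowPart U (moebius : ArithmeticFunction ℝ))
        * (zeta : ArithmeticFunction ℝ) * (vonMangoldt - lowPart U vonMangoldt) := by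
  have h1 : (moebius : ArithmeticFunction ℝ) * (zeta : ArithmeticFunction ℝ) = 1 :=
    coe_moebius_mul_coe_zeta
  have h2 : vonMangoldt * (zeta : ArithmeticFunction ℝ) = log := vonMangoldt_mul_zeta
  linear_combination (-1 : ArithmeticFunction ℝ) * (vonMangoldt - lowPart U vonMangoldt) * h1 +
    lowPart U (moebius : ArithmeticFunction ℝ) * h2

theorem abs_moebius_real_le (n : ℕ) :
    |((ArithmeticFunction.moebius : ArithmeticFunction ℝ) n)| ≤ 1 := by
  rw [ArithmeticFunction.intCoe_apply]
  exact_mod_cast ArithmeticFunction.abs_moebius_le_one (n := n)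

theorem abs_lowPart_moebius_le (U n : ℕ) :
    |lowPart U (ArithmeticFunction.moebius : ArithmeticFunction ℝ) n| ≤ 1 := by
  rw [lowPart_apply]
  split_ifs
  · exact abs_moebius_real_le n
  · simp

/-- The convolution is dominated termwise by that of 1 and Λ, which is log. -/
theorem abs_lowPart_mul_lowPart_le (U n : ℕ) :
    |(lowPart U (ArithmeticFunction.moebius : ArithmeticFunction ℝ) *
      lowPart U ArithmeticFunction.vonMangoldt) n| ≤ Real.log n := by
  rw [ArithmeticFunction.mul_apply, ← ArithmeticFunction.vonMangoldt_sum]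
  refine (Finset.abs_sum_le_sum_abs _ _).trans ?_
  rw [← Nat.map_div_left_divisors, Finset.sum_map]
  refine Finset.sum_le_sum fun i _ => ?_
  simp only [abs_mul]
  have h1 := abs_lowPart_moebius_le U (n / i)
  have h2 : |lowPart U ArithmeticFunction.vonMangoldt i| ≤ ArithmeticFunction.vonMangoldt i := by
    rw [lowPart_apply]
    split_ifs
    · rw [abs_of_nonneg ArithmeticFunction.vonMangoldt_nonneg]
    · simp [ArithmeticFunction.vonMangoldt_nonneg]
  calc _ ≤ 1 * ArithmeticFunction.vonMangoldt i :=
        mul_le_mul h1 h2 (abs_nonneg _) zero_le_one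
    _ = _ := one_mul _

theorem lowPart_mul_lowPart_eq_zero {U n : ℕ} (f g : ArithmeticFunction ℝ) (hn : U * U < n) :
    (lowPart U f * lowPart U g) n = 0 := by
  rw [ArithmeticFunction.mul_apply]
  refine Finset.sum_eq_zero fun p hp => ?_
  have h := (Nat.mem_divisorsAntidiagonal.1 hp).1
  rw [lowPart_apply, lowPart_apply]
  split_ifs with h1 h2
  · exfalso
    have := Nat.mul_le_mul h1 h2
    omega
  all_goals simp

theorem abs_highPart_mul_zeta_le (U n : ℕ) :
    |(((ArithmeticFunction.moebius : ArithmeticFunction ℝ) -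
      lowPart U (ArithmeticFunction.moebius : ArithmeticFunction ℝ)) *
        (ArithmeticFunction.zeta : ArithmeticFunction ℝ)) n| ≤ #n.divisors := by
  rw [ArithmeticFunction.mul_apply]
  refine (Finset.abs_sum_le_sum_abs _ _).trans ?_
  have h : #n.divisors = #n.divisorsAntidiagonal := by
    rw [← Nat.map_div_left_divisors, Finset.card_map]
  rw [h, Finset.card_eq_sum_ones, Nat.cast_sum]
  refine Finset.sum_le_sum fun p _ => ?_
  rw [abs_mul, highPart_apply]
  have h1 : |if p.1 ≤ U then (0 : ℝ) else (ArithmeticFunction.moebius : ArithmeticFunction ℝ) p.1| ≤ 1 := by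
    split_ifs
    · simp
    · exact abs_moebius_real_le _
  have h2 : |(ArithmeticFunction.zeta : ArithmeticFunction ℝ) p.2| ≤ 1 := by
    rw [ArithmeticFunction.natCoe_apply, ArithmeticFunction.zeta_apply]
    split_ifs <;> simp
  rw [Nat.cast_one]
  exact mul_le_one₀ h1 (abs_nonneg _) h2

theorem highPart_mul_zeta_eq_zero {U n : ℕ} (hn : n ≤ U) :
    (((ArithmeticFunction.moebius : ArithmeticFunction ℝ) -
      lowPart U (ArithmeticFunction.moebius : ArithmeticFunction ℝ)) *
        (ArithmeticFunction.zeta : ArithmeticFunction ℝ)) n = 0 := by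
  rw [ArithmeticFunction.mul_apply]
  refine Finset.sum_eq_zero fun p hp => ?_
  have h := Nat.mem_divisorsAntidiagonal.1 hp
  have h1 : p.1 ≤ n := Nat.le_of_dvd (Nat.pos_of_ne_zero h.2) ⟨p.2, h.1.symm⟩
  rw [highPart_apply, if_pos (h1.trans hn), zero_mul]

/-! ### Sums over primes from type I and type II information -/

theorem norm_sum_Icc_le_of_support {X V : ℕ} (f : ℕ → ℂ) {K : ℝ} (hK : 0 ≤ K)
    (h : ∀ a ∈ Icc 1 X, a ≤ V → ‖f a‖ ≤ K) (h0 : ∀ a ∈ Icc 1 X, V < a → f a = 0) :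
    ‖∑ a ∈ Icc 1 X, f a‖ ≤ V * K := by
  have h1 : ∑ a ∈ Icc 1 X, f a = ∑ a ∈ Icc 1 X with a ≤ V, f a := by
    rw [Finset.sum_filter]
    refine Finset.sum_congr rfl fun a ha => ?_
    split_ifs with h2
    · rfl
    · exact h0 a ha (by omega)
  rw [h1]
  refine (norm_sum_le_of_le (f := f) (n := fun _ => K) _ fun a ha => ?_).trans ?_
  · rw [mem_filter] at ha
    exact h a ha.1 ha.2
  · rw [Finset.sum_const, nsmul_eq_mul]
    refine mul_le_mul_of_nonneg_right ?_ hK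
    have : (Icc 1 X).filter (fun a => a ≤ V) ⊆ Icc 1 V := by
      intro a ha
      rw [mem_filter, mem_Icc] at ha
      rw [mem_Icc]; omega
    have := card_le_card this
    rw [Nat.card_Icc, Nat.add_sub_cancel] at this
    exact_mod_cast this

/-- The Vaughan coefficients are bounded only on [1, X]; they are cut off there before being
normalized to 1. -/
theorem bilinear_scale (S : ℕ → ℂ) {X U : ℕ} {B : ℝ}
    (hB : ∀ α β : ℕ → ℂ, (∀ n, ‖α n‖ ≤ 1) → (∀ n, ‖β n‖ ≤ 1) → (∀ n ≤ U, α n = 0) →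
      (∀ n ≤ U, β n = 0) → ‖∑ a ∈ Icc 1 X, α a * ∑ b ∈ Icc 1 (X / a), β b * S (a * b)‖ ≤ B)
    (α β : ℕ → ℂ) {K₁ K₂ : ℝ} (hK₁ : 0 < K₁) (hK₂ : 0 < K₂) (hα : ∀ n ∈ Icc 1 X, ‖α n‖ ≤ K₁)
    (hβ : ∀ n ∈ Icc 1 X, ‖β n‖ ≤ K₂) (hα0 : ∀ n ≤ U, α n = 0) (hβ0 : ∀ n ≤ U, β n = 0) :
    ‖∑ a ∈ Icc 1 X, α a * ∑ b ∈ Icc 1 (X / a), β b * S (a * b)‖ ≤ K₁ * K₂ * B := by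
  have hnorm : ∀ (γ : ℕ → ℂ) (K : ℝ), 0 < K → (∀ n ∈ Icc 1 X, ‖γ n‖ ≤ K) →
      ∀ n, ‖if n ∈ Icc 1 X then γ n / K else 0‖ ≤ 1 := by
    intro γ K hK hγ n
    split_ifs with h
    · rw [norm_div, Complex.norm_real, Real.norm_of_nonneg hK.le, div_le_one hK]
      exact hγ n h
    · simp
  have h := hB (fun n => if n ∈ Icc 1 X then α n / K₁ else 0)
    (fun n => if n ∈ Icc 1 X then β n / K₂ else 0) (hnorm α K₁ hK₁ hα) (hnorm β K₂ hK₂ hβ)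
    (fun n hn => by simp [hα0 n hn]) (fun n hn => by simp [hβ0 n hn])
  have hK₁' : (K₁ : ℂ) ≠ 0 := by exact_mod_cast hK₁.ne'
  have hK₂' : (K₂ : ℂ) ≠ 0 := by exact_mod_cast hK₂.ne'
  have heq : ∑ a ∈ Icc 1 X, α a * ∑ b ∈ Icc 1 (X / a), β b * S (a * b) =
      ((K₁ * K₂ : ℝ) : ℂ) * ∑ a ∈ Icc 1 X, (if a ∈ Icc 1 X then α a / K₁ else 0) *
        ∑ b ∈ Icc 1 (X / a), (if b ∈ Icc 1 X then β b / K₂ else 0) * S (a * b) := by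
    rw [Finset.mul_sum]
    refine Finset.sum_congr rfl fun a ha => ?_
    rw [if_pos ha, Finset.mul_sum, Finset.mul_sum, Finset.mul_sum]
    refine Finset.sum_congr rfl fun b hb => ?_
    have hb' : b ∈ Icc 1 X := by
      rw [mem_Icc] at hb ⊢
      exact ⟨hb.1, hb.2.trans (Nat.div_le_self _ _)⟩
    rw [if_pos hb']
    push_cast
    field_simp
  rw [heq, norm_mul, Complex.norm_real, Real.norm_of_nonneg (by positivity)]
  exact mul_le_mul_of_nonneg_left h (by positivity)

open ArithmeticFunction in
-- The four Vaughan terms: the short sum is trivial, the term with log is of type I after removing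
-- the logarithm, and the last is of type II with one coefficient bounded by the divisor function.
-- The remaining term μ' * Λ' * ζ is mixed.
theorem norm_sum_vonMangoldt_mul_le (S : ℕ → ℂ) {X U : ℕ} {T B₁ B₂ L τ : ℝ}
    (hL : 1 ≤ L) (hlog : Real.log X ≤ L) (hτ1 : 1 ≤ τ)
    (hτ : ∀ n ∈ Icc 1 X, (#n.divisors : ℝ) ≤ τ) (hT0 : 0 ≤ T) (hT : ∀ n ∈ Icc 1 X, ‖S n‖ ≤ T)
    (hB₁ : 0 ≤ B₁) (hI : ∀ a ∈ Icc 1 U, ∀ Y, a * Y ≤ X → ‖∑ m ∈ Icc 1 Y, S (a * m)‖ ≤ B₁)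
    (hII : ∀ α β : ℕ → ℂ, (∀ n, ‖α n‖ ≤ 1) → (∀ n, ‖β n‖ ≤ 1) → (∀ n ≤ U, α n = 0) →
      (∀ n ≤ U, β n = 0) → ‖∑ a ∈ Icc 1 X, α a * ∑ b ∈ Icc 1 (X / a), β b * S (a * b)‖ ≤ B₂) :
    ‖∑ n ∈ Icc 1 X, (vonMangoldt n : ℂ) * S n‖ ≤
      U * (L * T) + U * (2 * L * B₁) + L * (U * B₁ + U ^ 3 * T + B₂) + τ * L * B₂ := by
  have hL0 : 0 < L := by linarith
  have hlogn : ∀ n ∈ Icc 1 X, Real.log n ≤ L := by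
    intro n hn
    rw [mem_Icc] at hn
    refine le_trans (Real.log_le_log ?_ ?_) hlog
    · exact_mod_cast hn.1
    · exact_mod_cast hn.2
  have hΛ : ∀ n ∈ Icc 1 X, ‖(vonMangoldt n : ℂ)‖ ≤ L := by
    intro n hn
    rw [Complex.norm_real, Real.norm_of_nonneg vonMangoldt_nonneg]
    exact vonMangoldt_le_log.trans (hlogn n hn)
  set μ' := lowPart U (moebius : ArithmeticFunction ℝ) with hμ'
  set Λ' := lowPart U vonMangoldt with hΛ'
  set M := ((moebius : ArithmeticFunction ℝ) - μ') * (zeta : ArithmeticFunction ℝ) with hM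
  set N := vonMangoldt - Λ' with hN
  set h := μ' * Λ' with hh
  have hsum : ∑ n ∈ Icc 1 X, (vonMangoldt n : ℂ) * S n =
      ∑ n ∈ Icc 1 X, (Λ' n : ℂ) * S n + ∑ n ∈ Icc 1 X, ((μ' * log) n : ℂ) * S n -
        ∑ n ∈ Icc 1 X, ((h * (zeta : ArithmeticFunction ℝ)) n : ℂ) * S n +
        ∑ n ∈ Icc 1 X, ((M * N) n : ℂ) * S n := by
    rw [← Finset.sum_add_distrib, ← Finset.sum_sub_distrib, ← Finset.sum_add_distrib]
    refine Finset.sum_congr rfl fun n _ => ?_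
    have h1 := congrArg (fun f : ArithmeticFunction ℝ => f n) (vaughan_identity U)
    simp only [sub_eq_add_neg, ArithmeticFunction.add_apply] at h1
    have h2 : (-(lowPart U (moebius : ArithmeticFunction ℝ) * lowPart U vonMangoldt *
        (zeta : ArithmeticFunction ℝ))) n = -((h * (zeta : ArithmeticFunction ℝ)) n) := rfl
    rw [h2] at h1
    have h3 : vonMangoldt n = Λ' n + (μ' * log) n - (h * (zeta : ArithmeticFunction ℝ)) n +
        (M * N) n := by
      rw [sub_eq_add_neg, h1]
      simp only [hM, hN, sub_eq_add_neg]
      rfl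
    rw [h3]; push_cast; ring
  have hT₀ : ‖∑ n ∈ Icc 1 X, (Λ' n : ℂ) * S n‖ ≤ U * (L * T) := by
    refine norm_sum_Icc_le_of_support _ (by positivity) ?_ ?_
    · intro a ha haU
      rw [hΛ', lowPart_apply, if_pos haU, norm_mul]
      exact mul_le_mul (hΛ a ha) (hT a ha) (norm_nonneg _) hL0.le
    · intro a _ haU
      rw [hΛ', lowPart_apply, if_neg (by omega)]; simp
  have hT₁ : ‖∑ n ∈ Icc 1 X, ((μ' * log) n : ℂ) * S n‖ ≤ U * (2 * L * B₁) := by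
    rw [sum_Icc_arithmeticFunction_mul]
    refine norm_sum_Icc_le_of_support _ (by positivity) ?_ ?_
    · intro a ha haU
      rw [mem_Icc] at ha
      have h1 : ‖(μ' a : ℂ)‖ ≤ 1 := by
        rw [Complex.norm_real]; exact abs_lowPart_moebius_le U a
      have h2 := norm_sum_log_mul_le (fun m => S (a * m)) (X := X / a) (Q := B₁)
        fun n hn => hI a (mem_Icc.2 ⟨ha.1, haU⟩) n
          ((Nat.mul_le_mul_left a hn).trans (Nat.mul_div_le X a))
      have h3 : Real.log (X / a : ℕ) ≤ L := by
        rcases Nat.eq_zero_or_pos (X / a) with h0 | h0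
        · rw [h0]; simpa using hL0.le
        · exact hlogn _ (mem_Icc.2 ⟨h0, Nat.div_le_self _ _⟩)
      rw [norm_mul]
      calc _ ≤ 1 * (B₁ * (2 * Real.log (X / a : ℕ))) :=
            mul_le_mul h1 h2 (norm_nonneg _) zero_le_one
        _ ≤ 1 * (B₁ * (2 * L)) := by gcongr
        _ = _ := by ring
    · intro a _ haU
      rw [hμ', lowPart_apply, if_neg (by omega)]; simp
  have hhL : ∀ n ∈ Icc 1 X, ‖(h n : ℂ)‖ ≤ L := by
    intro n hn
    rw [Complex.norm_real]
    exact (abs_lowPart_mul_lowPart_le U n).trans (hlogn n hn)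
  have hT₂ : ‖∑ n ∈ Icc 1 X, ((h * (zeta : ArithmeticFunction ℝ)) n : ℂ) * S n‖ ≤
      L * (U * B₁ + U ^ 3 * T + B₂) := by
    rw [sum_Icc_arithmeticFunction_mul]
    -- For a ≤ U this is type I. For a > U and b ≤ U the support a ≤ U² leaves at most U³ terms,
    -- bounded trivially. For a, b > U it is type II. So type I is needed only up to U, not U².
    have hz : ∀ a ∈ Icc 1 X, (h a : ℂ) * ∑ b ∈ Icc 1 (X / a),
        ((zeta : ArithmeticFunction ℝ) b : ℂ) * S (a * b) =
        (if a ≤ U then (h a : ℂ) * ∑ b ∈ Icc 1 (X / a), S (a * b) else 0) +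
        (if a ≤ U then 0 else (h a : ℂ)) *
          ∑ b ∈ Icc 1 (X / a), (if b ≤ U then 1 else 0) * S (a * b) +
        (if a ≤ U then 0 else (h a : ℂ)) *
          ∑ b ∈ Icc 1 (X / a), (if b ≤ U then 0 else 1) * S (a * b) := by
      intro a _
      have h1 : ∑ b ∈ Icc 1 (X / a), ((zeta : ArithmeticFunction ℝ) b : ℂ) * S (a * b) =
          ∑ b ∈ Icc 1 (X / a), S (a * b) := by
        refine Finset.sum_congr rfl fun b hb => ?_
        rw [mem_Icc] at hb
        rw [natCoe_apply, zeta_apply, if_neg (by omega)]; simp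
      have h2 : ∑ b ∈ Icc 1 (X / a), S (a * b) =
          ∑ b ∈ Icc 1 (X / a), (if b ≤ U then 1 else 0) * S (a * b) +
          ∑ b ∈ Icc 1 (X / a), (if b ≤ U then 0 else 1) * S (a * b) := by
        rw [← Finset.sum_add_distrib]
        refine Finset.sum_congr rfl fun b _ => ?_
        split_ifs <;> ring
      rw [h1]
      split_ifs with haU
      · ring
      · rw [h2]; ring
    rw [Finset.sum_congr rfl hz, Finset.sum_add_distrib, Finset.sum_add_distrib]
    have hA : ‖∑ a ∈ Icc 1 X, (if a ≤ U then (h a : ℂ) * ∑ b ∈ Icc 1 (X / a), S (a * b) else 0)‖ ≤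
        U * (L * B₁) := by
      refine norm_sum_Icc_le_of_support _ (by positivity) ?_ ?_
      · intro a ha haU
        rw [if_pos haU, norm_mul]
        refine mul_le_mul (hhL a ha) (hI a ?_ _ (Nat.mul_div_le X a)) (norm_nonneg _) hL0.le
        rw [mem_Icc] at ha ⊢
        exact ⟨ha.1, haU⟩
      · intro a _ haU
        rw [if_neg (by omega)]
    have hB : ‖∑ a ∈ Icc 1 X, (if a ≤ U then 0 else (h a : ℂ)) *
          ∑ b ∈ Icc 1 (X / a), (if b ≤ U then 1 else 0) * S (a * b)‖ ≤
        (U * U : ℕ) * (L * (U * T)) := by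
      refine norm_sum_Icc_le_of_support _ (by positivity) ?_ ?_
      · intro a ha _
        rw [norm_mul]
        refine mul_le_mul ?_ ?_ (norm_nonneg _) hL0.le
        · split_ifs
          · simpa using hL0.le
          · exact hhL a ha
        · refine norm_sum_Icc_le_of_support _ hT0 ?_ ?_
          · intro b hb hbU
            rw [if_pos hbU, one_mul]
            rw [mem_Icc] at ha hb
            refine hT _ (mem_Icc.2 ⟨Nat.mul_pos ha.1 hb.1, ?_⟩)
            exact (Nat.mul_le_mul_left a hb.2).trans (Nat.mul_div_le X a)
          · intro b _ hbU
            rw [if_neg (by omega), zero_mul]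
      · intro a _ haU
        rw [hh, hμ', hΛ', lowPart_mul_lowPart_eq_zero _ _ haU]; simp
    have hC := bilinear_scale S hII (fun a => if a ≤ U then 0 else (h a : ℂ))
      (fun b => if b ≤ U then 0 else 1) hL0 one_pos
      (fun n hn => by
        show ‖if n ≤ U then 0 else (h n : ℂ)‖ ≤ L
        split_ifs
        · simpa using hL0.le
        · exact hhL n hn)
      (fun n _ => by
        show ‖if n ≤ U then (0 : ℂ) else 1‖ ≤ 1
        split_ifs <;> simp)
      (fun n hn => if_pos hn) (fun n hn => if_pos hn)
    refine (norm_add₃_le).trans ((add_le_add (add_le_add hA hB) hC).trans (le_of_eq ?_))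
    push_cast; ring
  have hT₃ : ‖∑ n ∈ Icc 1 X, ((M * N) n : ℂ) * S n‖ ≤ τ * L * B₂ := by
    rw [sum_Icc_arithmeticFunction_mul]
    refine bilinear_scale S hII (fun a => (M a : ℂ)) (fun b => (N b : ℂ)) (by linarith) hL0
      ?_ ?_ ?_ ?_
    · intro n hn
      rw [Complex.norm_real]
      exact (abs_highPart_mul_zeta_le U n).trans (hτ n hn)
    · intro n hn
      rw [hN, hΛ', highPart_apply]
      split_ifs
      · simpa using hL0.le
      · exact hΛ n hn
    · intro n hn
      rw [hM, hμ', highPart_mul_zeta_eq_zero hn]; simp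
    · intro n hn
      rw [hN, hΛ', highPart_apply, if_pos hn]; simp
  rw [hsum]
  refine (norm_add_le _ _).trans (add_le_add ((norm_sub_le _ _).trans
    (add_le_add ((norm_add_le _ _).trans (add_le_add hT₀ hT₁)) hT₂)) hT₃)

/-! ### Factorization of sums over primary numbers -/

/-- The primary Gaussian integers of norm `n`. -/
def primarySphere (n : ℕ) : Finset GaussianInt := (finite_primary_norm_eq n).toFinset

theorem mem_primarySphere {n : ℕ} {z : GaussianInt} :
    z ∈ primarySphere n ↔ IsPrimary z ∧ gnorm z = n := by
  rw [primarySphere, Set.Finite.mem_toFinset, Set.mem_ofPred_eq, mul_star_eq_gnorm, Nat.cast_inj]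

theorem IsPrimary.of_mul {w z : GaussianInt} (hw : IsPrimary w) (h : IsPrimary (w * z)) :
    IsPrimary z := by
  unfold IsPrimary at *
  have : z - 1 = (w * z - 1) - (w - 1) * z := by ring
  rw [this]
  exact dvd_sub h (hw.mul_right z)

/-- Once imprimitive numbers are discarded, multiplication is a bijection from pairs of norms (a, b)
onto numbers of norm ab, by `existsUnique_primary_dvd`. -/
theorem sum_primarySphere_mul (F : GaussianInt → ℂ)
    (hF : ∀ z, IsPrimary z → ¬ IsPrimitive z → F z = 0) (a b : ℕ) :
    ∑ Z ∈ primarySphere (a * b), F Z =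
      ∑ w ∈ primarySphere a, ∑ z ∈ primarySphere b, F (w * z) := by
  classical
  rw [← Finset.sum_product']
  have h1 : ∑ Z ∈ primarySphere (a * b), F Z =
      ∑ Z ∈ primarySphere (a * b) with IsPrimitive Z, F Z := by
    rw [Finset.sum_filter]
    refine Finset.sum_congr rfl fun Z hZ => ?_
    split_ifs with h
    · rfl
    · exact hF Z (mem_primarySphere.1 hZ).1 h
  have h2 : ∑ p ∈ primarySphere a ×ˢ primarySphere b, F (p.1 * p.2) =
      ∑ p ∈ (primarySphere a ×ˢ primarySphere b) with IsPrimitive (p.1 * p.2), F (p.1 * p.2) := by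
    rw [Finset.sum_filter]
    refine Finset.sum_congr rfl fun p hp => ?_
    rw [mem_product, mem_primarySphere, mem_primarySphere] at hp
    split_ifs with h
    · rfl
    · exact hF _ (hp.1.1.mul hp.2.1) h
  rw [h1, h2]
  symm
  refine Finset.sum_bij (fun p _ => p.1 * p.2) ?_ ?_ ?_ ?_
  · intro p hp
    rw [mem_filter, mem_product, mem_primarySphere, mem_primarySphere] at hp
    rw [mem_filter, mem_primarySphere, gnorm_mul, hp.1.1.2, hp.1.2.2]
    exact ⟨⟨hp.1.1.1.mul hp.1.2.1, rfl⟩, hp.2⟩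
  · intro p hp p' hp' h
    rw [mem_filter, mem_product, mem_primarySphere, mem_primarySphere] at hp hp'
    have hprim := hp.1.1.1.mul hp.1.2.1
    have hdvd : a ∣ gnorm (p.1 * p.2) := ⟨gnorm p.2, by rw [gnorm_mul, hp.1.1.2]⟩
    have h3 : p.1 = p'.1 := (existsUnique_primary_dvd hprim hp.2 hdvd).unique
      ⟨⟨hp.1.1.1, dvd_mul_right _ _⟩, hp.1.1.2⟩
      ⟨⟨hp'.1.1.1, by rw [h]; exact dvd_mul_right _ _⟩, hp'.1.1.2⟩
    rw [h3] at h
    exact Prod.ext h3 (mul_left_cancel₀ hp'.1.1.1.ne_zero h)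
  · intro Z hZ
    rw [mem_filter, mem_primarySphere] at hZ
    obtain ⟨⟨hZp, hZn⟩, hZq⟩ := hZ
    obtain ⟨w, ⟨⟨hwp, z, rfl⟩, hwn⟩, -⟩ :=
      existsUnique_primary_dvd hZp hZq (a := a) ⟨b, hZn⟩
    refine ⟨(w, z), ?_, rfl⟩
    rw [mem_filter, mem_product, mem_primarySphere, mem_primarySphere]
    refine ⟨⟨⟨hwp, hwn⟩, hwp.of_mul hZp, ?_⟩, hZq⟩
    rw [gnorm_mul, hwn] at hZn
    exact Nat.eq_of_mul_eq_mul_left (hwn ▸ gnorm_pos hwp.ne_zero) hZn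
  · intro p _; rfl

theorem sum_primaryBall_eq (H : GaussianInt → ℂ) (X : ℕ) :
    ∑ z ∈ primaryBall X, H z = ∑ n ∈ Icc 1 X, ∑ z ∈ primarySphere n, H z := by
  classical
  rw [← Finset.sum_fiberwise_of_maps_to (s := primaryBall X) (t := Icc 1 X) (g := gnorm)]
  · refine Finset.sum_congr rfl fun n hn => ?_
    rw [mem_Icc] at hn
    refine Finset.sum_congr ?_ fun _ _ => rfl
    ext z
    rw [mem_filter, mem_primaryBall, mem_primarySphere]
    constructor
    · rintro ⟨⟨h1, _⟩, h2⟩; exact ⟨h1, h2⟩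
    · rintro ⟨h1, h2⟩; exact ⟨⟨h1, by omega⟩, h2⟩
  · intro z hz
    rw [mem_primaryBall] at hz
    exact mem_Icc.2 ⟨gnorm_pos hz.1.ne_zero, hz.2⟩

theorem grossenchar_mul_jacobiKubota_eq_zero {d : ℕ} (χ : ResidueChar d) (k : ℤ) {z : GaussianInt}
    (hz : IsPrimary z) (h : ¬ IsPrimitive z) : grossenchar χ k z * jacobiKubota z = 0 := by
  rw [jacobiKubota_eq_zero hz.re_ne_zero h, mul_zero]

theorem eigenvalue_mul {d : ℕ} (χ : ResidueChar d) (k : ℤ) (a b : ℕ) :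
    eigenvalue χ k (a * b) = ∑ w ∈ primarySphere a, ∑ z ∈ primarySphere b,
      grossenchar χ k w * (grossenchar χ k z * jacobiKubota (w * z)) := by
  have h := sum_primarySphere_mul (fun z => grossenchar χ k z * jacobiKubota z)
    (fun z hz hp => grossenchar_mul_jacobiKubota_eq_zero χ k hz hp) a b
  refine h.trans (Finset.sum_congr rfl fun w _ => Finset.sum_congr rfl fun z _ => ?_)
  rw [grossenchar_mul]; ring

/-- The factor w of norm c is kept outside, so that the type II estimate can be applied for each
fixed w. -/
theorem eigenvalue_mul_mul {d : ℕ} (χ : ResidueChar d) (k : ℤ) (c a b : ℕ) :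
    eigenvalue χ k (c * (a * b)) = ∑ w ∈ primarySphere c, grossenchar χ k w *
      ∑ z ∈ primarySphere a, ∑ t ∈ primarySphere b,
        grossenchar χ k z * grossenchar χ k t * jacobiKubota (w * z * t) := by
  rw [eigenvalue_mul]
  refine Finset.sum_congr rfl fun w hw => ?_
  have hwp := (mem_primarySphere.1 hw).1
  rw [← Finset.mul_sum]
  congr 1
  rw [sum_primarySphere_mul (fun z => grossenchar χ k z * jacobiKubota (w * z))]
  · refine Finset.sum_congr rfl fun z _ => Finset.sum_congr rfl fun t _ => ?_
    rw [grossenchar_mul, mul_assoc w z t]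
  · intro z hz hp
    rw [jacobiKubota_eq_zero (hwp.mul hz).re_ne_zero, mul_zero]
    exact fun h => hp (h.of_dvd (dvd_mul_left _ _))

theorem norm_eigenvalue_le {d : ℕ} (hd : 1 ≤ d) (χ : ResidueChar d) (k : ℤ) (n : ℕ) :
    ‖eigenvalue χ k n‖ ≤ #(primarySphere n) := by
  refine (norm_sum_le_of_le (n := fun _ => (1 : ℝ)) _ fun z hz => ?_).trans (le_of_eq ?_)
  · rw [norm_mul]
    exact mul_le_one₀ (norm_grossenchar_le hd χ k (mem_primarySphere.1 hz).1.ne_zero)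
      (norm_nonneg _) (norm_jacobiKubota_le _)
  · rw [Finset.sum_const, nsmul_eq_mul, mul_one]; rfl

/-! ### Type I and type II bounds for the eigenvalues -/

/-- Here W = wz collects the whole fixed factor of norm ca; there are O((ca)^η) such W. -/
theorem exists_sum_eigenvalue_le {η : ℝ} (hη : 0 < η) :
    ∃ C : ℝ, 1 ≤ C ∧ ∀ d : ℕ, 1 ≤ d → ∀ (χ : ResidueChar d) (k : ℤ) (c a Y : ℕ), 1 ≤ c → 1 ≤ a →
      ‖∑ m ∈ Icc 1 Y, eigenvalue χ k (c * (a * m))‖ ≤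
        C * ((c * a : ℕ) : ℝ) ^ η * (d * (c * a : ℕ) * (|(k : ℝ)| + 1)) * (Y : ℝ) ^ (3 / 4 + η) := by
  obtain ⟨C₁, hC₁, hI⟩ := exists_sum_grossenchar_jacobiKubota_le hη
  obtain ⟨C₂, hC₂, hcard⟩ := exists_card_gnorm_eq_le hη
  refine ⟨C₂ * C₁, one_le_mul_of_one_le_of_one_le hC₂ hC₁, fun d hd χ k c a Y hc ha => ?_⟩
  have hk0 := abs_nonneg (k : ℝ)
  rcases Nat.eq_zero_or_pos Y with rfl | hY
  · rw [Icc_eq_empty (by omega), sum_empty, norm_zero]; positivity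
  have heq : ∑ m ∈ Icc 1 Y, eigenvalue χ k (c * (a * m)) =
      ∑ W ∈ primarySphere (c * a), grossenchar χ k W *
        ∑ z ∈ primaryBall Y, grossenchar χ k z * jacobiKubota (W * z) := by
    simp only [← mul_assoc c a, eigenvalue_mul]
    rw [Finset.sum_comm]
    refine Finset.sum_congr rfl fun W _ => ?_
    rw [sum_primaryBall_eq, Finset.mul_sum]
    exact Finset.sum_congr rfl fun m _ => by rw [Finset.mul_sum]
  rw [heq]
  set B : ℝ := C₁ * (d * (c * a : ℕ) * (|(k : ℝ)| + 1)) * (Y : ℝ) ^ (3 / 4 + η) with hB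
  have hB0 : 0 ≤ B := by positivity
  calc _ ≤ ∑ W ∈ primarySphere (c * a), B := by
        refine norm_sum_le_of_le _ fun W hW => ?_
        rw [mem_primarySphere] at hW
        rw [norm_mul]
        have h1 := hI d hd χ k W Y hW.1 hY
        rw [hW.2] at h1
        calc _ ≤ 1 * B := mul_le_mul (norm_grossenchar_le hd χ k hW.1.ne_zero) h1
              (norm_nonneg _) zero_le_one
          _ = B := one_mul B
    _ = #(primarySphere (c * a)) * B := by rw [Finset.sum_const, nsmul_eq_mul]
    _ ≤ (C₂ * ((c * a : ℕ) : ℝ) ^ η) * B := by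
        refine mul_le_mul_of_nonneg_right (hcard (c * a) (Nat.mul_pos hc ha) _ ?_) hB0
        exact fun z hz => (mem_primarySphere.1 hz).2
    _ = _ := by rw [hB]; ring

theorem exists_bilinear_eigenvalue_le {η : ℝ} (hη : 0 < η) :
    ∃ C : ℝ, 1 ≤ C ∧ ∀ d : ℕ, 1 ≤ d → ∀ (χ : ResidueChar d) (k : ℤ) (c X : ℕ) (y : ℝ), 1 ≤ c →
      1 ≤ X → 1 ≤ y → ∀ α β : ℕ → ℂ, (∀ n, ‖α n‖ ≤ 1) → (∀ n, ‖β n‖ ≤ 1) →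
      (∀ n ≤ ⌊y⌋₊, α n = 0) → (∀ n ≤ ⌊y⌋₊, β n = 0) →
      ‖∑ a ∈ Icc 1 X, α a * ∑ b ∈ Icc 1 (X / a), β b * eigenvalue χ k (c * (a * b))‖ ≤
        C * (c : ℝ) ^ η * ((X : ℝ) ^ (1 + η) * y ^ (-(1 / 12) : ℝ)) := by
  obtain ⟨C₁, hC₁, hII⟩ := exists_bilinear_hyperbola_le hη
  obtain ⟨C₂, hC₂, hcard⟩ := exists_card_gnorm_eq_le hη
  refine ⟨C₂ * C₁, one_le_mul_of_one_le_of_one_le hC₂ hC₁,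
    fun d hd χ k c X y hc hX hy α β hα hβ hα0 hβ0 => ?_⟩
  have hy0 : 0 ≤ y := by linarith
  set a' : GaussianInt → ℂ := fun z => α (gnorm z) * grossenchar χ k z with ha'
  set b' : GaussianInt → ℂ := fun z => β (gnorm z) * grossenchar χ k z with hb'
  have hvan : ∀ γ : ℕ → ℂ, (∀ n ≤ ⌊y⌋₊, γ n = 0) → ∀ z, (gnorm z : ℝ) ≤ y →
      γ (gnorm z) * grossenchar χ k z = 0 := by
    intro γ hγ z hz
    rw [hγ _ (Nat.le_floor hz), zero_mul]
  have hbd : ∀ γ : ℕ → ℂ, (∀ n, ‖γ n‖ ≤ 1) → (∀ n ≤ ⌊y⌋₊, γ n = 0) → ∀ z,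
      ‖γ (gnorm z) * grossenchar χ k z‖ ≤ 1 := by
    intro γ hγ1 hγ z
    -- The character has no norm bound at 0, but there the coefficient is γ 0 = 0.
    by_cases hz : z = 0
    · rw [hvan γ hγ z, norm_zero]
      · exact zero_le_one
      · rw [hz]; simpa [gnorm] using hy0
    · rw [norm_mul]
      exact mul_le_one₀ (hγ1 _) (norm_nonneg _) (norm_grossenchar_le hd χ k hz)
  have heq : ∑ a ∈ Icc 1 X, α a * ∑ b ∈ Icc 1 (X / a), β b * eigenvalue χ k (c * (a * b)) =
      ∑ w ∈ primarySphere c, grossenchar χ k w *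
        ∑ z ∈ primaryBall X, ∑ t ∈ primaryBall X, a' z * b' t *
          (if gnorm z * gnorm t ≤ X then jacobiKubota (w * z * t) else 0) := by
    have h1 : ∀ w : GaussianInt, ∑ z ∈ primaryBall X, ∑ t ∈ primaryBall X, a' z * b' t *
          (if gnorm z * gnorm t ≤ X then jacobiKubota (w * z * t) else 0) =
        ∑ a ∈ Icc 1 X, ∑ b ∈ Icc 1 (X / a), α a * (β b * ∑ z ∈ primarySphere a,
          ∑ t ∈ primarySphere b,
            grossenchar χ k z * grossenchar χ k t * jacobiKubota (w * z * t)) := by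
      intro w
      rw [sum_primaryBall_eq]
      refine Finset.sum_congr rfl fun a ha => ?_
      rw [mem_Icc] at ha
      have h2 : ∀ z ∈ primarySphere a, ∑ t ∈ primaryBall X, a' z * b' t *
          (if gnorm z * gnorm t ≤ X then jacobiKubota (w * z * t) else 0) =
          ∑ b ∈ Icc 1 (X / a), ∑ t ∈ primarySphere b, a' z * b' t * jacobiKubota (w * z * t) := by
        intro z hz
        rw [mem_primarySphere] at hz
        rw [sum_primaryBall_eq]
        have hsub : Icc 1 (X / a) ⊆ Icc 1 X := Icc_subset_Icc le_rfl (Nat.div_le_self _ _)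
        rw [← Finset.sum_subset hsub]
        · refine Finset.sum_congr rfl fun b hb => Finset.sum_congr rfl fun t ht => ?_
          rw [mem_Icc, Nat.le_div_iff_mul_le (by omega)] at hb
          rw [mem_primarySphere] at ht
          rw [hz.2, ht.2, if_pos (by rw [mul_comm]; exact hb.2)]
        · intro b hb hbn
          refine Finset.sum_eq_zero fun t ht => ?_
          rw [mem_primarySphere] at ht
          rw [hz.2, ht.2, if_neg, mul_zero]
          intro hle
          rw [mem_Icc] at hb
          exact hbn (mem_Icc.2 ⟨hb.1, by
            rw [Nat.le_div_iff_mul_le (by omega), mul_comm]; exact hle⟩)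
      rw [Finset.sum_congr rfl h2, Finset.sum_comm]
      refine Finset.sum_congr rfl fun b _ => ?_
      rw [Finset.mul_sum, Finset.mul_sum]
      refine Finset.sum_congr rfl fun z hz => ?_
      rw [Finset.mul_sum, Finset.mul_sum]
      refine Finset.sum_congr rfl fun t ht => ?_
      rw [mem_primarySphere] at hz ht
      rw [ha', hb']; simp only
      rw [hz.2, ht.2]; ring
    simp only [h1, eigenvalue_mul_mul, Finset.mul_sum (s := Icc 1 X)]
    rw [Finset.sum_comm]
    refine Finset.sum_congr rfl fun a _ => ?_
    simp only [Finset.mul_sum (s := Icc 1 (X / a)), Finset.mul_sum (s := primarySphere c)]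
    rw [Finset.sum_comm]
    refine Finset.sum_congr rfl fun w _ => Finset.sum_congr rfl fun b _ => ?_
    ring
  rw [heq]
  set B : ℝ := C₁ * ((X : ℝ) ^ (1 + η) * y ^ (-(1 / 12) : ℝ)) with hB
  have hB0 : 0 ≤ B := by positivity
  calc _ ≤ ∑ w ∈ primarySphere c, B := by
        refine norm_sum_le_of_le _ fun w hw => ?_
        rw [mem_primarySphere] at hw
        rw [norm_mul]
        calc _ ≤ 1 * B := mul_le_mul (norm_grossenchar_le hd χ k hw.1.ne_zero)
              (hII X y hX hy w hw.1 a' b' (hbd α hα hα0) (hbd β hβ hβ0) (hvan α hα0) (hvan β hβ0))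
              (norm_nonneg _) zero_le_one
          _ = B := one_mul B
    _ = #(primarySphere c) * B := by rw [Finset.sum_const, nsmul_eq_mul]
    _ ≤ (C₂ * (c : ℝ) ^ η) * B := by
        refine mul_le_mul_of_nonneg_right (hcard c hc _ ?_) hB0
        exact fun z hz => (mem_primarySphere.1 hz).2
    _ = _ := by rw [hB]; ring

/-! ### The final estimate -/

/-- With only the bound (cn)^η for the eigenvalue, the missing X^(1/77) and the η-powers are all
absorbed into c ≥ X. -/
theorem norm_sum_vonMangoldt_eigenvalue_trivial {η : ℝ} (hη : 0 < η) (hη1 : η ≤ 1 / 10000) :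
    ∃ C : ℝ, 1 ≤ C ∧ ∀ d : ℕ, 1 ≤ d → ∀ (χ : ResidueChar d) (k : ℤ) (c X : ℕ), 1 ≤ X → X ≤ c →
      ‖∑ n ∈ Icc 1 X, (ArithmeticFunction.vonMangoldt n : ℂ) * eigenvalue χ k (c * n)‖ ≤
        C * (c * (X : ℝ) ^ (76 / 77 : ℝ)) := by
  obtain ⟨C, hC, hcard⟩ := exists_card_gnorm_eq_le hη
  refine ⟨C / η, ?_, fun d hd χ k c X hX hXc => ?_⟩
  · rw [le_div_iff₀ hη]; linarith
  have hX' : (1 : ℝ) ≤ X := by exact_mod_cast hX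
  have hXc' : (X : ℝ) ≤ c := by exact_mod_cast hXc
  have hc' : (1 : ℝ) ≤ c := hX'.trans hXc'
  have hterm : ∀ n ∈ Icc 1 X,
      ‖(ArithmeticFunction.vonMangoldt n : ℂ) * eigenvalue χ k (c * n)‖ ≤
        (X : ℝ) ^ η / η * (C * ((c : ℝ) * X) ^ η) := by
    intro n hn
    rw [mem_Icc] at hn
    have hn1 : (1 : ℝ) ≤ n := by exact_mod_cast hn.1
    have hnX : (n : ℝ) ≤ X := by exact_mod_cast hn.2
    rw [norm_mul, Complex.norm_real, Real.norm_of_nonneg ArithmeticFunction.vonMangoldt_nonneg]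
    refine mul_le_mul ?_ ?_ (norm_nonneg _) (by positivity)
    · refine ArithmeticFunction.vonMangoldt_le_log.trans ?_
      refine (Real.log_le_log (by linarith) hnX).trans ?_
      exact Real.log_le_rpow_div (by linarith) hη
    · refine (norm_eigenvalue_le hd χ k _).trans ?_
      refine (hcard (c * n) (Nat.mul_pos (by omega) hn.1) _
        fun z hz => (mem_primarySphere.1 hz).2).trans ?_
      push_cast
      gcongr
  refine (norm_sum_le_of_le _ hterm).trans ?_
  rw [Finset.sum_const, nsmul_eq_mul, Nat.card_Icc, Nat.add_sub_cancel]
  have h1 : (X : ℝ) = (X : ℝ) ^ (76 / 77 : ℝ) * (X : ℝ) ^ (1 / 77 : ℝ) := by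
    rw [← Real.rpow_add (by linarith)]; norm_num
  calc (X : ℝ) * ((X : ℝ) ^ η / η * (C * ((c : ℝ) * X) ^ η))
      = (X : ℝ) ^ (76 / 77 : ℝ) * (X : ℝ) ^ (1 / 77 : ℝ) *
          ((X : ℝ) ^ η / η * (C * ((c : ℝ) * X) ^ η)) := by rw [← h1]
    _ = C / η * ((X : ℝ) ^ (76 / 77 : ℝ) *
          ((X : ℝ) ^ (1 / 77 : ℝ) * (X : ℝ) ^ η * (X : ℝ) ^ η * (c : ℝ) ^ η)) := by
        rw [Real.mul_rpow (by linarith) (by linarith)]; ring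
    _ ≤ C / η * ((X : ℝ) ^ (76 / 77 : ℝ) *
          ((c : ℝ) ^ (1 / 77 : ℝ) * (c : ℝ) ^ η * (c : ℝ) ^ η * (c : ℝ) ^ η)) := by gcongr
    _ ≤ C / η * ((X : ℝ) ^ (76 / 77 : ℝ) * (c : ℝ)) := by
        gcongr
        rw [← Real.rpow_add (by linarith), ← Real.rpow_add (by linarith),
          ← Real.rpow_add (by linarith)]
        calc _ ≤ (c : ℝ) ^ (1 : ℝ) := Real.rpow_le_rpow_of_exponent_le hc' (by linarith)
          _ = c := Real.rpow_one _
    _ = _ := by ring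

theorem norm_sum_vonMangoldt_eigenvalue_main {η : ℝ} (hη : 0 < η) (hη1 : η ≤ 1 / 10000) :
    ∃ C : ℝ, 1 ≤ C ∧ ∀ d : ℕ, 1 ≤ d → ∀ (χ : ResidueChar d) (k : ℤ) (c X : ℕ), 1 ≤ c → c ≤ X →
      ‖∑ n ∈ Icc 1 X, (ArithmeticFunction.vonMangoldt n : ℂ) * eigenvalue χ k (c * n)‖ ≤
        C * (c * (d * (|(k : ℝ)| + 1))) * (X : ℝ) ^ (76 / 77 : ℝ) := by
  obtain ⟨C₁, hC₁, hI⟩ := exists_sum_eigenvalue_le hη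
  obtain ⟨C₂, hC₂, hII⟩ := exists_bilinear_eigenvalue_le hη
  obtain ⟨C₃, hC₃, hcard⟩ := exists_card_gnorm_eq_le hη
  obtain ⟨C₄, hC₄, hdiv⟩ := exists_card_divisors_le hη
  set K := 1 + 1 / η with hK
  have hK1 : 1 ≤ K := by have : 0 < 1 / η := by positivity
                         linarith
  refine ⟨K * (2 * C₃ + 3 * C₁ + C₂ + C₄ * C₂), ?_, fun d hd χ k c X hc hcX => ?_⟩
  · have : 0 ≤ C₄ * C₂ := by positivity
    exact one_le_mul_of_one_le_of_one_le hK1 (by linarith)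
  have hk0 := abs_nonneg (k : ℝ)
  have hc' : (1 : ℝ) ≤ c := by exact_mod_cast hc
  have hd' : (1 : ℝ) ≤ d := by exact_mod_cast hd
  have hcX' : (c : ℝ) ≤ X := by exact_mod_cast hcX
  have hX : 1 ≤ X := hc.trans hcX
  have hX' : (1 : ℝ) ≤ X := by exact_mod_cast hX
  have hX0 : (0 : ℝ) < X := by linarith
  set P : ℝ := c * (d * (|(k : ℝ)| + 1)) with hP
  have hP1 : 1 ≤ P := one_le_mul_of_one_le_of_one_le hc'
    (one_le_mul_of_one_le_of_one_le hd' (by linarith))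
  set E : ℝ := (X : ℝ) ^ (76 / 77 : ℝ) with hE
  set t : ℝ := (X : ℝ) ^ η with ht
  -- Writing y = X^θ, type II requires θ > 12/77 and type I requires 5θ/4 + 3/4 < 76/77, that is θ <
  -- 73/385; 2/11 lies between. Then s = X^(1-θ/12) and v = X^(θ/4+3/4) are the type II and type I
  -- sizes, and t collects η-losses.
  set y : ℝ := (X : ℝ) ^ (2 / 11 : ℝ) with hy
  set v : ℝ := (X : ℝ) ^ (1 / 22 + 3 / 4 : ℝ) with hv
  set s : ℝ := (X : ℝ) ^ (65 / 66 : ℝ) with hs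
  have ht1 : 1 ≤ t := Real.one_le_rpow hX' hη.le
  have hy1 : 1 ≤ y := Real.one_le_rpow hX' (by norm_num)
  have hyX : y ≤ X := by
    calc y ≤ (X : ℝ) ^ (1 : ℝ) := Real.rpow_le_rpow_of_exponent_le hX' (by norm_num)
      _ = X := Real.rpow_one _
  have hv0 : 0 ≤ v := by positivity
  have hs0 : 0 ≤ s := by positivity
  have hE0 : 0 ≤ E := by positivity
  have hpow : ∀ (e : ℝ) (n : ℕ), e + n * η ≤ 76 / 77 → (X : ℝ) ^ e * t ^ n ≤ E := by
    intro e n he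
    rw [ht, ← Real.rpow_natCast, ← Real.rpow_mul hX0.le, ← Real.rpow_add hX0]
    exact Real.rpow_le_rpow_of_exponent_le hX' (by linarith)
  have hyt : y * t ^ 3 ≤ E := hpow _ 3 (by push_cast; linarith)
  have hyvt : y * v * t ^ 4 ≤ E := by
    have := hpow (2 / 11 + (1 / 22 + 3 / 4)) 4 (by push_cast; linarith)
    rwa [Real.rpow_add hX0] at this
  have hy3t : y ^ 3 * t ^ 3 ≤ E := by
    have := hpow (2 / 11 * (3 : ℕ)) 3 (by push_cast; linarith)
    rwa [Real.rpow_mul hX0.le, Real.rpow_natCast] at this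
  have hst4 : s * t ^ 4 ≤ E := hpow _ 4 (by push_cast; linarith)
  have hst3 : s * t ^ 3 ≤ E := hpow _ 3 (by push_cast; linarith)
  set U := ⌊y⌋₊ with hU
  have hUy : (U : ℝ) ≤ y := Nat.floor_le (by linarith)
  have htt : ∀ m n : ℕ, (m : ℝ) ≤ X → (n : ℝ) ≤ X → ((m * n : ℕ) : ℝ) ^ η ≤ t ^ 2 := by
    intro m n hm hn
    push_cast
    rw [Real.mul_rpow (by positivity) (by positivity), sq, ht]
    gcongr
  have hlog : Real.log X ≤ K * t := by
    have := Real.log_le_rpow_div (x := (X : ℝ)) hX0.le hη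
    calc Real.log X ≤ t / η := this
      _ ≤ t + t / η := by linarith
      _ = K * t := by rw [hK]; ring
  have hB₂ : C₂ * t ^ 2 * s = C₂ * (t * ((X : ℝ) ^ (1 + η) * y ^ (-(1 / 12) : ℝ))) := by
    have : (X : ℝ) ^ (1 + η) * y ^ (-(1 / 12) : ℝ) = t * s := by
      rw [hy, ht, hs, ← Real.rpow_mul hX0.le, ← Real.rpow_add hX0, ← Real.rpow_add hX0]
      congr 1; ring
    rw [this]; ring
  have hmain := norm_sum_vonMangoldt_mul_le (fun n => eigenvalue χ k (c * n)) (X := X) (U := U)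
    (T := C₃ * t ^ 2) (B₁ := C₁ * P * (t ^ 3 * v)) (B₂ := C₂ * t ^ 2 * s) (L := K * t)
    (τ := C₄ * t) (one_le_mul_of_one_le_of_one_le hK1 ht1) hlog
    (one_le_mul_of_one_le_of_one_le hC₄ ht1) ?_ (by positivity) ?_ (by positivity) ?_ ?_
  · refine hmain.trans ?_
    have hKC : 0 ≤ K * C₃ := by positivity
    have h0 : (U : ℝ) * (K * t * (C₃ * t ^ 2)) ≤ K * C₃ * (P * E) := by
      calc _ ≤ y * (K * t * (C₃ * t ^ 2)) := by gcongr
        _ = K * C₃ * (y * t ^ 3) := by ring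
        _ ≤ K * C₃ * (1 * E) := by rw [one_mul]; gcongr
        _ ≤ _ := by gcongr
    have h1 : (U : ℝ) * (2 * (K * t) * (C₁ * P * (t ^ 3 * v))) ≤ 2 * (K * C₁) * (P * E) := by
      calc _ ≤ y * (2 * (K * t) * (C₁ * P * (t ^ 3 * v))) := by gcongr
        _ = 2 * (K * C₁) * (P * (y * v * t ^ 4)) := by ring
        _ ≤ _ := by gcongr
    have h2 : K * t * ((U : ℝ) * (C₁ * P * (t ^ 3 * v))) ≤ K * C₁ * (P * E) := by
      calc _ ≤ K * t * (y * (C₁ * P * (t ^ 3 * v))) := by gcongr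
        _ = K * C₁ * (P * (y * v * t ^ 4)) := by ring
        _ ≤ _ := by gcongr
    have h3 : K * t * ((U : ℝ) ^ 3 * (C₃ * t ^ 2)) ≤ K * C₃ * (P * E) := by
      calc _ ≤ K * t * (y ^ 3 * (C₃ * t ^ 2)) := by gcongr
        _ = K * C₃ * (y ^ 3 * t ^ 3) := by ring
        _ ≤ K * C₃ * (1 * E) := by rw [one_mul]; gcongr
        _ ≤ _ := by gcongr
    have h4 : K * t * (C₂ * t ^ 2 * s) ≤ K * C₂ * (P * E) := by
      calc _ = K * C₂ * (s * t ^ 3) := by ring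
        _ ≤ K * C₂ * (1 * E) := by rw [one_mul]; gcongr
        _ ≤ _ := by gcongr
    have h5 : C₄ * t * (K * t) * (C₂ * t ^ 2 * s) ≤ K * (C₄ * C₂) * (P * E) := by
      calc _ = K * (C₄ * C₂) * (s * t ^ 4) := by ring
        _ ≤ K * (C₄ * C₂) * (1 * E) := by rw [one_mul]; gcongr
        _ ≤ _ := by gcongr
    linarith
  · intro n hn
    rw [mem_Icc] at hn
    refine (hdiv n hn.1).trans ?_
    have : (n : ℝ) ≤ X := by exact_mod_cast hn.2
    rw [ht]; gcongr
  · intro n hn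
    rw [mem_Icc] at hn
    refine (norm_eigenvalue_le hd χ k _).trans ?_
    refine (hcard (c * n) (Nat.mul_pos hc hn.1) _
      fun z hz => (mem_primarySphere.1 hz).2).trans ?_
    exact mul_le_mul_of_nonneg_left (htt c n hcX' (by exact_mod_cast hn.2)) (by linarith)
  · intro a ha Y haY
    rw [mem_Icc] at ha
    have ha1 : (1 : ℝ) ≤ a := by exact_mod_cast ha.1
    have hay : (a : ℝ) ≤ y := (by exact_mod_cast ha.2 : (a : ℝ) ≤ U).trans hUy
    have hYX : (Y : ℝ) ≤ X := by
      exact_mod_cast (Nat.le_mul_of_pos_left Y ha.1).trans haY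
    have haY' : (a : ℝ) * Y ≤ X := by exact_mod_cast haY
    refine (hI d hd χ k c a Y hc ha.1).trans ?_
    have h1 := htt c a hcX' (hay.trans hyX)
    rcases Nat.eq_zero_or_pos Y with h0 | hY
    · rw [h0, Nat.cast_zero, Real.zero_rpow (by linarith), mul_zero]; positivity
    have hY0 : (0 : ℝ) < Y := by exact_mod_cast hY
    -- The linear loss in a is partly recovered from aY ≤ X: a·Y^(3/4) = a^(1/4)(aY)^(3/4), with a ≤
    -- y.
    have h2 : (a : ℝ) * (Y : ℝ) ^ (3 / 4 + η) ≤ v * t := by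
      have h3 : (a : ℝ) = (a : ℝ) ^ (1 / 4 : ℝ) * (a : ℝ) ^ (3 / 4 : ℝ) := by
        rw [← Real.rpow_add (by linarith)]; norm_num
      have h4 : (a : ℝ) ^ (1 / 4 : ℝ) ≤ (X : ℝ) ^ (1 / 22 : ℝ) := by
        calc _ ≤ y ^ (1 / 4 : ℝ) := by gcongr
          _ = _ := by rw [hy, ← Real.rpow_mul hX0.le]; norm_num
      calc _ = (a : ℝ) ^ (1 / 4 : ℝ) * (a : ℝ) ^ (3 / 4 : ℝ) * (Y : ℝ) ^ (3 / 4 + η) := by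
            rw [← h3]
        _ = (a : ℝ) ^ (1 / 4 : ℝ) * ((a : ℝ) * Y) ^ (3 / 4 : ℝ) * (Y : ℝ) ^ η := by
            rw [Real.rpow_add hY0, Real.mul_rpow (by linarith) hY0.le]; ring
        _ ≤ (X : ℝ) ^ (1 / 22 : ℝ) * (X : ℝ) ^ (3 / 4 : ℝ) * (X : ℝ) ^ η := by gcongr
        _ = v * t := by rw [hv, ht, Real.rpow_add hX0]
    calc _ = C₁ * P * (((c * a : ℕ) : ℝ) ^ η * (a * (Y : ℝ) ^ (3 / 4 + η))) := by
          rw [hP]; push_cast; ring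
      _ ≤ C₁ * P * (t ^ 2 * (v * t)) := by gcongr
      _ = _ := by ring
  · intro α β hα hβ hα0 hβ0
    refine (hII d hd χ k c X y hc hX hy1 α β hα hβ hα0 hβ0).trans ?_
    rw [hB₂, mul_assoc]
    have : (c : ℝ) ^ η ≤ t := by rw [ht]; gcongr
    gcongr

end QuadraticEigenvalue

end

theorem mainTheorem3 :
    ∃ C : ℝ, 0 < C ∧
      ∀ (d : ℕ), 1 ≤ d → ∀ (χ : QuadraticEigenvalue.ResidueChar d) (k : ℤ) (c : ℕ), 1 ≤ c →
        ∀ x : ℝ, 0 ≤ x →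
          ‖∑ n ∈ Finset.Icc 1 ⌊x⌋₊,
              (ArithmeticFunction.vonMangoldt n : ℂ) *
                QuadraticEigenvalue.eigenvalue χ k (c * n)‖ ≤
            C * (c * (d * (|(k : ℝ)| + 1))) * x ^ (76 / 77 : ℝ) := by
  have hη : (0 : ℝ) < 1 / 10000 := by norm_num
  obtain ⟨C₁, hC₁, h₁⟩ := QuadraticEigenvalue.norm_sum_vonMangoldt_eigenvalue_trivial hη le_rfl
  obtain ⟨C₂, hC₂, h₂⟩ := QuadraticEigenvalue.norm_sum_vonMangoldt_eigenvalue_main hη le_rfl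
  refine ⟨C₁ + C₂, by linarith, fun d hd χ k c hc x hx => ?_⟩
  have hk0 := abs_nonneg (k : ℝ)
  have hd' : (1 : ℝ) ≤ d := by exact_mod_cast hd
  rcases Nat.eq_zero_or_pos ⌊x⌋₊ with h0 | hX
  · rw [h0, Finset.Icc_eq_empty (by omega), Finset.sum_empty, norm_zero]
    positivity
  have hXx : ((⌊x⌋₊ : ℕ) : ℝ) ^ (76 / 77 : ℝ) ≤ x ^ (76 / 77 : ℝ) :=
    Real.rpow_le_rpow (by positivity) (Nat.floor_le hx) (by norm_num)
  have hx0 : 0 ≤ x ^ (76 / 77 : ℝ) := by positivity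
  have hc0 : (0 : ℝ) ≤ c := by positivity
  have hP : (c : ℝ) ≤ c * (d * (|(k : ℝ)| + 1)) :=
    le_mul_of_one_le_right hc0 (one_le_mul_of_one_le_of_one_le hd' (by linarith))
  have hP0 : (0 : ℝ) ≤ c * (d * (|(k : ℝ)| + 1)) := hc0.trans hP
  -- For c ≤ x the η-powers of c are at most powers of x; for larger c the trivial bound is already
  -- below c·x^(76/77) up to a constant.
  rcases le_total c ⌊x⌋₊ with h | h
  · calc _ ≤ C₂ * (c * (d * (|(k : ℝ)| + 1))) * ((⌊x⌋₊ : ℕ) : ℝ) ^ (76 / 77 : ℝ) :=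
          h₂ d hd χ k c _ hc h
      _ ≤ (C₁ + C₂) * (c * (d * (|(k : ℝ)| + 1))) * x ^ (76 / 77 : ℝ) := by
          gcongr
          linarith
  · calc _ ≤ C₁ * (c * ((⌊x⌋₊ : ℕ) : ℝ) ^ (76 / 77 : ℝ)) := h₁ d hd χ k c _ hX h
      _ = C₁ * c * ((⌊x⌋₊ : ℕ) : ℝ) ^ (76 / 77 : ℝ) := by ring
      _ ≤ (C₁ + C₂) * (c * (d * (|(k : ℝ)| + 1))) * x ^ (76 / 77 : ℝ) := by
          gcongr
          linarith
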